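/- **Setting.** Let $I=(t_0,t_f)$ with $t_0<t_f$, $x_0\in\mathbb R^{n_x}$, and write $y=(x,u,p)\in\mathbb R^{n_y}=\mathbb R^{n_x}\times\mathbb R^{n_u}\times\mathbb R^{n_p}$. Consider the optimal control problem $$\min_{x,u,p}\ \varphi(x(t_f),p)+\int_{t_0}^{t_f} l\big(t,y(t),g(t,y(t))\big)\,dt\quad\text{s.t.}\quad x'(t)=f\big(t,y(t),g(t,y(t))\big)\ \text{a.e.},\quad x(t_0)=x_0,\qquad y(t)=(x(t),u(t),p),$$ whose solution depends on the component function $g$, and the quantity of interest $$q(x,u,p;g)=\phi(x(t_f),p)+\int_{t_0}^{t_f}\ell\big(t,y(t),g(t,y(t))\big)\,dt .$$ Component functions belong to $\mathcal G^3$, the space of $g:I\times\mathbb R^{n_y}\to\mathbb R^{n_g}$ that are measurable in $t$ for each $y$, three times continuously differentiable in $y$ for a.a. $t$, and have finite norm $\|g\|=\sum_{n=0}^{3}\operatorname{ess\,sup}_{t}\sup_y\|\partial_y^n g(t,y)\|$. Let $\mathcal Z^\infty=(W^{1,\infty}(I))^{n_x}\times(L^\infty(I))^{n_u}\times\mathbb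 R^{n_p}\times(W^{1,\infty}(I))^{n_x}$, with elements $z=(x,u,p,\lambda)$. **Smoothness.** $\varphi,\phi$ are twice continuously differentiable. Each $F\in\{f,l,\ell\}$, $F=F(t,w)$ with $w=(x,u,p,g)$, is measurable in $t$ for each $w$ and twice continuously differentiable in $w$ for a.a. $t$; there is $K$ with $\|\partial_w^sF(t,0)\|\le K$ for a.a. $t$, $s=0,1,2$; and for every $R>0$ there is $L(R)$ such that, for a.a. $t$, $\partial^s_wF(t,\cdot)$ is $L(R)$-Lipschitz on the closed ball of radius $R$ about $0$, $s=0,1,2$. **Notation.** Subscripts denote partial derivatives, $\nabla$ gradients (columns), and $H(t,y,g,\lambda)=l(t,y,g)+\lambda^Tf(t,y,g)$. Given $(\bar z,\bar g)$ with $\bar z=(\bar x,\bar u,\bar p,\bar\lambda)$, the symbol $[t]$ denotes evaluation at $\bar y(t)=(\bar x(t),\bar u(t),\bar p)$, $\bar g(t,\bar y(t))$, $\bar\lambda(t)$, and $[t_f]$ evaluation at $(\bar x(t_f),\bar p)$. Put $A=f_x+f_g\bar g_x$, $B=f_u+f_g\bar g_u$, $C=f_p+f_g\bar g_p$; and for $z,z'\in\{x,u,p\}$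 $$H_{zz'}[t]=\frac{\partial^2}{\partial z\,\partial z'}\Big(y\mapsto H\big(t,y,\bar g(t,y),\bar\lambda(t)\big)\Big)\Big|_{y=\bar y(t)},\qquad H_{zg}=\nabla^2_{zg}H+\bar g_z^T\nabla^2_{gg}H,\qquad H_{gz}=H_{zg}^T,$$ $$\bar d=\nabla_gH=f_g^T\bar\lambda+\nabla_g l .$$ **Optimality system.** $\psi(z;g)=0$, for $z=(x,u,p,\lambda)\in\mathcal Z^\infty$ and $g\in\mathcal G^3$, denotes the first-order system (all coefficients evaluated along $(z,g)$, equations in $t$ holding a.e.) $$x'=f[t],\quad x(t_0)=x_0,\quad \lambda'=-(f_x+f_gg_x)^T\lambda-(\nabla_xl+g_x^T\nabla_gl),\quad \lambda(t_f)=\nabla_x\varphi[t_f],$$ $$0=(f_u+f_gg_u)^T\lambda+\nabla_ul+g_u^T\nabla_gl,\qquad 0=\nabla_p\varphi[t_f]+\int_{t_0}^{t_f}\big((f_p+f_gg_p)^T\lambda+\nabla_pl+g_p^T\nabla_gl\big)\,dt .$$ **Second-order condition at $(\bar z,\bar g)$.** (i) The Hessian of $\varphi$ at $(\bar x(t_f),\bar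 p)$ is symmetric positive semidefinite. (ii) There is $\epsilon>0$ such that $$\int_{t_0}^{t_f}w(t)^T\big(H_{zz'}[t]\big)_{z,z'\in\{x,u,p\}}w(t)\,dt\ \ge\ \epsilon\big(\|\delta x\|_{L^2}^2+\|\delta u\|_{L^2}^2+|\delta p|^2\big),\qquad w=(\delta x,\delta u,\delta p),$$ for all $(\delta x,\delta u,\delta p)\in (W^{1,2}(I))^{n_x}\times (L^2(I))^{n_u}\times\mathbb R^{n_p}$ with $\delta x'=A\delta x+B\delta u+C\delta p$ a.e. and $\delta x(t_0)=0$. (iii) $H_{uu}[t]$ is invertible for a.a. $t$ and its inverse is essentially bounded. **Theorem.** Let the smoothness assumptions hold, and let $\bar z\in\mathcal Z^\infty$ and $\bar g\in\mathcal G^3$ satisfy $\psi(\bar z;\bar g)=0$ and the second-order condition. Then: 1. There are a neighbourhood $U$ of $\bar g$ in $\mathcal G^3$, a neighbourhood $V$ of $\bar z$ in $\mathcal Z^\infty$ and a solution mapping $g\mapsto z(g)=(x(g),u(g),p(g),\lambda(g))$ with $z(\bar g)=\bar z$ such that for each $g\in U$, $z(g)$ is the only solution in $V$ of $\psi(z;g)=0$.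 For any such mapping, $\widetilde q(g):=q(x(g),u(g),p(g);g)$ is Fréchet differentiable at $\bar g$, with derivative $\widetilde q_g(\bar g)$. 2. The adjoint equations $$\widetilde{\delta x}'=A\widetilde{\delta x}+B\widetilde{\delta u}+C\widetilde{\delta p},\qquad \widetilde{\delta x}(t_0)=0,$$ $$\widetilde{\delta\lambda}'=-A^T\widetilde{\delta\lambda}-H_{xx}\widetilde{\delta x}-H_{xu}\widetilde{\delta u}-H_{xp}\widetilde{\delta p}-\nabla_x\ell-\bar g_x^T\nabla_g\ell,$$ $$\widetilde{\delta\lambda}(t_f)=\nabla_x\phi[t_f]+\nabla^2_{xx}\varphi[t_f]\,\widetilde{\delta x}(t_f)+\nabla^2_{xp}\varphi[t_f]\,\widetilde{\delta p},$$ $$H_{ux}\widetilde{\delta x}+H_{uu}\widetilde{\delta u}+H_{up}\widetilde{\delta p}+B^T\widetilde{\delta\lambda}=-\nabla_u\ell-\bar g_u^T\nabla_g\ell,$$ $$\nabla^2_{px}\varphi[t_f]\,\widetilde{\delta x}(t_f)+\nabla^2_{pp}\varphi[t_f]\,\widetilde{\delta p}+\int_{t_0}^{t_f}\!\big(H_{px}\widetilde{\delta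 x}+H_{pu}\widetilde{\delta u}+H_{pp}\widetilde{\delta p}+C^T\widetilde{\delta\lambda}\big)dt=-\nabla_p\phi[t_f]-\int_{t_0}^{t_f}\!\big(\nabla_p\ell+\bar g_p^T\nabla_g\ell\big)dt$$ have a unique solution $(\widetilde{\delta x},\widetilde{\delta u},\widetilde{\delta p},\widetilde{\delta\lambda})\in\mathcal Z^\infty$. 3. Let $g_*\in\mathcal G^3$ and let $\varepsilon:I\to\mathbb R^{n_g}$ and $\varepsilon^z:I\to\mathbb R^{n_g\times n_z}$, $z\in\{x,u,p\}$, be integrable (for example essentially bounded) with, elementwise for a.a. $t\in I$, $$|\bar g(t,\bar y(t))-g_*(t,\bar y(t))|\le\varepsilon(t),\qquad |\bar g_z(t,\bar y(t))-(g_*)_z(t,\bar y(t))|\le\varepsilon^z(t)\quad (z\in\{x,u,p\}).$$ Then, with absolute values taken componentwise on the right-hand side, $$\big|\widetilde q_g(\bar g)(\bar g-g_*)\big|\le\int_{t_0}^{t_f}\Big|H_{gx}[t]\widetilde{\delta x}(t)+H_{gu}[t]\widetilde{\delta u}(t)+H_{gp}[t]\widetilde{\delta p}+f_g[t]^T\widetilde{\delta\lambda}(t)+\nabla_g\ell[t]\Big|^T\varepsilon(t)\,dt$$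 $$\qquad+\int_{t_0}^{t_f}\Big(|\bar d[t]|^T\varepsilon^x(t)\,|\widetilde{\delta x}(t)|+|\bar d[t]|^T\varepsilon^u(t)\,|\widetilde{\delta u}(t)|+|\bar d[t]|^T\varepsilon^p(t)\,|\widetilde{\delta p}|\Big)dt .$$ -/

import Mathlib

open MeasureTheory Set Filter Topology
open scoped ENNReal Matrix

noncomputable section

namespace OCP

/-! ### Finite-dimensional notation -/

/-- `ℝⁿ`. All norms on it are equivalent; nothing below depends on the choice. -/
abbrev Vec (n : ℕ) := Fin n → ℝ

/-- State-control-parameter triples `y = (x, u, p)`. -/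
abbrev Triple (nx nu np : ℕ) := Vec nx × Vec nu × Vec np

/-- Coordinate directions of `x`, `u`, `p` in the space of triples `(x, u, p)`. -/
def dirX (nx nu np : ℕ) (j : Fin nx) : Triple nx nu np := (Pi.single j 1, 0, 0)
/-- See `dirX`. -/
def dirU (nx nu np : ℕ) (j : Fin nu) : Triple nx nu np := (0, Pi.single j 1, 0)
/-- See `dirX`. -/
def dirP (nx nu np : ℕ) (j : Fin np) : Triple nx nu np := (0, 0, Pi.single j 1)

section Derivatives

variable {E : Type*} [NormedAddCommGroup E] [NormedSpace ℝ E] {ι κ : Type*} {m n : ℕ}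

/-- Partial Jacobian of `F` at `w` with respect to the coordinates with directions `e`. -/
def jac (F : E → Vec m) (w : E) (e : ι → E) : Matrix (Fin m) ι ℝ :=
  Matrix.of fun i j => fderiv ℝ F w (e j) i

/-- Partial gradient of `F` at `w` with respect to the coordinates with directions `e`. -/
def grad (F : E → ℝ) (w : E) (e : ι → E) : ι → ℝ := fun j => fderiv ℝ F w (e j)

/-- Block of second partial derivatives of `F` at `w` with respect to the coordinates with
directions `e` (rows) and `e'` (columns). -/
def hess (F : E → ℝ) (w : E) (e : ι → E) (e' : κ → E) : Matrix ι κ ℝ :=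
  Matrix.of fun i j => fderiv ℝ (fderiv ℝ F) w (e i) (e' j)

/-- A direction of `y`, as a direction of `(y, g)`. -/
def inY (e : ι → E) : ι → E × Vec n := fun j => (e j, 0)

/-- The coordinate directions of `g` in the space of pairs `(y, g)`. -/
def dirG : Fin n → E × Vec n := fun i => (0, Pi.single i 1)

/-- `F_z + F_g g_z` at `(y, g y)`. -/
def totalJac (F : E × Vec n → Vec m) (g : E → Vec n) (y : E) (e : ι → E) : Matrix (Fin m) ι ℝ :=
  jac F (y, g y) (inY e) + jac F (y, g y) dirG * jac g y e

/-- `∇_z F + g_zᵀ ∇_g F` at `(y, g y)`. -/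
def totalGrad (F : E × Vec n → ℝ) (g : E → Vec n) (y : E) (e : ι → E) : ι → ℝ :=
  grad F (y, g y) (inY e) + (jac g y e)ᵀ *ᵥ grad F (y, g y) dirG

end Derivatives

/-! ### Function spaces -/

/-- Lebesgue measure on the time interval `I = (t₀, t_f)`. -/
def timeMeasure (t₀ t_f : ℝ) : Measure ℝ := volume.restrict (Ioo t₀ t_f)

instance (t₀ t_f : ℝ) : IsFiniteMeasure (timeMeasure t₀ t_f) := by
  unfold timeMeasure; infer_instance

/-- `(L^q(I))ⁿ`. -/
abbrev LSpace (n : ℕ) (q : ℝ≥0∞) (t₀ t_f : ℝ) := Lp (Vec n) q (timeMeasure t₀ t_f)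

theorem LSpace.intervalIntegrable {n : ℕ} {q : ℝ≥0∞} [hq : Fact (1 ≤ q)] {t₀ t_f : ℝ}
    (v : LSpace n q t₀ t_f) (r s : Icc t₀ t_f) : IntervalIntegrable v volume r s := by
  have h : IntegrableOn v (Ioo t₀ t_f) volume := (Lp.memLp v).integrable hq.out
  rw [intervalIntegrable_iff]
  rw [← integrableOn_Icc_iff_integrableOn_Ioo] at h
  refine h.mono_set (uIoc_subset_uIcc.trans ?_)
  exact (ordConnected_Icc.uIcc_subset r.2 s.2)

theorem ae_uIoc_of_ae_timeMeasure {t₀ t_f : ℝ} {p : ℝ → Prop}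
    (h : ∀ᵐ t ∂timeMeasure t₀ t_f, p t) (r s : Icc t₀ t_f) :
    ∀ᵐ t ∂(volume : Measure ℝ), t ∈ uIoc (r : ℝ) s → p t := by
  have h' : ∀ᵐ t ∂(volume.restrict (Icc t₀ t_f)), p t := by
    rw [← restrict_Ioo_eq_restrict_Icc]; exact h
  rw [ae_restrict_iff' measurableSet_Icc] at h'
  filter_upwards [h'] with t ht hm
  exact ht ((ordConnected_Icc.uIcc_subset r.2 s.2) (uIoc_subset_uIcc hm))

/-- The Sobolev space `(W^{1,q}(I))ⁿ`: pairs `(x, x')` of a continuous function `x` on the closed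
interval and a function `x' ∈ L^q` that is its (weak, equivalently almost everywhere) derivative,
i.e. `x` is the absolutely continuous representative. It carries the norm
`max (sup |x|) ‖x'‖_{L^q}`, which is equivalent to the usual one. -/
def sobolevSubmodule (n : ℕ) (q : ℝ≥0∞) [Fact (1 ≤ q)] (t₀ t_f : ℝ) :
    Submodule ℝ (C(Icc t₀ t_f, Vec n) × LSpace n q t₀ t_f) where
  carrier := {w | ∀ r s : Icc t₀ t_f, w.1 s - w.1 r = ∫ t in (r : ℝ)..s, w.2 t}
  add_mem' := by
    intro a b ha hb r s
    have h1 : ∫ t in (r : ℝ)..s, (a + b).2 t = ∫ t in (r : ℝ)..s, (a.2 t + b.2 t) :=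
      intervalIntegral.integral_congr_ae (ae_uIoc_of_ae_timeMeasure (Lp.coeFn_add a.2 b.2) r s)
    rw [h1, intervalIntegral.integral_add (LSpace.intervalIntegrable a.2 r s)
      (LSpace.intervalIntegrable b.2 r s), ← ha r s, ← hb r s]
    simp only [Prod.fst_add, ContinuousMap.add_apply]
    abel
  zero_mem' := by
    intro r s
    have h1 : ∫ t in (r : ℝ)..s, (0 : LSpace n q t₀ t_f) t = ∫ t in (r : ℝ)..s, (0 : Vec n) :=
      intervalIntegral.integral_congr_ae
        (ae_uIoc_of_ae_timeMeasure (Lp.coeFn_zero (Vec n) q (timeMeasure t₀ t_f)) r s)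
    change (0 : Vec n) - 0 = ∫ t in (r : ℝ)..s, (0 : LSpace n q t₀ t_f) t
    rw [h1]; simp
  smul_mem' := by
    intro c a ha r s
    have h1 : ∫ t in (r : ℝ)..s, (c • a).2 t = ∫ t in (r : ℝ)..s, c • a.2 t :=
      intervalIntegral.integral_congr_ae (ae_uIoc_of_ae_timeMeasure (Lp.coeFn_smul c a.2) r s)
    rw [h1, intervalIntegral.integral_smul, ← ha r s]
    simp [smul_sub]

/-- `(W^{1,q}(I))ⁿ`. -/
abbrev WSpace (n : ℕ) (q : ℝ≥0∞) [Fact (1 ≤ q)] (t₀ t_f : ℝ) := ↥(sobolevSubmodule n q t₀ t_f)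

/-- The value `x(t)` for `t` in the closed time interval (and `0` outside). -/
def WSpace.val {n : ℕ} {q : ℝ≥0∞} [Fact (1 ≤ q)] {t₀ t_f : ℝ} (x : WSpace n q t₀ t_f)
    (t : ℝ) : Vec n :=
  open Classical in if h : t ∈ Icc t₀ t_f then x.1.1 ⟨t, h⟩ else 0

/-- The derivative `x' ∈ (L^q(I))ⁿ`. -/
def WSpace.der {n : ℕ} {q : ℝ≥0∞} [Fact (1 ≤ q)] {t₀ t_f : ℝ} (x : WSpace n q t₀ t_f) :
    LSpace n q t₀ t_f := x.1.2

/-- `∑_{k ≤ s} ess sup_t sup_y ‖∂^k g / ∂y^k (t, y)‖`, as an extended nonnegative number. -/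
def gNorm {nx nu np ng : ℕ} (t₀ t_f : ℝ) (s : ℕ) (g : ℝ → Triple nx nu np → Vec ng) : ℝ≥0∞ :=
  ∑ k ∈ Finset.range (s + 1),
    essSup (fun t => ⨆ y, ‖iteratedFDeriv ℝ k (g t) y‖ₑ) (timeMeasure t₀ t_f)

section GSpace

variable {nx nu np ng : ℕ} {t₀ t_f : ℝ} {s : ℕ}

theorem gNorm_add_le {g h : ℝ → Triple nx nu np → Vec ng}
    (hg : ∀ᵐ t ∂timeMeasure t₀ t_f, ContDiff ℝ s (g t))
    (hh : ∀ᵐ t ∂timeMeasure t₀ t_f, ContDiff ℝ s (h t)) :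
    gNorm t₀ t_f s (g + h) ≤ gNorm t₀ t_f s g + gNorm t₀ t_f s h := by
  unfold gNorm
  rw [← Finset.sum_add_distrib]
  refine Finset.sum_le_sum fun k hk => ?_
  have hk' : ((k : ℕ) : WithTop ℕ∞) ≤ (s : ℕ) := by
    exact_mod_cast Nat.lt_succ_iff.mp (Finset.mem_range.mp hk)
  refine le_trans (essSup_mono_ae ?_) (ENNReal.essSup_add_le _ _)
  filter_upwards [hg, hh] with t h1 h2
  refine iSup_le fun y => ?_
  rw [Pi.add_apply, iteratedFDeriv_add_apply (h1.of_le hk').contDiffAt (h2.of_le hk').contDiffAt]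
  have e1 := le_iSup (fun y => ‖iteratedFDeriv ℝ k (g t) y‖ₑ) y
  have e2 := le_iSup (fun y => ‖iteratedFDeriv ℝ k (h t) y‖ₑ) y
  exact (enorm_add_le (iteratedFDeriv ℝ k (g t) y) (iteratedFDeriv ℝ k (h t) y)).trans
    (add_le_add e1 e2)

theorem gNorm_smul_le (c : ℝ) {g : ℝ → Triple nx nu np → Vec ng}
    (hg : ∀ᵐ t ∂timeMeasure t₀ t_f, ContDiff ℝ s (g t)) :
    gNorm t₀ t_f s (c • g) ≤ ‖c‖ₑ * gNorm t₀ t_f s g := by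
  unfold gNorm
  rw [Finset.mul_sum]
  refine Finset.sum_le_sum fun k hk => ?_
  have hk' : ((k : ℕ) : WithTop ℕ∞) ≤ (s : ℕ) := by
    exact_mod_cast Nat.lt_succ_iff.mp (Finset.mem_range.mp hk)
  rw [← ENNReal.essSup_const_mul]
  refine essSup_mono_ae ?_
  filter_upwards [hg] with t h1
  refine iSup_le fun y => ?_
  rw [Pi.smul_apply, iteratedFDeriv_const_smul_apply (h1.of_le hk').contDiffAt, enorm_smul]
  exact mul_le_mul_right (le_iSup (fun y => ‖iteratedFDeriv ℝ k (g t) y‖ₑ) y) _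

theorem gNorm_zero : gNorm t₀ t_f s (0 : ℝ → Triple nx nu np → Vec ng) = 0 := by
  have h := gNorm_smul_le (t₀ := t₀) (t_f := t_f) (s := s) (0 : ℝ)
    (g := (0 : ℝ → Triple nx nu np → Vec ng)) (Eventually.of_forall fun _ => contDiff_zero_fun)
  simpa using h

variable (nx nu np ng t₀ t_f s) in
/-- The functions `g : I × ℝ^{n_y} → ℝ^{n_g}` that are `s` times continuously differentiable in `y`
for almost all `t`, measurable in `t` for all `y`, and of finite norm. -/
def gSubmodule : Submodule ℝ (ℝ → Triple nx nu np → Vec ng) where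
  carrier := {g | (∀ᵐ t ∂timeMeasure t₀ t_f, ContDiff ℝ s (g t)) ∧
    (∀ y, AEStronglyMeasurable (fun t => g t y) (timeMeasure t₀ t_f)) ∧ gNorm t₀ t_f s g < ∞}
  add_mem' := by
    rintro a b ⟨a1, a2, a3⟩ ⟨b1, b2, b3⟩
    refine ⟨?_, fun y => (a2 y).add (b2 y), (gNorm_add_le a1 b1).trans_lt
      (ENNReal.add_lt_top.mpr ⟨a3, b3⟩)⟩
    filter_upwards [a1, b1] with t h1 h2 using h1.add h2
  zero_mem' := ⟨Eventually.of_forall fun _ => contDiff_zero_fun,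
    fun _ => aestronglyMeasurable_const, by rw [gNorm_zero]; exact ENNReal.zero_lt_top⟩
  smul_mem' := by
    rintro c a ⟨a1, a2, a3⟩
    refine ⟨?_, fun y => (a2 y).const_smul c, (gNorm_smul_le c a1).trans_lt
      (ENNReal.mul_lt_top enorm_lt_top a3)⟩
    filter_upwards [a1] with t h1
    exact h1.const_smul c

variable (nx nu np ng t₀ t_f s) in
/-- The space `(𝒢^s(I))^{n_g}` of component functions. As usual for such spaces, functions that
agree for almost all `t` are at distance zero from each other (this is the seminormed space of
functions; neighbourhoods and Fréchet derivatives are the same as in the space of classes). -/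
def GSpace : Type := ↥(gSubmodule nx nu np ng t₀ t_f s)

instance : AddCommGroup (GSpace nx nu np ng t₀ t_f s) :=
  inferInstanceAs (AddCommGroup ↥(gSubmodule nx nu np ng t₀ t_f s))

instance : Module ℝ (GSpace nx nu np ng t₀ t_f s) :=
  inferInstanceAs (Module ℝ ↥(gSubmodule nx nu np ng t₀ t_f s))

/-- The function underlying an element of `(𝒢^s(I))^{n_g}`. -/
def GSpace.fn (g : GSpace nx nu np ng t₀ t_f s) : ℝ → Triple nx nu np → Vec ng := Subtype.val g

instance : CoeFun (GSpace nx nu np ng t₀ t_f s) (fun _ => ℝ → Triple nx nu np → Vec ng) :=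
  ⟨GSpace.fn⟩

/-- The norm of `(𝒢^s(I))^{n_g}`. -/
def GSpace.seminorm : Seminorm ℝ (GSpace nx nu np ng t₀ t_f s) :=
  Seminorm.ofSMulLE (fun g => (gNorm t₀ t_f s g).toReal)
    (by
      change (gNorm t₀ t_f s (0 : ℝ → Triple nx nu np → Vec ng)).toReal = 0
      rw [gNorm_zero]; rfl)
    (by
      intro g h
      have hg : gNorm t₀ t_f s g ≠ ∞ := g.2.2.2.ne
      have hh : gNorm t₀ t_f s h ≠ ∞ := h.2.2.2.ne
      rw [← ENNReal.toReal_add hg hh]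
      exact ENNReal.toReal_mono (ENNReal.add_ne_top.mpr ⟨hg, hh⟩) (gNorm_add_le g.2.1 h.2.1))
    (by
      intro c g
      have hg : gNorm t₀ t_f s g ≠ ∞ := g.2.2.2.ne
      rw [← toReal_enorm c, ← ENNReal.toReal_mul]
      exact ENNReal.toReal_mono (ENNReal.mul_ne_top enorm_ne_top hg) (gNorm_smul_le c g.2.1))

instance : SeminormedAddCommGroup (GSpace nx nu np ng t₀ t_f s) :=
  GSpace.seminorm.toAddGroupSeminorm.toSeminormedAddCommGroup

instance : NormedSpace ℝ (GSpace nx nu np ng t₀ t_f s) where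
  norm_smul_le c g := (map_smul_eq_mul GSpace.seminorm c g).le

end GSpace

/-! ### The optimal control problem -/

/-- Data of the problem: minimize `φ(x(t_f), p) + ∫ l(t, y(t), g(t, y(t))) dt` subject to
`x'(t) = f(t, y(t), g(t, y(t)))`, `x(t₀) = x₀`, where `y = (x, u, p)`. -/
structure Problem (nx nu np ng : ℕ) where
  t₀ : ℝ
  t_f : ℝ
  lt : t₀ < t_f
  x₀ : Vec nx
  φ : Vec nx × Vec np → ℝ
  l : ℝ → Triple nx nu np × Vec ng → ℝ
  f : ℝ → Triple nx nu np × Vec ng → Vec nx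

/-- Smoothness of an integrand or right-hand side `F(t, w)`, `w = (x, u, p, g)`: measurable in `t`,
twice continuously differentiable in `w` for almost all `t`, with derivatives of order `0, 1, 2`
that are bounded at `w = 0` and Lipschitz on bounded sets, uniformly in `t`. -/
structure Smooth {E V : Type*} [NormedAddCommGroup E] [NormedSpace ℝ E] [NormedAddCommGroup V]
    [NormedSpace ℝ V] (t₀ t_f : ℝ) (F : ℝ → E → V) : Prop where
  measurable : ∀ w, AEStronglyMeasurable (fun t => F t w) (timeMeasure t₀ t_f)
  contDiff : ∀ᵐ t ∂timeMeasure t₀ t_f, ContDiff ℝ 2 (F t)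
  bounded : ∃ K : ℝ, ∀ k ≤ 2, ∀ᵐ t ∂timeMeasure t₀ t_f, ‖iteratedFDeriv ℝ k (F t) 0‖ ≤ K
  lipschitz : ∀ R > 0, ∃ L : ℝ, ∀ k ≤ 2, ∀ᵐ t ∂timeMeasure t₀ t_f,
    ∀ w₁ ∈ Metric.closedBall (0 : E) R, ∀ w₂ ∈ Metric.closedBall (0 : E) R,
      ‖iteratedFDeriv ℝ k (F t) w₁ - iteratedFDeriv ℝ k (F t) w₂‖ ≤ L * ‖w₁ - w₂‖

namespace Problem

variable {nx nu np ng : ℕ} (P : Problem nx nu np ng)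

/-- Lebesgue measure on `I`. -/
abbrev μ : Measure ℝ := timeMeasure P.t₀ P.t_f

/-- `𝒵^∞ = (W^{1,∞})^{n_x} × (L^∞)^{n_u} × ℝ^{n_p} × (W^{1,∞})^{n_x}`, with elements
`z = (x, u, p, λ)`. -/
abbrev Z : Type :=
  WSpace nx ∞ P.t₀ P.t_f × LSpace nu ∞ P.t₀ P.t_f × Vec np × WSpace nx ∞ P.t₀ P.t_f

/-- `(𝒢³(I))^{n_g}`. -/
abbrev G : Type := GSpace nx nu np ng P.t₀ P.t_f 3

/-- `φ`, `l`, `f` are smooth enough. -/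
structure IsSmooth : Prop where
  φ : ContDiff ℝ 2 P.φ
  l : Smooth P.t₀ P.t_f P.l
  f : Smooth P.t₀ P.t_f P.f

variable {P}

/-- `x(t)`. -/
def xAt (z : P.Z) (t : ℝ) : Vec nx := z.1.val t
/-- `u(t)`. -/
def uAt (z : P.Z) (t : ℝ) : Vec nu := z.2.1 t
/-- `p`. -/
def par (z : P.Z) : Vec np := z.2.2.1
/-- `λ(t)`. -/
def costate (z : P.Z) (t : ℝ) : Vec nx := z.2.2.2.val t
/-- `y(t) = (x(t), u(t), p)`. -/
def yAt (z : P.Z) (t : ℝ) : Triple nx nu np := (xAt z t, uAt z t, par z)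
/-- `(x(t_f), p)`. -/
def endPt (z : P.Z) : Vec nx × Vec np := (xAt z P.t_f, par z)
/-- Coordinate directions of `x` and `p` in the space of pairs `(x(t_f), p)`. -/
def endX (j : Fin nx) : Vec nx × Vec np := (Pi.single j 1, 0)
/-- See `endX`. -/
def endP (j : Fin np) : Vec nx × Vec np := (0, Pi.single j 1)

variable (P)

/-- The Hamiltonian `H(t, y, g, λ) = l(t, y, g) + λᵀ f(t, y, g)`. -/
def ham (t : ℝ) (lam : Vec nx) (w : Triple nx nu np × Vec ng) : ℝ := P.l t w + lam ⬝ᵥ P.f t w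

/-- `A[t] = f_x + f_g g_x` along `z`. -/
def A (z : P.Z) (g : P.G) (t : ℝ) : Matrix (Fin nx) (Fin nx) ℝ :=
  totalJac (P.f t) (g t) (yAt z t) (dirX nx nu np)
/-- `B[t] = f_u + f_g g_u` along `z`. -/
def B (z : P.Z) (g : P.G) (t : ℝ) : Matrix (Fin nx) (Fin nu) ℝ :=
  totalJac (P.f t) (g t) (yAt z t) (dirU nx nu np)
/-- `C[t] = f_p + f_g g_p` along `z`. -/
def C (z : P.Z) (g : P.G) (t : ℝ) : Matrix (Fin nx) (Fin np) ℝ :=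
  totalJac (P.f t) (g t) (yAt z t) (dirP nx nu np)

/-- `f_g[t]` along `z`. -/
def fg (z : P.Z) (g : P.G) (t : ℝ) : Matrix (Fin nx) (Fin ng) ℝ :=
  jac (P.f t) (yAt z t, g t (yAt z t)) dirG

/-- `d[t] = ∇_g H = f_gᵀ λ + ∇_g l` along `z`. -/
def d (z : P.Z) (g : P.G) (t : ℝ) : Vec ng :=
  (P.fg z g t)ᵀ *ᵥ costate z t + grad (P.l t) (yAt z t, g t (yAt z t)) dirG

/-- The reduced Hamiltonian `y ↦ H(t, y, g(t, y), λ(t))`. -/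
def redHam (z : P.Z) (g : P.G) (t : ℝ) (y : Triple nx nu np) : ℝ :=
  P.ham t (costate z t) (y, g t y)

/-- `H_{zz'}[t]`: second derivatives of the reduced Hamiltonian at `y(t)`. By the chain rule
`H_{zz'} = ∇²_{zz'} H + ∇²_{zg} H g_{z'} + g_zᵀ ∇²_{gz'} H + g_zᵀ ∇²_{gg} H g_{z'} + ∑ᵢ dᵢ ∇²_{zz'} gᵢ`. -/
def HH {ι κ : Type*} (z : P.Z) (g : P.G) (t : ℝ) (e : ι → Triple nx nu np)
    (e' : κ → Triple nx nu np) : Matrix ι κ ℝ :=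
  hess (P.redHam z g t) (yAt z t) e e'

/-- `H_{zg}[t] = ∇²_{zg} H + g_zᵀ ∇²_{gg} H`. -/
def HG {ι : Type*} (z : P.Z) (g : P.G) (t : ℝ) (e : ι → Triple nx nu np) : Matrix ι (Fin ng) ℝ :=
  hess (P.ham t (costate z t)) (yAt z t, g t (yAt z t)) (inY e) dirG +
    (jac (g t) (yAt z t) e)ᵀ *
      hess (P.ham t (costate z t)) (yAt z t, g t (yAt z t)) dirG dirG

/-- The first-order necessary optimality system `ψ(z; g) = 0`. -/
structure IsKKT (z : P.Z) (g : P.G) : Prop where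
  state : ∀ᵐ t ∂P.μ, z.1.der t = P.f t (yAt z t, g t (yAt z t))
  init : xAt z P.t₀ = P.x₀
  adjoint : ∀ᵐ t ∂P.μ, z.2.2.2.der t =
    -((P.A z g t)ᵀ *ᵥ costate z t) - totalGrad (P.l t) (g t) (yAt z t) (dirX nx nu np)
  final : costate z P.t_f = grad P.φ (endPt z) endX
  control : ∀ᵐ t ∂P.μ,
    (P.B z g t)ᵀ *ᵥ costate z t + totalGrad (P.l t) (g t) (yAt z t) (dirU nx nu np) = 0
  param : grad P.φ (endPt z) endP +
    ∫ t, ((P.C z g t)ᵀ *ᵥ costate z t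
      + totalGrad (P.l t) (g t) (yAt z t) (dirP nx nu np)) ∂P.μ = 0

/-- The second-order sufficient optimality condition at `(z, g)`. -/
structure SecondOrder (z : P.Z) (g : P.G) : Prop where
  terminal : (Matrix.fromBlocks
    (hess P.φ (endPt z) endX endX) (hess P.φ (endPt z) endX endP)
    (hess P.φ (endPt z) endP endX) (hess P.φ (endPt z) endP endP)).PosSemidef
  /-- `D²(w, w)` is the quadratic form `wᵀ (H_{zz'}[t]) w` with `w = (δx(t), δu(t), δp)`. -/
  coercive : ∃ ε > 0, ∀ (δx : WSpace nx 2 P.t₀ P.t_f) (δu : LSpace nu 2 P.t₀ P.t_f) (δp : Vec np),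
    δx.val P.t₀ = 0 →
    (∀ᵐ t ∂P.μ, δx.der t =
      P.A z g t *ᵥ δx.val t + P.B z g t *ᵥ δu t + P.C z g t *ᵥ δp) →
    ε * ((∫ t, δx.val t ⬝ᵥ δx.val t ∂P.μ) + (∫ t, δu t ⬝ᵥ δu t ∂P.μ) + δp ⬝ᵥ δp) ≤
      ∫ t, fderiv ℝ (fderiv ℝ (P.redHam z g t)) (yAt z t)
        (δx.val t, δu t, δp) (δx.val t, δu t, δp) ∂P.μ
  /-- `H_uu[t]` is invertible with inverse bounded (entrywise) uniformly in `t`. -/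
  legendre : ∃ M : ℝ, ∀ᵐ t ∂P.μ,
    IsUnit (P.HH z g t (dirU nx nu np) (dirU nx nu np)) ∧
      ∀ i j, |(P.HH z g t (dirU nx nu np) (dirU nx nu np))⁻¹ i j| ≤ M

/-- `sol` is a local solution mapping `g ↦ z(g) = (x(g), u(g), p(g), λ(g))` of the optimality
system through `(z̄, ḡ)`: for `g` in a neighbourhood of `ḡ`, `sol g` is the only solution of
`ψ(z; g) = 0` in a neighbourhood of `z̄`. Values away from `ḡ` are irrelevant. -/
def IsSolutionMap (zbar : P.Z) (gbar : P.G) (sol : P.G → P.Z) : Prop :=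
  sol gbar = zbar ∧ ∃ U ∈ 𝓝 gbar, ∃ V ∈ 𝓝 zbar, ∀ g ∈ U,
    sol g ∈ V ∧ P.IsKKT (sol g) g ∧ ∀ z ∈ V, P.IsKKT z g → z = sol g

/-! ### The quantity of interest -/

/-- `q(x, u, p; g) = ϕ(x(t_f), p) + ∫ ℓ(t, y(t), g(t, y(t))) dt`. -/
def qoi (ϕ : Vec nx × Vec np → ℝ) (ell : ℝ → Triple nx nu np × Vec ng → ℝ) (z : P.Z) (g : P.G) :
    ℝ :=
  ϕ (endPt z) + ∫ t, ell t (yAt z t, g t (yAt z t)) ∂P.μ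

/-- `w = (δx, δu, δp, δλ)` solves the adjoint equations of the quantity of interest at `(z, g)`. -/
structure IsAdjoint (ϕ : Vec nx × Vec np → ℝ) (ell : ℝ → Triple nx nu np × Vec ng → ℝ)
    (z : P.Z) (g : P.G) (w : P.Z) : Prop where
  state : ∀ᵐ t ∂P.μ, w.1.der t =
    P.A z g t *ᵥ xAt w t + P.B z g t *ᵥ uAt w t + P.C z g t *ᵥ par w
  init : xAt w P.t₀ = 0
  adjoint : ∀ᵐ t ∂P.μ, w.2.2.2.der t =
    -((P.A z g t)ᵀ *ᵥ costate w t)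
      - P.HH z g t (dirX nx nu np) (dirX nx nu np) *ᵥ xAt w t
      - P.HH z g t (dirX nx nu np) (dirU nx nu np) *ᵥ uAt w t
      - P.HH z g t (dirX nx nu np) (dirP nx nu np) *ᵥ par w
      - totalGrad (ell t) (g t) (yAt z t) (dirX nx nu np)
  final : costate w P.t_f = grad ϕ (endPt z) endX
    + hess P.φ (endPt z) endX endX *ᵥ xAt w P.t_f + hess P.φ (endPt z) endX endP *ᵥ par w
  control : ∀ᵐ t ∂P.μ,
    P.HH z g t (dirU nx nu np) (dirX nx nu np) *ᵥ xAt w t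
      + P.HH z g t (dirU nx nu np) (dirU nx nu np) *ᵥ uAt w t
      + P.HH z g t (dirU nx nu np) (dirP nx nu np) *ᵥ par w
      + (P.B z g t)ᵀ *ᵥ costate w t =
    -totalGrad (ell t) (g t) (yAt z t) (dirU nx nu np)
  param : hess P.φ (endPt z) endP endX *ᵥ xAt w P.t_f
      + hess P.φ (endPt z) endP endP *ᵥ par w
      + ∫ t, (P.HH z g t (dirP nx nu np) (dirX nx nu np) *ᵥ xAt w t
        + P.HH z g t (dirP nx nu np) (dirU nx nu np) *ᵥ uAt w t
        + P.HH z g t (dirP nx nu np) (dirP nx nu np) *ᵥ par w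
        + (P.C z g t)ᵀ *ᵥ costate w t) ∂P.μ =
    -grad ϕ (endPt z) endP - ∫ t, totalGrad (ell t) (g t) (yAt z t) (dirP nx nu np) ∂P.μ

/-- `H_{gx} δx + H_{gu} δu + H_{gp} δp + f_gᵀ δλ + ∇_g ℓ` at time `t`, with `H_{gz} = H_{zg}ᵀ`. -/
def coeff (ell : ℝ → Triple nx nu np × Vec ng → ℝ) (z : P.Z) (g : P.G) (w : P.Z) (t : ℝ) :
    Vec ng :=
  (P.HG z g t (dirX nx nu np))ᵀ *ᵥ xAt w t + (P.HG z g t (dirU nx nu np))ᵀ *ᵥ uAt w t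
    + (P.HG z g t (dirP nx nu np))ᵀ *ᵥ par w + (P.fg z g t)ᵀ *ᵥ costate w t
    + grad (ell t) (yAt z t, g t (yAt z t)) dirG

end Problem

/-- Componentwise absolute value of a vector. -/
def absVec {ι : Type*} (v : ι → ℝ) : ι → ℝ := fun i => |v i|

end OCP

end

/-!
The optimality system is an equation `ψ(z, g) = 0` between Banach spaces (`psi_eq_zero_iff`). All
its nonlinearity sits in the superposition operator `nem`, which sends `(z, g)` to the right-hand
side of the state equation and to the `y`-derivative of the reduced Hamiltonian along the
trajectory, and in the terminal cost. Three bounded derivatives of `g` in `y` and Lipschitz second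
derivatives of the data make the pointwise jets of `y ↦ F(t, y, g(t, y))` Lipschitz in `(y, g)`,
uniformly in `t` (`exists_pairEstimate`). Hence `ψ` is strictly differentiable in `z`, uniformly for
`g` near `ḡ` (`exists_psi_strict`), and its residual at `z̄` is Lipschitz in `g`
(`exists_psi_lipschitz`).

The linearization at `(z̄, ḡ)` is an isomorphism. It is injective by Green's formula and coercivity
(`lin_injective`). For surjectivity, the control is eliminated by the essentially bounded inverse of
`H_uu`; what remains is a linear differential equation for `(x, λ)`, solvable for any initial
multiplier and any parameter. These finitely many data may be exchanged for the transversality and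
parameter conditions, which have the same dimension, because the kernel is trivial
(`surjective_prod_of_bijective_prod`, `lin_bijective`). An inverse function argument with a
parameter (`exists_locally_unique_solution`) then yields locally unique solutions `z(g)`, Lipschitz
at `ḡ`. The adjoint equations have the same operator (`lin_eq_adjointData_iff`), so they are
uniquely solvable.

The quantity of interest is differentiated without differentiating `z(g)`. Green's formula is
applied to `z(g) - z̄` with the adjoint solution `w` and to `w` with `z(g) - z̄`; by symmetry of the
Hessians, the difference of the two identities expresses the linear part of the quantity of interest
by `w` and by the linearization defects of `ψ` alone (`duality`). Expanding the defects to first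
order in `g - ḡ` leaves remainders of order `o(‖g - ḡ‖)`, by the Lipschitz bound for `z(g)`
(`hasFDerivAt_qoi`). The derivative is the functional `sensitivity`, an integral of the value and
the Jacobians of its argument along the reference trajectory, from which the bound follows
componentwise (`abs_sensitivity_le`).
-/

namespace OCP

/-! ### Measurability of superposition operators -/

section Superposition

variable {α E V : Type*} [MeasurableSpace α] {μ : Measure α}

/-- A Carathéodory function composed with a measurable function is measurable. -/
theorem aestronglyMeasurable_superposition [TopologicalSpace E] [NormedAddCommGroup V]
    {h : α → E → V} {y : α → E} (hm : ∀ e, AEStronglyMeasurable (fun t => h t e) μ)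
    (hc : ∀ᵐ t ∂μ, Continuous (h t)) (hy : AEStronglyMeasurable y μ) :
    AEStronglyMeasurable (fun t => h t (y t)) μ := by
  obtain ⟨y', hy', hyy⟩ := hy
  have key : ∀ s : SimpleFunc α E, AEStronglyMeasurable (fun t => h t (s t)) μ := by
    intro s
    have : (fun t => h t (s t)) =
        fun t => ∑ c ∈ s.range, (s ⁻¹' {c}).indicator (fun t => h t c) t := by
      funext t
      rw [Finset.sum_eq_single (s t)]
      · simp
      · intro c _ hc
        exact indicator_of_notMem (fun h => hc (by simpa using h.symm)) _
      · intro h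
        exact absurd (s.mem_range_self t) h
    rw [this]
    exact Finset.aestronglyMeasurable_fun_sum _ fun c _ =>
      (hm c).indicator (s.measurableSet_fiber c)
  refine aestronglyMeasurable_of_tendsto_ae atTop (fun n => key (hy'.approx n)) ?_
  filter_upwards [hc, hyy] with t h1 h2
  rw [h2]
  exact (h1.tendsto _).comp (hy'.tendsto_approx t)

variable [NormedAddCommGroup E] [NormedSpace ℝ E] [FiniteDimensional ℝ E]
  [NormedAddCommGroup V] [NormedSpace ℝ V]

/-- For operators on a finite-dimensional space, strong measurability is measurability. -/
theorem aestronglyMeasurable_clm_of_apply {A : α → E →L[ℝ] V}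
    (h : ∀ v, AEStronglyMeasurable (fun t => A t v) μ) : AEStronglyMeasurable A μ := by
  let b := Module.finBasis ℝ E
  have : A = fun t => ∑ i, ContinuousLinearMap.smulRightL ℝ E V
      (LinearMap.toContinuousLinearMap (b.coord i)) (A t (b i)) := by
    funext t
    ext v
    conv_lhs => rw [← b.sum_repr v, map_sum]
    simp
  rw [this]
  exact Finset.aestronglyMeasurable_fun_sum _ fun i _ =>
    (ContinuousLinearMap.continuous _).comp_aestronglyMeasurable (h (b i))

/-- Derivatives of Carathéodory functions are measurable, as limits of difference quotients. -/
theorem aestronglyMeasurable_fderiv {h : α → E → V}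
    (hm : ∀ e, AEStronglyMeasurable (fun t => h t e) μ)
    (hd : ∀ᵐ t ∂μ, Differentiable ℝ (h t)) (y : E) :
    AEStronglyMeasurable (fun t => fderiv ℝ (h t) y) μ := by
  refine aestronglyMeasurable_clm_of_apply fun v => ?_
  refine aestronglyMeasurable_of_tendsto_ae atTop
    (f := fun (n : ℕ) t => (n : ℝ) • (h t (y + (n : ℝ)⁻¹ • v) - h t y))
    (fun n => ((hm _).sub (hm _)).const_smul _) ?_
  filter_upwards [hd] with t ht
  have := ((ht y).hasFDerivAt.lim v (c := fun n : ℕ => (n : ℝ)) (l := atTop)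
    (by simpa using tendsto_natCast_atTop_atTop))
  simpa using this

end Superposition

/-! ### Integration by parts and initial value problems -/

/-- Integration by parts for two primitives of integrable functions. -/
theorem integral_mul_add_mul_of_primitive {a b : ℝ} (hab : a ≤ b) {x y x' y' : ℝ → ℝ}
    (hx' : IntervalIntegrable x' volume a b) (hy' : IntervalIntegrable y' volume a b)
    (hx : ∀ t ∈ Icc a b, x t = x a + ∫ s in a..t, x' s)
    (hy : ∀ t ∈ Icc a b, y t = y a + ∫ s in a..t, y' s) :
    ∫ t in a..b, (x' t * y t + x t * y' t) = x b * y b - x a * y a := by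
  have hX := hx'.absolutelyContinuousOnInterval_intervalIntegral (c := a) (by simp)
  have hY := hy'.absolutelyContinuousOnInterval_intervalIntegral (c := a) (by simp)
  have hcst : ∀ c : ℝ, AbsolutelyContinuousOnInterval (fun _ : ℝ => c) a b := fun c =>
    (LipschitzWith.const c).lipschitzOnWith.absolutelyContinuousOnInterval
  have := ((hcst (x a)).add hX).integral_deriv_mul_eq_sub ((hcst (y a)).add hY)
  rw [hx b ⟨hab, le_rfl⟩, hy b ⟨hab, le_rfl⟩]
  simp only [Pi.add_apply, intervalIntegral.integral_same, add_zero] at this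
  rw [← this]
  refine intervalIntegral.integral_congr_ae ?_
  filter_upwards [hx'.ae_hasDerivAt_integral, hy'.ae_hasDerivAt_integral] with t h1 h2 ht
  rw [uIoc_of_le hab] at ht
  have ht' : t ∈ uIcc a b := by rw [uIcc_of_le hab]; exact Ioc_subset_Icc_self ht
  have d1 := ((hasDerivAt_const t (x a)).add (h1 ht' a (by simp))).deriv
  have d2 := ((hasDerivAt_const t (y a)).add (h2 ht' a (by simp))).deriv
  simp only [Pi.add_def, zero_add] at d1 d2 ⊢
  rw [d1, d2, hx t (Ioc_subset_Icc_self ht), hy t (Ioc_subset_Icc_self ht)]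

theorem intervalIntegrable_of_integrable_timeMeasure {V : Type*} [NormedAddCommGroup V]
    {t₀ t_f : ℝ} {f : ℝ → V} (hf : Integrable f (timeMeasure t₀ t_f)) (r s : Icc t₀ t_f) :
    IntervalIntegrable f volume r s := by
  have h : IntegrableOn f (Icc t₀ t_f) volume := by
    rw [integrableOn_Icc_iff_integrableOn_Ioo]; exact hf
  rw [intervalIntegrable_iff]
  exact h.mono_set (uIoc_subset_uIcc.trans (ordConnected_Icc.uIcc_subset r.2 s.2))

theorem intervalIntegral_eq_integral_timeMeasure {V : Type*} [NormedAddCommGroup V]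
    [NormedSpace ℝ V] {t₀ t_f : ℝ} (h : t₀ ≤ t_f) (f : ℝ → V) :
    ∫ t in t₀..t_f, f t = ∫ t, f t ∂timeMeasure t₀ t_f := by
  rw [intervalIntegral.integral_of_le h, integral_Ioc_eq_integral_Ioo, timeMeasure]

section Picard

theorem integrable_of_lipschitz_of_bounded {V : Type*} [NormedAddCommGroup V] {t₀ t_f : ℝ}
    {m : ℝ → V → V} {c K : ℝ}
    (hm : ∀ v, AEStronglyMeasurable (fun t => m t v) (timeMeasure t₀ t_f))
    (hL : ∀ᵐ t ∂timeMeasure t₀ t_f, ∀ v w, ‖m t v - m t w‖ ≤ c * ‖v - w‖)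
    (hK : ∀ᵐ t ∂timeMeasure t₀ t_f, ‖m t 0‖ ≤ K) (hc : 0 ≤ c) {ξ : ℝ → V} (hξ : Continuous ξ) :
    Integrable (fun t => m t (ξ t)) (timeMeasure t₀ t_f) := by
  have hcont : ∀ᵐ t ∂timeMeasure t₀ t_f, Continuous (m t) := by
    filter_upwards [hL] with t ht
    exact (LipschitzWith.of_dist_le_mul (K := ⟨c, hc⟩)
      (fun v w => by rw [dist_eq_norm, dist_eq_norm]; exact ht v w)).continuous
  have hmeas := aestronglyMeasurable_superposition hm hcont
    (hξ.aestronglyMeasurable (μ := timeMeasure t₀ t_f))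
  obtain ⟨B, hB⟩ := (isCompact_Icc (a := t₀) (b := t_f)).exists_bound_of_continuousOn
    hξ.continuousOn
  refine Integrable.of_bound hmeas (K + c * B) ?_
  have hI : ∀ᵐ t ∂timeMeasure t₀ t_f, t ∈ Ioo t₀ t_f := ae_restrict_mem measurableSet_Ioo
  filter_upwards [hL, hK, hI] with t h1 h2 h3
  calc ‖m t (ξ t)‖ = ‖m t 0 + (m t (ξ t) - m t 0)‖ := by congr 1; abel
    _ ≤ ‖m t 0‖ + ‖m t (ξ t) - m t 0‖ := norm_add_le _ _
    _ ≤ K + c * B := by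
        have := h1 (ξ t) 0
        rw [sub_zero] at this
        have h4 := mul_le_mul_of_nonneg_left (hB t (Ioo_subset_Icc_self h3)) hc
        linarith

variable {V : Type*} [NormedAddCommGroup V] [NormedSpace ℝ V] [CompleteSpace V] {t₀ t_f : ℝ}

/-- Carathéodory's existence and uniqueness theorem for a right-hand side that is globally
Lipschitz in the state: the Picard operator is a contraction for an exponentially weighted
supremum norm. -/
theorem existsUnique_integral_solution (h : t₀ ≤ t_f) {m : ℝ → V → V} {c K : ℝ}
    (hm : ∀ v, AEStronglyMeasurable (fun t => m t v) (timeMeasure t₀ t_f))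
    (hL : ∀ᵐ t ∂timeMeasure t₀ t_f, ∀ v w, ‖m t v - m t w‖ ≤ c * ‖v - w‖)
    (hK : ∀ᵐ t ∂timeMeasure t₀ t_f, ‖m t 0‖ ≤ K) (v₀ : V) :
    ∃! ξ : C(Icc t₀ t_f, V), ∀ t : Icc t₀ t_f,
      ξ t = v₀ + ∫ s in t₀..t, m s (IccExtend h ξ s) := by
  wlog hc : 0 < c generalizing c
  · refine this (c := 1) ?_ one_pos
    filter_upwards [hL] with t ht v w
    exact (ht v w).trans (mul_le_mul_of_nonneg_right (by linarith) (norm_nonneg _))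
  set γ : ℝ := 2 * c with hγ
  let a : Icc t₀ t_f := ⟨t₀, le_rfl, h⟩
  have hII : ∀ ξ : ℝ → V, Continuous ξ → ∀ r s : Icc t₀ t_f,
      IntervalIntegrable (fun t => m t (ξ t)) volume r s := fun ξ hξ =>
    intervalIntegrable_of_integrable_timeMeasure
      (integrable_of_lipschitz_of_bounded hm hL hK hc.le hξ)
  have hprim : ∀ ξ : ℝ → V, Continuous ξ →
      Continuous (fun t : Icc t₀ t_f => ∫ s in t₀..t, m s (ξ s)) := by
    intro ξ hξ
    have h1 := hII ξ hξ a ⟨t_f, h, le_rfl⟩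
    have h2 := intervalIntegral.continuousOn_primitive_interval' h1 (a := t₀) (by simp [a])
    simp only [a, uIcc_of_le h] at h2
    exact continuousOn_iff_continuous_domRestrict.mp h2
  -- The weight `exp (γ (s - t₀))` makes the integral operator a contraction on the whole interval.
  let W : C(Icc t₀ t_f, V) → ℝ → V := fun η s => Real.exp (γ * (s - t₀)) • IccExtend h η s
  have hW : ∀ η, Continuous (W η) := fun η => by
    have : Continuous (IccExtend h (η : Icc t₀ t_f → V)) := η.continuous.Icc_extend'
    fun_prop
  let N : C(Icc t₀ t_f, V) → C(Icc t₀ t_f, V) := fun η =>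
    ⟨fun t => Real.exp (-(γ * (t - t₀))) • (v₀ + ∫ s in t₀..t, m s (W η s)), by
      have := hprim _ (hW η)
      fun_prop⟩
  have hN : ContractingWith (1 / 2) N := by
    refine ⟨by rw [← NNReal.coe_lt_coe]; norm_num, LipschitzWith.of_dist_le_mul fun η₁ η₂ => ?_⟩
    rw [dist_eq_norm, dist_eq_norm]
    refine (ContinuousMap.norm_le _ (by positivity)).2 fun t => ?_
    have hd : ‖(∫ s in t₀..t, m s (W η₁ s)) - ∫ s in t₀..t, m s (W η₂ s)‖ ≤
        ∫ s in t₀..t, c * (Real.exp (γ * (s - t₀)) * ‖η₁ - η₂‖) := by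
      rw [← intervalIntegral.integral_sub (hII _ (hW η₁) a t) (hII _ (hW η₂) a t)]
      refine intervalIntegral.norm_integral_le_of_norm_le t.2.1 ?_
        (by apply Continuous.intervalIntegrable; fun_prop)
      filter_upwards [ae_uIoc_of_ae_timeMeasure hL a t] with s hs hst
      rw [← uIoc_of_le t.2.1] at hst
      refine (hs hst _ _).trans (mul_le_mul_of_nonneg_left ?_ hc.le)
      simp only [W]
      rw [← smul_sub, norm_smul, Real.norm_of_nonneg (Real.exp_nonneg _)]
      exact mul_le_mul_of_nonneg_left ((η₁ - η₂).norm_coe_le_norm (projIcc t₀ t_f h s))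
        (Real.exp_nonneg _)
    have hint : ∫ s in t₀..t, c * (Real.exp (γ * (s - t₀)) * ‖η₁ - η₂‖) =
        (Real.exp (γ * (t - t₀)) - 1) * (1 / 2 * ‖η₁ - η₂‖) := by
      have : ∀ s ∈ uIcc t₀ (t : ℝ), HasDerivAt
          (fun s => Real.exp (γ * (s - t₀)) * (1 / 2 * ‖η₁ - η₂‖))
          (c * (Real.exp (γ * (s - t₀)) * ‖η₁ - η₂‖)) s := by
        intro s _
        have := ((((hasDerivAt_id s).sub_const t₀).const_mul γ).exp).mul_const
          (1 / 2 * ‖η₁ - η₂‖)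
        refine this.congr_deriv ?_
        simp only [id, hγ]; ring
      rw [intervalIntegral.integral_eq_sub_of_hasDerivAt this
        (by apply Continuous.intervalIntegrable; fun_prop)]
      simp; ring
    rw [hint] at hd
    have he : (N η₁ - N η₂) t = Real.exp (-(γ * (t - t₀))) •
        ((∫ s in t₀..t, m s (W η₁ s)) - ∫ s in t₀..t, m s (W η₂ s)) := by
      simp only [N, ContinuousMap.sub_apply, ContinuousMap.coe_mk, ← smul_sub]
      congr 1; abel
    rw [he, norm_smul, Real.norm_of_nonneg (Real.exp_nonneg _)]
    calc _ ≤ Real.exp (-(γ * (t - t₀))) *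
          ((Real.exp (γ * (t - t₀)) - 1) * (1 / 2 * ‖η₁ - η₂‖)) := by gcongr
      _ = (1 - Real.exp (-(γ * (t - t₀)))) * (1 / 2 * ‖η₁ - η₂‖) := by
          rw [← mul_assoc, mul_sub, ← Real.exp_add]; simp
      _ ≤ 1 * (1 / 2 * ‖η₁ - η₂‖) := by
          gcongr
          linarith [Real.exp_nonneg (-(γ * ((t : ℝ) - t₀)))]
      _ = _ := by simp
  -- Fixed points of `N` correspond to solutions by `ξ t = exp (γ (t - t₀)) • η t`.
  let up : C(Icc t₀ t_f, V) → C(Icc t₀ t_f, V) := fun η =>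
    ⟨fun t => Real.exp (γ * (t - t₀)) • η t, by fun_prop⟩
  let down : C(Icc t₀ t_f, V) → C(Icc t₀ t_f, V) := fun ξ =>
    ⟨fun t => Real.exp (-(γ * (t - t₀))) • ξ t, by fun_prop⟩
  have hdu : ∀ ξ, up (down ξ) = ξ := fun ξ => by
    ext t; simp [up, down, smul_smul, ← Real.exp_add]
  have hWup : ∀ η (t : Icc t₀ t_f), ∫ s in t₀..t, m s (IccExtend h (up η) s) =
      ∫ s in t₀..t, m s (W η s) := by
    intro η t
    refine intervalIntegral.integral_congr fun s hs => ?_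
    have hs' : s ∈ Icc t₀ t_f := (ordConnected_Icc.uIcc_subset a.2 t.2) hs
    simp only [W, IccExtend_of_mem h _ hs']
    rfl
  have hiff : ∀ η, (∀ t : Icc t₀ t_f, up η t = v₀ + ∫ s in t₀..t, m s (IccExtend h (up η) s)) ↔
      N η = η := by
    intro η
    rw [ContinuousMap.ext_iff]
    refine forall_congr' fun t => ?_
    rw [hWup]
    simp only [up, N, ContinuousMap.coe_mk]
    constructor
    · intro h; rw [← h, smul_smul, ← Real.exp_add]; simp
    · intro h; nth_rewrite 1 [← h]; rw [smul_smul, ← Real.exp_add]; simp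
  have : Nonempty C(Icc t₀ t_f, V) := ⟨0⟩
  refine ⟨up (hN.fixedPoint N), (hiff _).2 hN.fixedPoint_isFixedPt, fun ξ hξ => ?_⟩
  have : N (down ξ) = down ξ := (hiff _).1 (by rw [hdu]; exact hξ)
  rw [← hN.fixedPoint_unique this, hdu]

end Picard

end OCP

namespace OCP

/-! ### Two abstract solvability principles -/

/-- Shooting: if `T₁` together with the data `J` in a finite-dimensional space determines a point,
then the data may be exchanged for any other data `T₂` of the same dimension, as soon as `T₁` and
`T₂` together have trivial kernel. -/
theorem surjective_prod_of_bijective_prod {Z Y W : Type*} [AddCommGroup Z] [Module ℝ Z]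
    [AddCommGroup Y] [Module ℝ Y] [AddCommGroup W] [Module ℝ W] [FiniteDimensional ℝ W]
    (T₁ : Z →ₗ[ℝ] Y) (T₂ J : Z →ₗ[ℝ] W) (hJ : Function.Bijective (T₁.prod J))
    (hinj : ∀ z, T₁ z = 0 → T₂ z = 0 → z = 0) : Function.Surjective (T₁.prod T₂) := by
  let E := LinearEquiv.ofBijective (T₁.prod J) hJ
  have hE : ∀ y w, T₁ (E.symm (y, w)) = y ∧ J (E.symm (y, w)) = w := fun y w => by
    have : E (E.symm (y, w)) = (y, w) := E.apply_symm_apply _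
    exact Prod.ext_iff.mp this
  let B : W →ₗ[ℝ] W := T₂ ∘ₗ E.symm.toLinearMap ∘ₗ LinearMap.inr ℝ Y W
  have hB : Function.Injective B := by
    refine (injective_iff_map_eq_zero B).2 fun w hw => ?_
    have h0 := hinj (E.symm (0, w)) (hE 0 w).1 hw
    rw [← (hE 0 w).2, h0, map_zero]
  rintro ⟨y, w⟩
  obtain ⟨v, hv⟩ := LinearMap.injective_iff_surjective.1 hB (w - T₂ (E.symm (y, 0)))
  refine ⟨E.symm (y, 0) + E.symm (0, v), Prod.ext ?_ ?_⟩
  · simp [(hE y 0).1, (hE 0 v).1]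
  · have : T₂ (E.symm (0, v)) = w - T₂ (E.symm (y, 0)) := hv
    simp [this]

/-- A local solution theorem for `ψ z g = 0`, with a parameter `g` in a metric space: if the partial
maps `ψ · g` are strictly approximated by an invertible operator, uniformly for `g` near `gbar`,
and `ψ zbar ·` is Lipschitz at `gbar`, then there is a locally unique solution, which is Lipschitz
at `gbar`. -/
theorem exists_locally_unique_solution {Z Y G : Type*} [NormedAddCommGroup Z] [NormedSpace ℝ Z]
    [CompleteSpace Z] [NormedAddCommGroup Y] [NormedSpace ℝ Y] [PseudoMetricSpace G]
    (T : Z ≃L[ℝ] Y) {ψ : Z → G → Y} {zbar : Z} {gbar : G} (h0 : ψ zbar gbar = 0)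
    (hstrict : ∀ c > 0, ∃ δ > 0, ∀ g, dist g gbar < δ → ∀ z₁ ∈ Metric.ball zbar δ,
      ∀ z₂ ∈ Metric.ball zbar δ, ‖ψ z₁ g - ψ z₂ g - T (z₁ - z₂)‖ ≤ c * ‖z₁ - z₂‖)
    (hlip : ∃ K, ∀ᶠ g in 𝓝 gbar, ‖ψ zbar g‖ ≤ K * dist g gbar) :
    ∃ r > 0, ∃ C : ℝ, ∃ sol : G → Z, sol gbar = zbar ∧ ∀ᶠ g in 𝓝 gbar,
      sol g ∈ Metric.ball zbar r ∧ ψ (sol g) g = 0 ∧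
      (∀ z ∈ Metric.ball zbar r, ψ z g = 0 → z = sol g) ∧
      ‖sol g - zbar‖ ≤ C * dist g gbar := by
  classical
  set κ : ℝ := ‖(T.symm : Y →L[ℝ] Z)‖ + 1 with hκ
  have hκ0 : 0 < κ := by positivity
  have hT : ∀ y, ‖T.symm y‖ ≤ κ * ‖y‖ := fun y =>
    ((T.symm : Y →L[ℝ] Z).le_opNorm y).trans
      (mul_le_mul_of_nonneg_right (by rw [hκ]; linarith) (norm_nonneg _))
  obtain ⟨δ, hδ, hs⟩ := hstrict (1 / (2 * κ)) (by positivity)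
  obtain ⟨K, hK⟩ := hlip
  -- With the constant `1 / (2κ)`, the map `ψ · g` is bounded below near `zbar`: this gives
  -- uniqueness and the Lipschitz bound.
  have hanti : ∀ g, dist g gbar < δ → ∀ z₁ ∈ Metric.ball zbar δ, ∀ z₂ ∈ Metric.ball zbar δ,
      ‖z₁ - z₂‖ ≤ 2 * κ * ‖ψ z₁ g - ψ z₂ g‖ := by
    intro g hg z₁ h1 z₂ h2
    have e1 := hs g hg z₁ h1 z₂ h2
    have e2 := hT (T (z₁ - z₂))
    rw [T.symm_apply_apply] at e2
    have e3 : ‖T (z₁ - z₂)‖ ≤ ‖ψ z₁ g - ψ z₂ g‖ + 1 / (2 * κ) * ‖z₁ - z₂‖ := by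
      have := norm_sub_norm_le (T (z₁ - z₂)) (ψ z₁ g - ψ z₂ g)
      rw [norm_sub_rev (T (z₁ - z₂))] at this
      linarith
    have e4 := e2.trans (mul_le_mul_of_nonneg_left e3 hκ0.le)
    rw [mul_add, ← mul_assoc, show κ * (1 / (2 * κ)) = 1 / 2 by field_simp] at e4
    linarith
  have hz : zbar ∈ Metric.ball zbar δ := Metric.mem_ball_self hδ
  have huniq : ∀ g, dist g gbar < δ → ∀ z₁ ∈ Metric.ball zbar δ, ∀ z₂ ∈ Metric.ball zbar δ,
      ψ z₁ g = 0 → ψ z₂ g = 0 → z₁ = z₂ := by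
    intro g hg z₁ h1 z₂ h2 e1 e2
    have := hanti g hg z₁ h1 z₂ h2
    rw [e1, e2, sub_zero, norm_zero, mul_zero] at this
    exact sub_eq_zero.1 (norm_le_zero_iff.1 this)
  have hex : ∀ᶠ g in 𝓝 gbar, ∃ z ∈ Metric.ball zbar δ, ψ z g = 0 := by
    have hsmall : ∀ᶠ g in 𝓝 gbar, K * dist g gbar < (κ⁻¹ - 1 / (2 * κ)) * (δ / 2) := by
      have : Tendsto (fun g => K * dist g gbar) (𝓝 gbar) (𝓝 (K * dist gbar gbar)) :=
        tendsto_const_nhds.mul (tendsto_id.dist tendsto_const_nhds)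
      rw [dist_self, mul_zero] at this
      refine this.eventually (gt_mem_nhds ?_)
      rw [show κ⁻¹ - 1 / (2 * κ) = 1 / (2 * κ) by field_simp; norm_num]
      positivity
    filter_upwards [hK, hsmall, Metric.ball_mem_nhds gbar hδ] with g h1 h2 h3
    -- Existence: `ψ · g` maps a ball onto a ball that contains `0`.
    let inv : (T : Z →L[ℝ] Y).NonlinearRightInverse :=
      { toFun := T.symm, nnnorm := ⟨κ, hκ0.le⟩, bound' := hT,
        right_inv' := fun y => T.apply_symm_apply y }
    have happ : ApproximatesLinearOn (fun z => ψ z g) (T : Z →L[ℝ] Y) (Metric.ball zbar δ)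
        ⟨1 / (2 * κ), by positivity⟩ := fun z₁ e1 z₂ e2 => hs g h3 z₁ e1 z₂ e2
    obtain ⟨z, hz1, hz2⟩ := happ.surjOn_closedBall_of_nonlinearRightInverse inv
      (ε := δ / 2) (by positivity)
      (Metric.closedBall_subset_ball (by linarith)) (a := 0) (by
        rw [Metric.mem_closedBall, dist_zero_left]
        exact h1.trans h2.le)
    exact ⟨z, Metric.closedBall_subset_ball (by linarith) hz1, hz2⟩
  let sol : G → Z := fun g =>
    if h : ∃ z ∈ Metric.ball zbar δ, ψ z g = 0 then h.choose else zbar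
  have hsol : ∀ g, (∃ z ∈ Metric.ball zbar δ, ψ z g = 0) →
      sol g ∈ Metric.ball zbar δ ∧ ψ (sol g) g = 0 := fun g h => by
    simp only [sol, dif_pos h]; exact h.choose_spec
  have hbar := hsol gbar ⟨zbar, hz, h0⟩
  refine ⟨δ, hδ, 2 * κ * K, sol,
    huniq gbar (by rwa [dist_self]) _ hbar.1 _ hz hbar.2 h0, ?_⟩
  filter_upwards [hex, hK, Metric.ball_mem_nhds gbar hδ] with g h1 h2 h3
  obtain ⟨e1, e2⟩ := hsol g h1
  refine ⟨e1, e2, fun z hz1 hz2 => huniq g h3 z hz1 _ e1 hz2 e2, ?_⟩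
  have := hanti g h3 _ e1 _ hz
  rw [e2, zero_sub, norm_neg] at this
  rw [mul_assoc]
  exact this.trans (mul_le_mul_of_nonneg_left h2 (by positivity))

end OCP

noncomputable section

namespace OCP

/-! ### Estimates for compositions `y ↦ F (y, g y)` -/

section Pointwise

variable {E Γ V V₁ V₂ V₃ : Type*} [NormedAddCommGroup E] [NormedSpace ℝ E] [NormedAddCommGroup Γ]
  [NormedSpace ℝ Γ] [NormedAddCommGroup V] [NormedSpace ℝ V]
  [NormedAddCommGroup V₁] [NormedSpace ℝ V₁] [NormedAddCommGroup V₂] [NormedSpace ℝ V₂]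
  [NormedAddCommGroup V₃] [NormedSpace ℝ V₃]

/-- `a` and `b` are bounded by `C` and at distance at most `C * s`. Pairs of this kind are stable
under the operations from which derivatives of compositions are formed. -/
structure CloseBdd {W : Type*} [NormedAddCommGroup W] (s C : ℝ) (a b : W) : Prop where
  left : ‖a‖ ≤ C
  right : ‖b‖ ≤ C
  sub : ‖a - b‖ ≤ C * s

namespace CloseBdd

variable {W : Type*} [NormedAddCommGroup W] {s C C' : ℝ}

theorem nonneg {a b : W} (h : CloseBdd s C a b) : 0 ≤ C := (norm_nonneg _).trans h.left

theorem mono {a b : W} (h : CloseBdd s C a b) (hs : 0 ≤ s) (hC : C ≤ C') : CloseBdd s C' a b :=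
  ⟨h.left.trans hC, h.right.trans hC, h.sub.trans (mul_le_mul_of_nonneg_right hC hs)⟩

theorem const (hs : 0 ≤ s) (a : W) : CloseBdd s ‖a‖ a a :=
  ⟨le_rfl, le_rfl, by rw [sub_self, norm_zero]; positivity⟩

theorem add {a b a' b' : W} (h : CloseBdd s C a b) (h' : CloseBdd s C' a' b') :
    CloseBdd s (C + C') (a + a') (b + b') :=
  ⟨(norm_add_le _ _).trans (add_le_add h.left h'.left),
    (norm_add_le _ _).trans (add_le_add h.right h'.right), by
    rw [add_sub_add_comm, add_mul]
    exact (norm_add_le _ _).trans (add_le_add h.sub h'.sub)⟩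

theorem bilin (L : V₁ →L[ℝ] V₂ →L[ℝ] V₃) (hL : ‖L‖ ≤ 1) (hs : 0 ≤ s) {a b : V₁} {a' b' : V₂}
    (h : CloseBdd s C a b) (h' : CloseBdd s C' a' b') :
    CloseBdd s (2 * (C * C')) (L a a') (L b b') := by
  have hl : ∀ v w, ‖L v w‖ ≤ ‖v‖ * ‖w‖ := fun v w =>
    (L.le_opNorm₂ v w).trans (by
      have : 0 ≤ ‖v‖ * ‖w‖ := by positivity
      nlinarith)
  have h0 := h.nonneg
  have h0' := h'.nonneg
  have h00 : 0 ≤ C * C' := by positivity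
  refine ⟨?_, ?_, ?_⟩
  · have := (hl a a').trans (mul_le_mul h.left h'.left (norm_nonneg _) h0)
    linarith
  · have := (hl b b').trans (mul_le_mul h.right h'.right (norm_nonneg _) h0)
    linarith
  · have e : L a a' - L b b' = L (a - b) a' + L b (a' - b') := by simp
    rw [e]
    have e1 := (hl (a - b) a').trans (mul_le_mul h.sub h'.left (norm_nonneg _) (by positivity))
    have e2 := (hl b (a' - b')).trans (mul_le_mul h.right h'.sub (norm_nonneg _) h0)
    calc _ ≤ _ := norm_add_le _ _
      _ ≤ C * s * C' + C * (C' * s) := add_le_add e1 e2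
      _ = _ := by ring

theorem comp (hs : 0 ≤ s) {a b : V₂ →L[ℝ] V₃} {a' b' : V₁ →L[ℝ] V₂}
    (h : CloseBdd s C a b) (h' : CloseBdd s C' a' b') :
    CloseBdd s (2 * (C * C')) (a ∘L a') (b ∘L b') :=
  bilin (ContinuousLinearMap.compL ℝ V₁ V₂ V₃) (ContinuousLinearMap.norm_compL_le ..) hs h h'

theorem compL {a b : V₂ →L[ℝ] V₃} (h : CloseBdd s C a b) :
    CloseBdd s C (ContinuousLinearMap.compL ℝ V₁ V₂ V₃ a)
      (ContinuousLinearMap.compL ℝ V₁ V₂ V₃ b) := by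
  have key : ∀ c : V₂ →L[ℝ] V₃, ‖ContinuousLinearMap.compL ℝ V₁ V₂ V₃ c‖ ≤ ‖c‖ := fun c =>
    ContinuousLinearMap.opNorm_le_bound _ (norm_nonneg _) fun d =>
      ContinuousLinearMap.opNorm_comp_le c d
  refine ⟨(key a).trans h.left, (key b).trans h.right, ?_⟩
  rw [← map_sub]
  exact (key _).trans h.sub

theorem compL_flip {a b : V₁ →L[ℝ] V₂} (h : CloseBdd s C a b) :
    CloseBdd s C ((ContinuousLinearMap.compL ℝ V₁ V₂ V₃).flip a)
      ((ContinuousLinearMap.compL ℝ V₁ V₂ V₃).flip b) := by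
  have key : ∀ c : V₁ →L[ℝ] V₂, ‖(ContinuousLinearMap.compL ℝ V₁ V₂ V₃).flip c‖ ≤ ‖c‖ :=
    fun c => ContinuousLinearMap.opNorm_le_bound _ (norm_nonneg _) fun d => by
      rw [mul_comm]; exact ContinuousLinearMap.opNorm_comp_le d c
  refine ⟨(key a).trans h.left, (key b).trans h.right, ?_⟩
  rw [← map_sub]
  exact (key _).trans h.sub

/-- The form in which the second derivative of a composition is built from the derivatives `D`, `Q`
of the outer and `J`, `A` of the inner function. -/
theorem secondDeriv {CA CJ CQ : ℝ} (hs : 0 ≤ s) {D D' : V₁ →L[ℝ] V₂} {A A' : V →L[ℝ] V →L[ℝ] V₁}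
    {J J' : V →L[ℝ] V₁} {Q Q' : V₁ →L[ℝ] V₁ →L[ℝ] V₂} (hD : CloseBdd s C D D')
    (hA : CloseBdd s CA A A') (hJ : CloseBdd s CJ J J') (hQ : CloseBdd s CQ Q Q') :
    CloseBdd s (2 * (C * CA) + 2 * (CJ * (2 * (CQ * CJ))))
      (ContinuousLinearMap.compL ℝ V V₁ V₂ D ∘L A +
        (ContinuousLinearMap.compL ℝ V V₁ V₂).flip J ∘L (Q ∘L J))
      (ContinuousLinearMap.compL ℝ V V₁ V₂ D' ∘L A' +
        (ContinuousLinearMap.compL ℝ V V₁ V₂).flip J' ∘L (Q' ∘L J')) := by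
  exact (comp hs hD.compL hA).add (comp hs hJ.compL_flip (hQ.comp hs hJ))

end CloseBdd

/-- Bounds for the outer function of a composition, on a ball of radius `ρ`. -/
structure OuterBound (F : E → V) (ρ K : ℝ) : Prop where
  contDiff : ContDiff ℝ 2 F
  bdd₀ : ∀ w ∈ Metric.closedBall (0 : E) ρ, ‖F w‖ ≤ K
  bdd₁ : ∀ w ∈ Metric.closedBall (0 : E) ρ, ‖fderiv ℝ F w‖ ≤ K
  bdd₂ : ∀ w ∈ Metric.closedBall (0 : E) ρ, ‖fderiv ℝ (fderiv ℝ F) w‖ ≤ K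
  lip₀ : ∀ w ∈ Metric.closedBall (0 : E) ρ, ∀ w' ∈ Metric.closedBall (0 : E) ρ,
    ‖F w - F w'‖ ≤ K * ‖w - w'‖
  lip₁ : ∀ w ∈ Metric.closedBall (0 : E) ρ, ∀ w' ∈ Metric.closedBall (0 : E) ρ,
    ‖fderiv ℝ F w - fderiv ℝ F w'‖ ≤ K * ‖w - w'‖
  lip₂ : ∀ w ∈ Metric.closedBall (0 : E) ρ, ∀ w' ∈ Metric.closedBall (0 : E) ρ,
    ‖fderiv ℝ (fderiv ℝ F) w - fderiv ℝ (fderiv ℝ F) w'‖ ≤ K * ‖w - w'‖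

/-- Global bounds for the inner function of a composition. -/
structure InnerBound (g : E → Γ) (K : ℝ) : Prop where
  contDiff : ContDiff ℝ 3 g
  bdd₀ : ∀ y, ‖g y‖ ≤ K
  bdd₁ : ∀ y, ‖fderiv ℝ g y‖ ≤ K
  bdd₂ : ∀ y, ‖fderiv ℝ (fderiv ℝ g) y‖ ≤ K
  lip₂ : ∀ y y', ‖fderiv ℝ (fderiv ℝ g) y - fderiv ℝ (fderiv ℝ g) y'‖ ≤ K * ‖y - y'‖

theorem InnerBound.mono {g : E → Γ} {K K' : ℝ} (h : InnerBound g K) (hK : K ≤ K') :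
    InnerBound g K' :=
  ⟨h.contDiff, fun y => (h.bdd₀ y).trans hK, fun y => (h.bdd₁ y).trans hK,
    fun y => (h.bdd₂ y).trans hK, fun y y' => (h.lip₂ y y').trans (by gcongr)⟩

theorem InnerBound.nonneg {g : E → Γ} {K : ℝ} (h : InnerBound g K) : 0 ≤ K :=
  (norm_nonneg _).trans (h.bdd₀ 0)

theorem norm_sub_le_of_norm_fderiv_le {h : E → V} {K : ℝ} (hd : Differentiable ℝ h)
    (hK : ∀ y, ‖fderiv ℝ h y‖ ≤ K) (y₁ y₂ : E) : ‖h y₁ - h y₂‖ ≤ K * ‖y₁ - y₂‖ :=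
  convex_univ.norm_image_sub_le_of_norm_fderiv_le (fun y _ => hd y) (fun y _ => hK y)
    (mem_univ _) (mem_univ _)

theorem norm_sub_le_mul_add {W : Type*} [NormedAddCommGroup W] {a b c : W} {K d δ : ℝ}
    (hK : 0 ≤ K) (hd : 0 ≤ d) (hδ : 0 ≤ δ) (h₁ : ‖a - b‖ ≤ K * d) (h₂ : ‖b - c‖ ≤ δ) :
    ‖a - c‖ ≤ (K + 1) * (d + δ) := by
  have := norm_sub_le_norm_sub_add_norm_sub a b c
  nlinarith [mul_nonneg hK hδ]

/-- The second-order jets of two inner functions are bounded, and close to each other in terms of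
the distances of the base points and of the functions. -/
theorem InnerBound.closeBdd {g₁ g₂ : E → Γ} {K δ : ℝ} (h₁ : InnerBound g₁ K)
    (h₂ : InnerBound g₂ K) (h : InnerBound (fun y => g₁ y - g₂ y) δ) (y₁ y₂ : E) :
    CloseBdd (‖y₁ - y₂‖ + δ) (K + 1) (g₁ y₁) (g₂ y₂) ∧
    CloseBdd (‖y₁ - y₂‖ + δ) (K + 1) (fderiv ℝ g₁ y₁) (fderiv ℝ g₂ y₂) ∧
    CloseBdd (‖y₁ - y₂‖ + δ) (K + 1) (fderiv ℝ (fderiv ℝ g₁) y₁)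
      (fderiv ℝ (fderiv ℝ g₂) y₂) := by
  have hK := h₁.nonneg
  have hδ := h.nonneg
  have c1 : ContDiff ℝ 2 (fderiv ℝ g₁) := h₁.contDiff.fderiv_right (by norm_num)
  have c2 : ContDiff ℝ 2 (fderiv ℝ g₂) := h₂.contDiff.fderiv_right (by norm_num)
  have d1 : fderiv ℝ (fun y => g₁ y - g₂ y) = fun y => fderiv ℝ g₁ y - fderiv ℝ g₂ y := by
    funext y
    exact fderiv_fun_sub (h₁.contDiff.differentiable (by norm_num) y)
      (h₂.contDiff.differentiable (by norm_num) y)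
  have d2 : fderiv ℝ (fderiv ℝ (fun y => g₁ y - g₂ y)) =
      fun y => fderiv ℝ (fderiv ℝ g₁) y - fderiv ℝ (fderiv ℝ g₂) y := by
    funext y
    rw [d1]
    exact fderiv_fun_sub (c1.differentiable (by norm_num) y)
      (c2.differentiable (by norm_num) y)
  refine ⟨⟨(h₁.bdd₀ _).trans (by linarith), (h₂.bdd₀ _).trans (by linarith),
      norm_sub_le_mul_add hK (norm_nonneg _) hδ (norm_sub_le_of_norm_fderiv_le
        (h₁.contDiff.differentiable (by norm_num)) h₁.bdd₁ y₁ y₂) (h.bdd₀ y₂)⟩,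
    ⟨(h₁.bdd₁ _).trans (by linarith), (h₂.bdd₁ _).trans (by linarith),
      norm_sub_le_mul_add hK (norm_nonneg _) hδ (norm_sub_le_of_norm_fderiv_le
        (c1.differentiable (by norm_num)) h₁.bdd₂ y₁ y₂) ?_⟩,
    ⟨(h₁.bdd₂ _).trans (by linarith), (h₂.bdd₂ _).trans (by linarith),
      norm_sub_le_mul_add hK (norm_nonneg _) hδ (h₁.lip₂ y₁ y₂) ?_⟩⟩
  · have := h.bdd₁ y₂; rwa [d1] at this
  · have := h.bdd₂ y₂; rwa [d2] at this

/-- The derivative of `y ↦ (y, g y)`. -/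
def graphDeriv (g : E → Γ) (y : E) : E →L[ℝ] E × Γ :=
  ContinuousLinearMap.inl ℝ E Γ + ContinuousLinearMap.inr ℝ E Γ ∘L fderiv ℝ g y

theorem graphDeriv_apply (g : E → Γ) (y e : E) : graphDeriv g y e = (e, fderiv ℝ g y e) := by
  simp [graphDeriv]

theorem hasFDerivAt_graph {g : E → Γ} {y : E} (hg : DifferentiableAt ℝ g y) :
    HasFDerivAt (fun y => (y, g y)) (graphDeriv g y) y := by
  have : graphDeriv g y = (ContinuousLinearMap.id ℝ E).prod (fderiv ℝ g y) := by
    ext e <;> simp [graphDeriv_apply]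
  rw [this]
  exact (hasFDerivAt_id y).prodMk hg.hasFDerivAt

theorem fderiv_comp_graph {F : E × Γ → V} {g : E → Γ} {y : E}
    (hF : DifferentiableAt ℝ F (y, g y)) (hg : DifferentiableAt ℝ g y) :
    fderiv ℝ (fun y => F (y, g y)) y = fderiv ℝ F (y, g y) ∘L graphDeriv g y :=
  (hF.hasFDerivAt.comp y (hasFDerivAt_graph hg)).fderiv

theorem contDiff_comp_graph {F : E × Γ → V} {g : E → Γ} (hF : ContDiff ℝ 2 F)
    (hg : ContDiff ℝ 2 g) : ContDiff ℝ 2 (fun y => F (y, g y)) :=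
  hF.comp (contDiff_id.prodMk hg)

theorem fderiv_fderiv_comp_graph {F : E × Γ → V} {g : E → Γ} (hF : ContDiff ℝ 2 F)
    (hg : ContDiff ℝ 2 g) (y : E) :
    fderiv ℝ (fderiv ℝ (fun y => F (y, g y))) y =
      ContinuousLinearMap.compL ℝ E (E × Γ) V (fderiv ℝ F (y, g y)) ∘L
        (ContinuousLinearMap.compL ℝ E Γ (E × Γ) (ContinuousLinearMap.inr ℝ E Γ) ∘L
          fderiv ℝ (fderiv ℝ g) y) +
      (ContinuousLinearMap.compL ℝ E (E × Γ) V).flip (graphDeriv g y) ∘L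
        (fderiv ℝ (fderiv ℝ F) (y, g y) ∘L graphDeriv g y) := by
  have hF1 : ContDiff ℝ 1 (fderiv ℝ F) := hF.fderiv_right (by norm_num)
  have hg1 : ContDiff ℝ 1 (fderiv ℝ g) := hg.fderiv_right (by norm_num)
  have h1 : fderiv ℝ (fun y => F (y, g y)) =
      fun y => fderiv ℝ F (y, g y) ∘L graphDeriv g y := by
    funext y
    exact fderiv_comp_graph (hF.differentiable (by norm_num) _)
      (hg.differentiable (by norm_num) _)
  rw [h1]
  have h2 : HasFDerivAt (fun y => fderiv ℝ F (y, g y))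
      (fderiv ℝ (fderiv ℝ F) (y, g y) ∘L graphDeriv g y) y :=
    ((hF1.differentiable (by norm_num) (y, g y)).hasFDerivAt.comp y
      (hasFDerivAt_graph (hg.differentiable (by norm_num) y)))
  have h3 : HasFDerivAt (graphDeriv g)
      (ContinuousLinearMap.compL ℝ E Γ (E × Γ) (ContinuousLinearMap.inr ℝ E Γ) ∘L
          fderiv ℝ (fderiv ℝ g) y) y :=
    ((ContinuousLinearMap.compL ℝ E Γ (E × Γ)
      (ContinuousLinearMap.inr ℝ E Γ)).hasFDerivAt.comp y
      (hg1.differentiable (by norm_num) y).hasFDerivAt).const_add _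
  exact (h2.clm_comp h3).fderiv

/-- The second-order jets of `y ↦ F (y, g y)` depend in a Lipschitz way on `y` and `g`. -/
theorem exists_closeBdd_comp_graph (ρ K : ℝ) (hK : 0 ≤ K) (hρ : ρ ≤ K) :
    ∃ C, 0 ≤ C ∧ ∀ (F : E × Γ → V) (g₁ g₂ : E → Γ) (δ : ℝ), OuterBound F ρ K →
      InnerBound g₁ ρ → InnerBound g₂ ρ → InnerBound (fun y => g₁ y - g₂ y) δ →
      ∀ y₁ ∈ Metric.closedBall (0 : E) ρ, ∀ y₂ ∈ Metric.closedBall (0 : E) ρ,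
        CloseBdd (‖y₁ - y₂‖ + δ) C (F (y₁, g₁ y₁)) (F (y₂, g₂ y₂)) ∧
        CloseBdd (‖y₁ - y₂‖ + δ) C (fderiv ℝ (fun y => F (y, g₁ y)) y₁)
          (fderiv ℝ (fun y => F (y, g₂ y)) y₂) ∧
        CloseBdd (‖y₁ - y₂‖ + δ) C (fderiv ℝ (fderiv ℝ (fun y => F (y, g₁ y))) y₁)
          (fderiv ℝ (fderiv ℝ (fun y => F (y, g₂ y))) y₂) := by
  set C₀ := K * (K + 1) + K
  set CJ := 1 + 2 * (1 * (K + 1))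
  set C₁ := 2 * (C₀ * CJ)
  set C₂ := 2 * (C₀ * (2 * (1 * (K + 1)))) + 2 * (CJ * (2 * (C₀ * CJ)))
  have hC₀ : 0 ≤ C₀ := by positivity
  refine ⟨max C₀ (max C₁ C₂), le_max_of_le_left hC₀, ?_⟩
  intro F g₁ g₂ δ hF h₁ h₂ h y₁ hy₁ y₂ hy₂
  obtain ⟨i0, i1, i2⟩ := (h₁.mono hρ).closeBdd (h₂.mono hρ) h y₁ y₂
  have hδ := h.nonneg
  set s := ‖y₁ - y₂‖ + δ with hs
  have hs0 : 0 ≤ s := by positivity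
  have hmem : ∀ {g : E → Γ}, InnerBound g ρ → ∀ {y}, y ∈ Metric.closedBall (0 : E) ρ →
      (y, g y) ∈ Metric.closedBall (0 : E × Γ) ρ := by
    intro g hg y hy
    rw [mem_closedBall_zero_iff] at hy ⊢
    exact max_le hy (hg.bdd₀ y)
  have hw : ‖(y₁, g₁ y₁) - (y₂, g₂ y₂)‖ ≤ (K + 1) * s := by
    refine max_le ?_ i0.sub
    change ‖y₁ - y₂‖ ≤ _
    nlinarith [norm_nonneg (y₁ - y₂)]
  have hb : K ≤ C₀ := by
    have : 0 ≤ K * (K + 1) := by positivity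
    linarith
  have hwC : K * ‖(y₁, g₁ y₁) - (y₂, g₂ y₂)‖ ≤ C₀ * s := by
    calc _ ≤ K * ((K + 1) * s) := mul_le_mul_of_nonneg_left hw hK
      _ ≤ C₀ * s := by
        rw [← mul_assoc]
        exact mul_le_mul_of_nonneg_right (by linarith) hs0
  have m1 := hmem h₁ hy₁
  have m2 := hmem h₂ hy₂
  have hinr : ‖ContinuousLinearMap.inr ℝ E Γ‖ ≤ 1 := ContinuousLinearMap.norm_inr_le_one ℝ E Γ
  have hinl : ‖ContinuousLinearMap.inl ℝ E Γ‖ ≤ 1 := ContinuousLinearMap.norm_inl_le_one ℝ E Γ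
  have o0 : CloseBdd s C₀ (F (y₁, g₁ y₁)) (F (y₂, g₂ y₂)) :=
    ⟨(hF.bdd₀ _ m1).trans hb, (hF.bdd₀ _ m2).trans hb, (hF.lip₀ _ m1 _ m2).trans hwC⟩
  have o1 : CloseBdd s C₀ ((fderiv ℝ F) (y₁, g₁ y₁)) ((fderiv ℝ F) (y₂, g₂ y₂)) :=
    ⟨(hF.bdd₁ _ m1).trans hb, (hF.bdd₁ _ m2).trans hb, (hF.lip₁ _ m1 _ m2).trans hwC⟩
  have o2 : CloseBdd s C₀ ((fderiv ℝ (fderiv ℝ F)) (y₁, g₁ y₁))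
      ((fderiv ℝ (fderiv ℝ F)) (y₂, g₂ y₂)) :=
    ⟨(hF.bdd₂ _ m1).trans hb, (hF.bdd₂ _ m2).trans hb, (hF.lip₂ _ m1 _ m2).trans hwC⟩
  have cinr := (CloseBdd.const hs0 (ContinuousLinearMap.inr ℝ E Γ)).mono hs0 hinr
  have hJ : CloseBdd s CJ (graphDeriv g₁ y₁) (graphDeriv g₂ y₂) :=
    ((CloseBdd.const hs0 (ContinuousLinearMap.inl ℝ E Γ)).mono hs0 hinl).add (cinr.comp hs0 i1)
  have g1 := h₁.contDiff.of_le (show (2 : WithTop ℕ∞) ≤ 3 by norm_num)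
  have g2 := h₂.contDiff.of_le (show (2 : WithTop ℕ∞) ≤ 3 by norm_num)
  refine ⟨o0.mono hs0 (le_max_left _ _), ?_, ?_⟩
  · rw [fderiv_comp_graph (hF.contDiff.differentiable (by norm_num) _)
      (g1.differentiable (by norm_num) _),
      fderiv_comp_graph (hF.contDiff.differentiable (by norm_num) _)
      (g2.differentiable (by norm_num) _)]
    exact (o1.comp hs0 hJ).mono hs0 ((le_max_left _ _).trans (le_max_right _ _))
  · rw [fderiv_fderiv_comp_graph hF.contDiff g1, fderiv_fderiv_comp_graph hF.contDiff g2]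
    exact (o1.secondDeriv hs0 (cinr.compL.comp hs0 i2) hJ o2).mono hs0
      ((le_max_right C₁ C₂).trans (le_max_right _ _))

/-- A function whose derivative is close to `A` on a segment is close to being affine there. -/
theorem norm_sub_sub_le_of_segment {h : E → V} {A : E →L[ℝ] V} {c : ℝ} {y₁ y₂ : E}
    (hd : Differentiable ℝ h) (hc : ∀ y ∈ segment ℝ y₂ y₁, ‖fderiv ℝ h y - A‖ ≤ c) :
    ‖h y₁ - h y₂ - A (y₁ - y₂)‖ ≤ c * ‖y₁ - y₂‖ :=
  (convex_segment y₂ y₁).norm_image_sub_le_of_norm_fderiv_le' (fun y _ => hd y) hc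
    (left_mem_segment ℝ y₂ y₁) (right_mem_segment ℝ y₂ y₁)

theorem norm_sub_le_of_mem_segment {y₁ y₂ y z : E} (hy : y ∈ segment ℝ y₂ y₁) :
    ‖y - z‖ ≤ ‖y₁ - z‖ + ‖y₂ - z‖ := by
  have : y ∈ Metric.closedBall z (‖y₁ - z‖ + ‖y₂ - z‖) :=
    (convex_closedBall z _).segment_subset
      (by rw [mem_closedBall_iff_norm]; linarith [norm_nonneg (y₁ - z)])
      (by rw [mem_closedBall_iff_norm]; linarith [norm_nonneg (y₂ - z)]) hy
  exact mem_closedBall_iff_norm.1 this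

/-- The derivative of the derivative of `y ↦ F (y, g y)` with respect to `g`, in direction `γ`. -/
def variation (F : E × Γ → V) (g γ : E → Γ) (y : E) : E →L[ℝ] V :=
  fderiv ℝ (fderiv ℝ F) (y, g y) (0, γ y) ∘L graphDeriv g y +
    fderiv ℝ F (y, g y) ∘L (ContinuousLinearMap.inr ℝ E Γ ∘L fderiv ℝ γ y)

/-- Quantitative first-order expansions of `y ↦ F (y, g y)` and of its derivative, jointly in
`y` and `g`; here `δ` measures the distance of `g₁` and `g₂`. -/
structure PairEstimate (F : E × Γ → V) (g₁ g₂ : E → Γ) (R C δ : ℝ) : Prop where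
  contDiff : ContDiff ℝ 2 (fun y => F (y, g₁ y))
  bdd₀ : ∀ y ∈ Metric.closedBall (0 : E) R, ‖F (y, g₁ y)‖ ≤ C
  bdd₁ : ∀ y ∈ Metric.closedBall (0 : E) R, ‖fderiv ℝ (fun y => F (y, g₁ y)) y‖ ≤ C
  bdd₂ : ∀ y ∈ Metric.closedBall (0 : E) R,
    ‖fderiv ℝ (fderiv ℝ (fun y => F (y, g₁ y))) y‖ ≤ C
  bddF₁ : ∀ y ∈ Metric.closedBall (0 : E) R, ‖fderiv ℝ F (y, g₁ y)‖ ≤ C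
  bddF₂ : ∀ y ∈ Metric.closedBall (0 : E) R, ‖fderiv ℝ (fderiv ℝ F) (y, g₁ y)‖ ≤ C
  close₀ : ∀ y₁ ∈ Metric.closedBall (0 : E) R, ∀ y₂ ∈ Metric.closedBall (0 : E) R,
    ‖F (y₁, g₁ y₁) - F (y₂, g₂ y₂)‖ ≤ C * (‖y₁ - y₂‖ + δ)
  close₁ : ∀ y₁ ∈ Metric.closedBall (0 : E) R, ∀ y₂ ∈ Metric.closedBall (0 : E) R,
    ‖fderiv ℝ (fun y => F (y, g₁ y)) y₁ - fderiv ℝ (fun y => F (y, g₂ y)) y₂‖ ≤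
      C * (‖y₁ - y₂‖ + δ)
  strict₀ : ∀ y₁ ∈ Metric.closedBall (0 : E) R, ∀ y₂ ∈ Metric.closedBall (0 : E) R,
    ∀ y ∈ Metric.closedBall (0 : E) R,
    ‖F (y₁, g₁ y₁) - F (y₂, g₁ y₂) - fderiv ℝ (fun y => F (y, g₂ y)) y (y₁ - y₂)‖ ≤
      C * (‖y₁ - y‖ + ‖y₂ - y‖ + δ) * ‖y₁ - y₂‖
  strict₁ : ∀ y₁ ∈ Metric.closedBall (0 : E) R, ∀ y₂ ∈ Metric.closedBall (0 : E) R,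
    ∀ y ∈ Metric.closedBall (0 : E) R,
    ‖fderiv ℝ (fun y => F (y, g₁ y)) y₁ - fderiv ℝ (fun y => F (y, g₁ y)) y₂ -
      fderiv ℝ (fderiv ℝ (fun y => F (y, g₂ y))) y (y₁ - y₂)‖ ≤
      C * (‖y₁ - y‖ + ‖y₂ - y‖ + δ) * ‖y₁ - y₂‖
  taylor₀ : ∀ y ∈ Metric.closedBall (0 : E) R,
    ‖F (y, g₁ y) - F (y, g₂ y) - fderiv ℝ F (y, g₂ y) (0, g₁ y - g₂ y)‖ ≤ C * δ ^ 2
  taylor₁ : ∀ y ∈ Metric.closedBall (0 : E) R,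
    ‖fderiv ℝ (fun y => F (y, g₁ y)) y - fderiv ℝ (fun y => F (y, g₂ y)) y -
      variation F g₂ (fun y => g₁ y - g₂ y) y‖ ≤ C * δ ^ 2

/-- First-order expansion of a function with Lipschitz derivative in the second variable. -/
theorem norm_sub_sub_fderiv_le {Φ : E × Γ → V} (hΦ : Differentiable ℝ Φ) {ρ K δ : ℝ} (hK : 0 ≤ K)
    (hl : ∀ w ∈ Metric.closedBall (0 : E × Γ) ρ, ∀ w' ∈ Metric.closedBall (0 : E × Γ) ρ,
      ‖fderiv ℝ Φ w - fderiv ℝ Φ w'‖ ≤ K * ‖w - w'‖) {y : E} {a b : Γ}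
    (h : (y, a) ∈ Metric.closedBall (0 : E × Γ) ρ ∧
      (y, b) ∈ Metric.closedBall (0 : E × Γ) ρ ∧ ‖a - b‖ ≤ δ) :
    ‖Φ (y, a) - Φ (y, b) - fderiv ℝ Φ (y, b) (0, a - b)‖ ≤ K * δ ^ 2 := by
  obtain ⟨ha, hb, hab⟩ := h
  have hδ : 0 ≤ δ := (norm_nonneg _).trans hab
  have e0 : (y, a) - (y, b) = (0, a - b) := by simp
  have e1 : ‖(y, a) - (y, b)‖ ≤ δ := by
    rw [e0]; exact max_le (by simpa using hδ) hab
  have := norm_sub_sub_le_of_segment (A := fderiv ℝ Φ (y, b)) (c := K * δ) hΦ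
    (y₁ := (y, a)) (y₂ := (y, b)) (by
      intro w hw
      have hwb : w ∈ Metric.closedBall (0 : E × Γ) ρ :=
        (convex_closedBall _ _).segment_subset hb ha hw
      refine (hl _ hwb _ hb).trans (mul_le_mul_of_nonneg_left ?_ hK)
      have := norm_sub_le_of_mem_segment (z := (y, b)) hw
      rw [sub_self, norm_zero, add_zero] at this
      exact this.trans e1)
  rw [e0] at this
  refine this.trans ?_
  rw [← e0, pow_two, ← mul_assoc]
  exact mul_le_mul_of_nonneg_left e1 (by positivity)

/-- A constant for `PairEstimate` that depends only on the bounds of the outer and the inner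
functions, hence not on the time at which these are taken. -/
theorem exists_pairEstimate (ρ K : ℝ) (hK : 0 ≤ K) (hρ : ρ ≤ K) :
    ∃ C, 0 ≤ C ∧ ∀ (F : E × Γ → V) (g₁ g₂ : E → Γ) (δ : ℝ), OuterBound F ρ K →
      InnerBound g₁ ρ → InnerBound g₂ ρ → InnerBound (fun y => g₁ y - g₂ y) δ →
      PairEstimate F g₁ g₂ ρ C δ := by
  obtain ⟨C, hC, H⟩ := exists_closeBdd_comp_graph (E := E) (Γ := Γ) (V := V) ρ K hK hρ
  refine ⟨C + K + K * (1 + K) + K, by positivity, ?_⟩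
  set C' := C + K + K * (1 + K) + K with hC'
  have hKK : 0 ≤ K * (1 + K) := by positivity
  have hCC' : C ≤ C' := by linarith
  intro F g₁ g₂ δ hF h₁ h₂ h
  have hδ := h.nonneg
  have H' := fun y₁ hy₁ y₂ hy₂ => H F g₁ g₂ δ hF h₁ h₂ h y₁ hy₁ y₂ hy₂
  have g1 := h₁.contDiff.of_le (show (2 : WithTop ℕ∞) ≤ 3 by norm_num)
  have g2 := h₂.contDiff.of_le (show (2 : WithTop ℕ∞) ≤ 3 by norm_num)
  have cd := contDiff_comp_graph hF.contDiff g1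
  have cd1 : ContDiff ℝ 1 (fderiv ℝ (fun y => F (y, g₁ y))) := cd.fderiv_right (by norm_num)
  have hmem : ∀ {g : E → Γ}, InnerBound g ρ → ∀ {y}, y ∈ Metric.closedBall (0 : E) ρ →
      (y, g y) ∈ Metric.closedBall (0 : E × Γ) ρ := by
    intro g hg y hy
    rw [mem_closedBall_zero_iff] at hy ⊢
    exact max_le hy (hg.bdd₀ y)
  have hball : ∀ {y₁ y₂ y : E}, y₁ ∈ Metric.closedBall (0 : E) ρ →
      y₂ ∈ Metric.closedBall (0 : E) ρ → y ∈ segment ℝ y₂ y₁ → y ∈ Metric.closedBall (0 : E) ρ :=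
    fun e1 e2 e3 => (convex_closedBall _ _).segment_subset e2 e1 e3
  have hseg : ∀ {y₁ y₂ y : E} (z : E), y ∈ segment ℝ y₂ y₁ →
      C * (‖y - z‖ + δ) ≤ C' * (‖y₁ - z‖ + ‖y₂ - z‖ + δ) := fun z hy => by
    have := norm_sub_le_of_mem_segment (z := z) hy
    gcongr
  have tay : ∀ y ∈ Metric.closedBall (0 : E) ρ, (y, g₁ y) ∈ Metric.closedBall (0 : E × Γ) ρ ∧
      (y, g₂ y) ∈ Metric.closedBall (0 : E × Γ) ρ ∧ ‖g₁ y - g₂ y‖ ≤ δ := fun y hy =>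
    ⟨hmem h₁ hy, hmem h₂ hy, h.bdd₀ y⟩
  have hF1 : Differentiable ℝ (fderiv ℝ F) :=
    (hF.contDiff.fderiv_right (m := 1) (by norm_num)).differentiable (by norm_num)
  refine ⟨cd, fun y hy => ((H' y hy y hy).1.left).trans hCC',
    fun y hy => ((H' y hy y hy).2.1.left).trans hCC',
    fun y hy => ((H' y hy y hy).2.2.left).trans hCC',
    fun y hy => (hF.bdd₁ _ (hmem h₁ hy)).trans (by linarith),
    fun y hy => (hF.bdd₂ _ (hmem h₁ hy)).trans (by linarith),
    fun y₁ e₁ y₂ e₂ => ((H' y₁ e₁ y₂ e₂).1.sub).trans (by gcongr),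
    fun y₁ e₁ y₂ e₂ => ((H' y₁ e₁ y₂ e₂).2.1.sub).trans (by gcongr), ?_, ?_, ?_, ?_⟩
  · intro y₁ e₁ y₂ e₂ y e
    exact norm_sub_sub_le_of_segment (cd.differentiable (by norm_num)) fun w hw =>
      ((H' w (hball e₁ e₂ hw) y e).2.1.sub).trans (hseg _ hw)
  · intro y₁ e₁ y₂ e₂ y e
    exact norm_sub_sub_le_of_segment (cd1.differentiable (by norm_num)) fun w hw =>
      ((H' w (hball e₁ e₂ hw) y e).2.2.sub).trans (hseg _ hw)
  · intro y hy
    exact (norm_sub_sub_fderiv_le (hF.contDiff.differentiable (by norm_num)) hK hF.lip₁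
      (tay y hy)).trans (by
      gcongr; linarith)
  · intro y hy
    have dsub : fderiv ℝ (fun y => g₁ y - g₂ y) y = fderiv ℝ g₁ y - fderiv ℝ g₂ y :=
      fderiv_fun_sub (g1.differentiable (by norm_num) y) (g2.differentiable (by norm_num) y)
    have dJ : graphDeriv g₁ y - graphDeriv g₂ y =
        ContinuousLinearMap.inr ℝ E Γ ∘L fderiv ℝ (fun y => g₁ y - g₂ y) y := by
      rw [dsub, ContinuousLinearMap.comp_sub]; simp [graphDeriv]
    have e1 := norm_sub_sub_fderiv_le hF1 hK hF.lip₂ (tay y hy)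
    have e2 : ‖fderiv ℝ F (y, g₁ y) - fderiv ℝ F (y, g₂ y)‖ ≤ K * δ := by
      refine (hF.lip₁ _ (hmem h₁ hy) _ (hmem h₂ hy)).trans (mul_le_mul_of_nonneg_left ?_ hK)
      exact max_le (by simpa using hδ) (h.bdd₀ y)
    have e3 : ‖graphDeriv g₁ y - graphDeriv g₂ y‖ ≤ δ := by
      rw [dJ]
      exact (ContinuousLinearMap.opNorm_comp_le _ _).trans
        ((mul_le_of_le_one_left (norm_nonneg _)
          (ContinuousLinearMap.norm_inr_le_one ℝ E Γ)).trans (h.bdd₁ y))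
    have e4 : ‖graphDeriv g₂ y‖ ≤ 1 + K := by
      refine (norm_add_le _ _).trans (add_le_add (ContinuousLinearMap.norm_inl_le_one ℝ E Γ) ?_)
      exact (ContinuousLinearMap.opNorm_comp_le _ _).trans
        ((mul_le_of_le_one_left (norm_nonneg _)
          (ContinuousLinearMap.norm_inr_le_one ℝ E Γ)).trans ((h₂.bdd₁ y).trans hρ))
    rw [fderiv_comp_graph (hF.contDiff.differentiable (by norm_num) _)
      (g1.differentiable (by norm_num) _),
      fderiv_comp_graph (hF.contDiff.differentiable (by norm_num) _)
      (g2.differentiable (by norm_num) _), variation, ← dJ]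
    set D₁ := fderiv ℝ F (y, g₁ y)
    set D₂ := fderiv ℝ F (y, g₂ y)
    set Q := fderiv ℝ (fderiv ℝ F) (y, g₂ y) (0, g₁ y - g₂ y)
    -- The first-order terms in `g₁ - g₂` cancel; what remains is a product of differences or a
    -- Taylor remainder of `fderiv ℝ F`.
    have split : D₁ ∘L graphDeriv g₁ y - D₂ ∘L graphDeriv g₂ y -
        (Q ∘L graphDeriv g₂ y + D₂ ∘L (graphDeriv g₁ y - graphDeriv g₂ y)) =
        (D₁ - D₂ - Q) ∘L graphDeriv g₂ y +
          (D₁ - D₂) ∘L (graphDeriv g₁ y - graphDeriv g₂ y) := by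
      ext e; simp; abel
    rw [split]
    calc _ ≤ ‖(D₁ - D₂ - Q) ∘L graphDeriv g₂ y‖ +
          ‖(D₁ - D₂) ∘L (graphDeriv g₁ y - graphDeriv g₂ y)‖ := norm_add_le _ _
      _ ≤ (K * δ ^ 2) * (1 + K) + (K * δ) * δ := by
          refine add_le_add ?_ ?_
          · exact (ContinuousLinearMap.opNorm_comp_le _ _).trans
              (mul_le_mul e1 e4 (norm_nonneg _) (by positivity))
          · exact (ContinuousLinearMap.opNorm_comp_le _ _).trans
              (mul_le_mul e2 e3 (norm_nonneg _) (by positivity))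
      _ = (K * (1 + K) + K) * δ ^ 2 := by ring
      _ ≤ C' * δ ^ 2 := by gcongr; linarith

end Pointwise

/-! ### Pointwise bounds for the data and for the component functions -/

section Smooth

variable {E V : Type*} [NormedAddCommGroup E] [NormedSpace ℝ E] [NormedAddCommGroup V]
  [NormedSpace ℝ V] {t₀ t_f : ℝ}

theorem norm_iteratedFDeriv_succ_sub (n : ℕ) (F : E → V) (w w' : E) :
    ‖iteratedFDeriv ℝ (n + 1) F w - iteratedFDeriv ℝ (n + 1) F w'‖ =
      ‖iteratedFDeriv ℝ n (fderiv ℝ F) w - iteratedFDeriv ℝ n (fderiv ℝ F) w'‖ := by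
  rw [iteratedFDeriv_succ_eq_comp_right, iteratedFDeriv_succ_eq_comp_right, ← dist_eq_norm,
    ← dist_eq_norm]
  exact (continuousMultilinearCurryRightEquiv' ℝ n E V).symm.dist_map _ _

theorem norm_iteratedFDeriv_zero_sub (F : E → V) (w w' : E) :
    ‖iteratedFDeriv ℝ 0 F w - iteratedFDeriv ℝ 0 F w'‖ = ‖F w - F w'‖ := by
  rw [iteratedFDeriv_zero_eq_comp, ← dist_eq_norm, ← dist_eq_norm]
  exact (continuousMultilinearCurryFin0 ℝ E V).symm.dist_map _ _

theorem norm_iteratedFDeriv_one_sub (F : E → V) (w w' : E) :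
    ‖iteratedFDeriv ℝ 1 F w - iteratedFDeriv ℝ 1 F w'‖ = ‖fderiv ℝ F w - fderiv ℝ F w'‖ := by
  rw [norm_iteratedFDeriv_succ_sub, norm_iteratedFDeriv_zero_sub]

theorem norm_iteratedFDeriv_two_sub (F : E → V) (w w' : E) :
    ‖iteratedFDeriv ℝ 2 F w - iteratedFDeriv ℝ 2 F w'‖ =
      ‖fderiv ℝ (fderiv ℝ F) w - fderiv ℝ (fderiv ℝ F) w'‖ := by
  rw [norm_iteratedFDeriv_succ_sub, norm_iteratedFDeriv_one_sub]

theorem norm_fderiv_fderiv (F : E → V) (w : E) :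
    ‖fderiv ℝ (fderiv ℝ F) w‖ = ‖iteratedFDeriv ℝ 2 F w‖ := by
  rw [← norm_iteratedFDeriv_fderiv, norm_iteratedFDeriv_one]

/-- The Lipschitz bounds on balls and the bounds at `0` give bounds on balls, uniformly in time. -/
theorem Smooth.exists_outerBound {F : ℝ → E → V} (hF : Smooth t₀ t_f F) {ρ : ℝ} (hρ : 0 < ρ) :
    ∃ K, 0 ≤ K ∧ ∀ᵐ t ∂timeMeasure t₀ t_f, OuterBound (F t) ρ K := by
  obtain ⟨K, hK⟩ := hF.bounded
  obtain ⟨L, hL⟩ := hF.lipschitz ρ hρ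
  refine ⟨|K| + |L| * (1 + ρ), by positivity, ?_⟩
  have hLC : L ≤ |K| + |L| * (1 + ρ) := by
    nlinarith [le_abs_self L, abs_nonneg K, mul_nonneg (abs_nonneg L) hρ.le]
  filter_upwards [hF.contDiff, hK 0 (by norm_num), hK 1 (by norm_num), hK 2 (by norm_num),
    hL 0 (by norm_num), hL 1 (by norm_num), hL 2 (by norm_num)] with t c k0 k1 k2 l0 l1 l2
  simp only [norm_iteratedFDeriv_zero_sub] at l0
  simp only [norm_iteratedFDeriv_one_sub] at l1
  simp only [norm_iteratedFDeriv_two_sub] at l2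
  rw [norm_iteratedFDeriv_zero] at k0
  rw [norm_iteratedFDeriv_one] at k1
  rw [← norm_fderiv_fderiv] at k2
  have h0 : (0 : E) ∈ Metric.closedBall (0 : E) ρ := Metric.mem_closedBall_self hρ.le
  have hl : ∀ w ∈ Metric.closedBall (0 : E) ρ, L * ‖w - 0‖ ≤ |L| * (1 + ρ) := fun w hw => by
    rw [mem_closedBall_zero_iff] at hw
    rw [sub_zero]
    exact mul_le_mul (le_abs_self L) (by linarith) (norm_nonneg _) (abs_nonneg _)
  refine ⟨c, fun w hw => ?_, fun w hw => ?_, fun w hw => ?_,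
    fun w hw w' hw' => (l0 w hw w' hw').trans (by gcongr),
    fun w hw w' hw' => (l1 w hw w' hw').trans (by gcongr),
    fun w hw w' hw' => (l2 w hw w' hw').trans (by gcongr)⟩
  · have := norm_sub_norm_le (F t w) (F t 0)
    linarith [l0 w hw 0 h0, hl w hw, le_abs_self K]
  · have := norm_sub_norm_le (fderiv ℝ (F t) w) (fderiv ℝ (F t) 0)
    linarith [l1 w hw 0 h0, hl w hw, le_abs_self K]
  · have := norm_sub_norm_le (fderiv ℝ (fderiv ℝ (F t)) w) (fderiv ℝ (fderiv ℝ (F t)) 0)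
    linarith [l2 w hw 0 h0, hl w hw, le_abs_self K]

end Smooth

section GSpaceBounds

variable {nx nu np ng : ℕ} {t₀ t_f : ℝ}

theorem GSpace.norm_def (g : GSpace nx nu np ng t₀ t_f 3) :
    ‖g‖ = (gNorm t₀ t_f 3 g).toReal := rfl

theorem GSpace.ae_norm_iteratedFDeriv_le (g : GSpace nx nu np ng t₀ t_f 3) {k : ℕ} (hk : k ≤ 3) :
    ∀ᵐ t ∂timeMeasure t₀ t_f, ∀ y, ‖iteratedFDeriv ℝ k (g t) y‖ ≤ ‖g‖ := by
  filter_upwards [ENNReal.ae_le_essSup (μ := timeMeasure t₀ t_f)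
    (fun t => ⨆ y, ‖iteratedFDeriv ℝ k (g t) y‖ₑ)] with t ht y
  have h1 : ‖iteratedFDeriv ℝ k (g t) y‖ₑ ≤ gNorm t₀ t_f 3 g :=
    (le_iSup (fun y => ‖iteratedFDeriv ℝ k (g t) y‖ₑ) y).trans (ht.trans
      (Finset.single_le_sum
        (f := fun k => essSup (fun t => ⨆ y, ‖iteratedFDeriv ℝ k (g t) y‖ₑ) (timeMeasure t₀ t_f))
        (fun _ _ => zero_le) (Finset.mem_range.2 (by omega))))
  rw [GSpace.norm_def, ← toReal_enorm]
  exact ENNReal.toReal_mono g.2.2.2.ne h1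

/-- The norm of `𝒢^3` bounds the jets at almost every time; the second derivative is Lipschitz
because the third one is bounded. -/
theorem GSpace.innerBound (g : GSpace nx nu np ng t₀ t_f 3) :
    ∀ᵐ t ∂timeMeasure t₀ t_f, InnerBound (g t) ‖g‖ := by
  filter_upwards [g.2.1, g.ae_norm_iteratedFDeriv_le (show 0 ≤ 3 by norm_num),
    g.ae_norm_iteratedFDeriv_le (show 1 ≤ 3 by norm_num),
    g.ae_norm_iteratedFDeriv_le (show 2 ≤ 3 by norm_num),
    g.ae_norm_iteratedFDeriv_le (show 3 ≤ 3 by norm_num)] with t c h0 h1 h2 h3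
  refine ⟨c, fun y => ?_, fun y => ?_, fun y => ?_, fun y y' => ?_⟩
  · simpa using h0 y
  · simpa only [norm_iteratedFDeriv_one] using h1 y
  · simpa only [norm_fderiv_fderiv] using h2 y
  · rw [← norm_iteratedFDeriv_two_sub]
    refine norm_sub_le_of_norm_fderiv_le ?_ (fun y => ?_) y y'
    · exact c.differentiable_iteratedFDeriv (by norm_cast)
    · rw [norm_fderiv_iteratedFDeriv]; exact h3 y

theorem GSpace.innerBound_sub (g₁ g₂ : GSpace nx nu np ng t₀ t_f 3) :
    ∀ᵐ t ∂timeMeasure t₀ t_f, InnerBound (fun y => g₁ t y - g₂ t y) ‖g₁ - g₂‖ :=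
  (g₁ - g₂).innerBound

/-- The estimates for `y ↦ F (t, y, g (t, y))`, uniformly in time and in `g` from a ball of `𝒢^3`.
-/
theorem Smooth.exists_pairEstimate {V : Type*} [NormedAddCommGroup V] [NormedSpace ℝ V]
    {F : ℝ → Triple nx nu np × Vec ng → V} (hF : Smooth t₀ t_f F) {R : ℝ} (hR : 0 < R) :
    ∃ C, 0 ≤ C ∧ ∀ g₁ g₂ : GSpace nx nu np ng t₀ t_f 3, ‖g₁‖ ≤ R → ‖g₂‖ ≤ R →
      ∀ᵐ t ∂timeMeasure t₀ t_f, PairEstimate (F t) (g₁ t) (g₂ t) R C ‖g₁ - g₂‖ := by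
  obtain ⟨K, hK, h⟩ := hF.exists_outerBound hR
  obtain ⟨C, hC, H⟩ := OCP.exists_pairEstimate (E := Triple nx nu np) (Γ := Vec ng) (V := V)
    R (max R K) (le_max_of_le_right hK) (le_max_left _ _)
  refine ⟨C, hC, fun g₁ g₂ h₁ h₂ => ?_⟩
  filter_upwards [h, g₁.innerBound, g₂.innerBound, g₁.innerBound_sub g₂] with t a b c d
  have hm : K ≤ max R K := le_max_right _ _
  refine H _ _ _ _ ⟨a.contDiff, fun w hw => (a.bdd₀ w hw).trans hm,
    fun w hw => (a.bdd₁ w hw).trans hm, fun w hw => (a.bdd₂ w hw).trans hm,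
    fun w hw w' hw' => (a.lip₀ w hw w' hw').trans (by gcongr),
    fun w hw w' hw' => (a.lip₁ w hw w' hw').trans (by gcongr),
    fun w hw w' hw' => (a.lip₂ w hw w' hw').trans (by gcongr)⟩ (b.mono h₁) (c.mono h₂) d

end GSpaceBounds

section MeasurabilityAlong

variable {α E V : Type*} [MeasurableSpace α] {μ : Measure α} [NormedAddCommGroup E]
  [NormedSpace ℝ E] [FiniteDimensional ℝ E] [NormedAddCommGroup V] [NormedSpace ℝ V]
  {h : α → E → V} {y : α → E}

theorem aestronglyMeasurable_fderiv_along (hm : ∀ e, AEStronglyMeasurable (fun t => h t e) μ)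
    (hd : ∀ᵐ t ∂μ, ContDiff ℝ 1 (h t)) (hy : AEStronglyMeasurable y μ) :
    AEStronglyMeasurable (fun t => fderiv ℝ (h t) (y t)) μ :=
  aestronglyMeasurable_superposition
    (aestronglyMeasurable_fderiv hm (hd.mono fun t ht => ht.differentiable (by norm_num)))
    (hd.mono fun t ht => ht.continuous_fderiv (by norm_num)) hy

theorem aestronglyMeasurable_fderiv_fderiv_along
    (hm : ∀ e, AEStronglyMeasurable (fun t => h t e) μ)
    (hd : ∀ᵐ t ∂μ, ContDiff ℝ 2 (h t)) (hy : AEStronglyMeasurable y μ) :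
    AEStronglyMeasurable (fun t => fderiv ℝ (fderiv ℝ (h t)) (y t)) μ :=
  aestronglyMeasurable_fderiv_along
    (aestronglyMeasurable_fderiv hm (hd.mono fun t ht => ht.differentiable (by norm_num)))
    (hd.mono fun t ht => ht.fderiv_right (by norm_num)) hy

variable {nx nu np ng : ℕ} {t₀ t_f : ℝ}

theorem GSpace.aestronglyMeasurable_along (g : GSpace nx nu np ng t₀ t_f 3)
    {y : ℝ → Triple nx nu np} (hy : AEStronglyMeasurable y (timeMeasure t₀ t_f)) :
    AEStronglyMeasurable (fun t => g t (y t)) (timeMeasure t₀ t_f) :=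
  aestronglyMeasurable_superposition g.2.2.1 (g.2.1.mono fun _ ht => ht.continuous) hy

theorem Smooth.aestronglyMeasurable_along {E : Type*} [NormedAddCommGroup E] [NormedSpace ℝ E]
    {F : ℝ → E → V} (hF : Smooth t₀ t_f F) {w : ℝ → E}
    (hw : AEStronglyMeasurable w (timeMeasure t₀ t_f)) :
    AEStronglyMeasurable (fun t => F t (w t)) (timeMeasure t₀ t_f) :=
  aestronglyMeasurable_superposition hF.measurable (hF.contDiff.mono fun _ ht => ht.continuous) hw

variable {F : ℝ → Triple nx nu np × Vec ng → V}

theorem Smooth.measurable_comp_graph (hF : Smooth t₀ t_f F) (g : GSpace nx nu np ng t₀ t_f 3)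
    (y : Triple nx nu np) :
    AEStronglyMeasurable (fun t => F t (y, g t y)) (timeMeasure t₀ t_f) :=
  hF.aestronglyMeasurable_along (aestronglyMeasurable_const.prodMk (g.2.2.1 y))

theorem Smooth.contDiff_comp_graph (hF : Smooth t₀ t_f F) (g : GSpace nx nu np ng t₀ t_f 3) :
    ∀ᵐ t ∂timeMeasure t₀ t_f, ContDiff ℝ 2 (fun y => F t (y, g t y)) := by
  filter_upwards [hF.contDiff, g.2.1] with t h1 h2
  exact OCP.contDiff_comp_graph h1 (h2.of_le (by norm_cast))

end MeasurabilityAlong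

/-! ### Essentially bounded functions and Sobolev functions -/

section LpTop

variable {α V W X : Type*} [MeasurableSpace α] {μ : Measure α} [NormedAddCommGroup V]
  [NormedAddCommGroup W] [NormedAddCommGroup X]

theorem ae_norm_le_norm_Lp_top (f : Lp V ∞ μ) : ∀ᵐ t ∂μ, ‖f t‖ ≤ ‖f‖ := by
  filter_upwards [ae_le_eLpNormEssSup (f := f) (μ := μ)] with t ht
  rw [Lp.norm_def, ← toReal_enorm, eLpNorm_exponent_top]
  refine ENNReal.toReal_mono ?_ ht
  rw [← eLpNorm_exponent_top]; exact Lp.eLpNorm_ne_top f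

theorem norm_Lp_top_le [IsFiniteMeasure μ] {f : Lp V ∞ μ} {C : ℝ} (hC : 0 ≤ C)
    (h : ∀ᵐ t ∂μ, ‖f t‖ ≤ C) : ‖f‖ ≤ C := by
  simpa using Lp.norm_le_of_ae_bound hC h

theorem MemLp_top.exists_bound {f : α → V} (hf : MemLp f ∞ μ) :
    ∃ C, 0 ≤ C ∧ ∀ᵐ t ∂μ, ‖f t‖ ≤ C := by
  refine ⟨‖hf.toLp f‖, norm_nonneg _, ?_⟩
  filter_upwards [ae_norm_le_norm_Lp_top (hf.toLp f), hf.coeFn_toLp] with t h1 h2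
  rwa [h2] at h1

theorem MemLp_top.bilin [NormedSpace ℝ V] [NormedSpace ℝ W] [NormedSpace ℝ X]
    (B : V →L[ℝ] W →L[ℝ] X) {f : α → V} {g : α → W} (hf : MemLp f ∞ μ) (hg : MemLp g ∞ μ) :
    MemLp (fun t => B (f t) (g t)) ∞ μ := B.memLp_of_bilin ∞ hf hg

theorem MemLp_top.clm_apply [NormedSpace ℝ V] [NormedSpace ℝ W] {A : α → V →L[ℝ] W} {v : α → V}
    (hA : MemLp A ∞ μ) (hv : MemLp v ∞ μ) : MemLp (fun t => A t (v t)) ∞ μ :=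
  MemLp_top.bilin (ContinuousLinearMap.id ℝ (V →L[ℝ] W)) hA hv

/-- In finite dimensions, an operator-valued function is essentially bounded if it is so strongly.
-/
theorem MemLp_top.clm_of_apply [NormedSpace ℝ V] [FiniteDimensional ℝ V] [NormedSpace ℝ W]
    {A : α → V →L[ℝ] W} (h : ∀ v, MemLp (fun t => A t v) ∞ μ) : MemLp A ∞ μ := by
  let b := Module.finBasis ℝ V
  choose C hC hb using fun i => MemLp_top.exists_bound (h (b i))
  let e : ∀ i, V →L[ℝ] ℝ := fun i => LinearMap.toContinuousLinearMap (b.coord i)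
  refine memLp_top_of_bound (aestronglyMeasurable_clm_of_apply fun v => (h v).1)
    (∑ i, C i * ‖e i‖) ?_
  filter_upwards [ae_all_iff.2 hb] with t ht
  refine ContinuousLinearMap.opNorm_le_bound _
    (Finset.sum_nonneg fun i _ => mul_nonneg (hC i) (norm_nonneg _)) fun v => ?_
  conv_lhs => rw [← b.sum_repr v, map_sum]
  rw [Finset.sum_mul]
  refine (norm_sum_le _ _).trans (Finset.sum_le_sum fun i _ => ?_)
  rw [map_smul, norm_smul, mul_comm, mul_assoc]
  exact mul_le_mul (ht i) ((e i).le_opNorm v) (norm_nonneg _) (hC i)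

theorem MemLp_top.dotProduct {n : ℕ} {v w : α → Vec n} (hv : MemLp v ∞ μ) (hw : MemLp w ∞ μ) :
    MemLp (fun t => v t ⬝ᵥ w t) ∞ μ := by
  simp only [_root_.dotProduct]
  refine memLp_finsetSum _ fun i _ => ?_
  exact MemLp_top.bilin (ContinuousLinearMap.mul ℝ ℝ)
    ((ContinuousLinearMap.proj (R := ℝ) (φ := fun _ : Fin n => ℝ) i).comp_memLp' hv)
    ((ContinuousLinearMap.proj (R := ℝ) (φ := fun _ : Fin n => ℝ) i).comp_memLp' hw)

end LpTop

namespace WSpace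

/-- The norm of `W^{1,q}`, on top of the algebraic structure of the submodule. In this form the
algebraic structures underlying spaces of operators and the norm agree syntactically. -/
instance normedAddCommGroup (n : ℕ) (q : ℝ≥0∞) [Fact (1 ≤ q)] (t₀ t_f : ℝ) :
    NormedAddCommGroup (WSpace n q t₀ t_f) where
  toAddCommGroup := Submodule.addCommGroup _
  toMetricSpace := (inferInstance : MetricSpace (WSpace n q t₀ t_f))
  norm x := ‖(x : C(Icc t₀ t_f, Vec n) × LSpace n q t₀ t_f)‖
  dist_eq x y := (sobolevSubmodule n q t₀ t_f).normedAddCommGroup.dist_eq x y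

instance seminormedAddCommGroup (n : ℕ) (q : ℝ≥0∞) [Fact (1 ≤ q)] (t₀ t_f : ℝ) :
    SeminormedAddCommGroup (WSpace n q t₀ t_f) :=
  (normedAddCommGroup n q t₀ t_f).toSeminormedAddCommGroup

instance normedSpace (n : ℕ) (q : ℝ≥0∞) [Fact (1 ≤ q)] (t₀ t_f : ℝ) :
    NormedSpace ℝ (WSpace n q t₀ t_f) where
  toModule := Submodule.module _
  norm_smul_le c x := norm_smul_le c (x : C(Icc t₀ t_f, Vec n) × LSpace n q t₀ t_f)

variable {n : ℕ} {t₀ t_f : ℝ}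

section General

variable {q : ℝ≥0∞} [Fact (1 ≤ q)] (x y : WSpace n q t₀ t_f) (t : ℝ)

theorem val_of_mem {t : ℝ} (h : t ∈ Icc t₀ t_f) : x.val t = x.1.1 ⟨t, h⟩ := by
  simp [val, h]

theorem val_of_notMem {t : ℝ} (h : t ∉ Icc t₀ t_f) : x.val t = 0 := dif_neg h

theorem val_add : (x + y).val t = x.val t + y.val t := by
  by_cases h : t ∈ Icc t₀ t_f
  · rw [val_of_mem _ h, val_of_mem _ h, val_of_mem _ h]; rfl
  · rw [val_of_notMem _ h, val_of_notMem _ h, val_of_notMem _ h, add_zero]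

theorem val_smul (c : ℝ) : (c • x).val t = c • x.val t := by
  by_cases h : t ∈ Icc t₀ t_f
  · rw [val_of_mem _ h, val_of_mem _ h]; rfl
  · rw [val_of_notMem _ h, val_of_notMem _ h, smul_zero]

theorem val_sub : (x - y).val t = x.val t - y.val t := by
  by_cases h : t ∈ Icc t₀ t_f
  · rw [val_of_mem _ h, val_of_mem _ h, val_of_mem _ h]; rfl
  · rw [val_of_notMem _ h, val_of_notMem _ h, val_of_notMem _ h, sub_zero]

theorem val_zero : (0 : WSpace n q t₀ t_f).val t = 0 := by
  by_cases h : t ∈ Icc t₀ t_f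
  · rw [val_of_mem _ h]; rfl
  · exact val_of_notMem _ h

theorem norm_val_le : ‖x.val t‖ ≤ ‖x‖ := by
  by_cases h : t ∈ Icc t₀ t_f
  · rw [val_of_mem _ h]
    exact (x.1.1.norm_coe_le_norm ⟨t, h⟩).trans (norm_fst_le x.1)
  · rw [val_of_notMem _ h, norm_zero]; exact norm_nonneg _

theorem val_eq {t : ℝ} (h : t ∈ Icc t₀ t_f) : x.val t = x.val t₀ + ∫ s in t₀..t, x.der s := by
  have h0 : t₀ ∈ Icc t₀ t_f := ⟨le_rfl, h.1.trans h.2⟩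
  have := x.2 ⟨t₀, h0⟩ ⟨t, h⟩
  rw [val_of_mem _ h, val_of_mem _ h0]
  simp only [der]
  rw [← this]; abel

theorem aestronglyMeasurable_val :
    AEStronglyMeasurable x.val (timeMeasure t₀ t_f) := by
  have h : ContinuousOn x.val (Icc t₀ t_f) := by
    rw [continuousOn_iff_continuous_domRestrict]
    have : (Icc t₀ t_f).domRestrict x.val = x.1.1 := by
      funext t
      exact val_of_mem x t.2
    rw [this]; exact x.1.1.continuous
  exact (h.mono Ioo_subset_Icc_self).aestronglyMeasurable measurableSet_Ioo

theorem memLp_val : MemLp x.val ∞ (timeMeasure t₀ t_f) :=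
  memLp_top_of_bound x.aestronglyMeasurable_val ‖x‖ (.of_forall fun t => x.norm_val_le t)

theorem ext_val_der {x y : WSpace n q t₀ t_f} (h : ∀ t ∈ Icc t₀ t_f, x.val t = y.val t)
    (hd : x.der =ᵐ[timeMeasure t₀ t_f] y.der) : x = y := by
  refine Subtype.ext (Prod.ext (ContinuousMap.ext fun t => ?_) (Lp.ext hd))
  rw [← val_of_mem x t.2, ← val_of_mem y t.2, h t t.2]

/-- A primitive of an `L^q` function is a Sobolev function. -/
theorem exists_of_primitive (h₀ : t₀ ≤ t_f) (ξ : C(Icc t₀ t_f, Vec n)) {v : ℝ → Vec n}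
    (hv : MemLp v q (timeMeasure t₀ t_f)) (c : Vec n)
    (hξ : ∀ t : Icc t₀ t_f, ξ t = c + ∫ s in t₀..t, v s) :
    ∃ x : WSpace n q t₀ t_f, (∀ t : Icc t₀ t_f, x.val t = ξ t) ∧
      x.der =ᵐ[timeMeasure t₀ t_f] v := by
  have hq : 1 ≤ q := Fact.out
  have hI := intervalIntegrable_of_integrable_timeMeasure (hv.integrable hq)
  refine ⟨⟨(ξ, hv.toLp v), fun r s => ?_⟩, fun t => val_of_mem _ t.2, hv.coeFn_toLp⟩
  have e : ∫ t in (r : ℝ)..s, (hv.toLp v) t = ∫ t in (r : ℝ)..s, v t :=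
    intervalIntegral.integral_congr_ae (ae_uIoc_of_ae_timeMeasure hv.coeFn_toLp r s)
  change ξ s - ξ r = ∫ t in (r : ℝ)..s, (hv.toLp v) t
  rw [e, hξ, hξ, add_sub_add_left_eq_sub]
  exact intervalIntegral.integral_interval_sub_left (hI ⟨t₀, le_rfl, h₀⟩ s)
    (hI ⟨t₀, le_rfl, h₀⟩ r)

end General

theorem memLp_der (x : WSpace n ∞ t₀ t_f) : MemLp x.der ∞ (timeMeasure t₀ t_f) := Lp.memLp _

/-- Essentially bounded derivatives are square integrable. -/
theorem exists_two_of_top (h₀ : t₀ ≤ t_f) (x : WSpace n ∞ t₀ t_f) :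
    ∃ y : WSpace n 2 t₀ t_f, (∀ t : Icc t₀ t_f, y.val t = x.val t) ∧
      y.der =ᵐ[timeMeasure t₀ t_f] x.der := by
  obtain ⟨y, h1, h2⟩ := exists_of_primitive (q := 2) h₀ x.1.1
    (x.memLp_der.mono_exponent le_top) (x.val t₀)
    (fun t => by rw [← val_of_mem x t.2]; exact val_eq x t.2)
  exact ⟨y, fun t => by rw [h1, val_of_mem x t.2], h2⟩

theorem isClosed_sobolevSubmodule :
    IsClosed (sobolevSubmodule n ∞ t₀ t_f : Set (C(Icc t₀ t_f, Vec n) × LSpace n ∞ t₀ t_f)) := by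
  have : (sobolevSubmodule n ∞ t₀ t_f : Set (C(Icc t₀ t_f, Vec n) × LSpace n ∞ t₀ t_f)) =
      ⋂ (r : Icc t₀ t_f) (s : Icc t₀ t_f),
        {w | w.1 s - w.1 r = ∫ t in (r : ℝ)..s, w.2 t} := by
    ext w
    simp only [mem_iInter, mem_ofPred_eq, SetLike.mem_coe]
    exact Iff.rfl
  rw [this]
  refine isClosed_iInter fun r => isClosed_iInter fun s => isClosed_eq ?_ ?_
  · exact ((continuous_eval_const s).comp continuous_fst).sub
      ((continuous_eval_const r).comp continuous_fst)
  · have hL : LipschitzWith (Real.nnabs ((s : ℝ) - r))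
        (fun v : LSpace n ∞ t₀ t_f => ∫ t in (r : ℝ)..s, v t) := by
      refine LipschitzWith.of_dist_le_mul fun v w => ?_
      rw [dist_eq_norm, dist_eq_norm, ← intervalIntegral.integral_sub
        (LSpace.intervalIntegrable v r s) (LSpace.intervalIntegrable w r s), mul_comm,
        Real.coe_nnabs]
      refine intervalIntegral.norm_integral_le_of_norm_le_const_ae ?_
      refine ae_uIoc_of_ae_timeMeasure (p := fun t => ‖v t - w t‖ ≤ ‖v - w‖) ?_ r s
      filter_upwards [ae_norm_le_norm_Lp_top (v - w), Lp.coeFn_sub v w] with t h1 h2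
      rwa [h2] at h1
    exact hL.continuous.comp continuous_snd

instance : CompleteSpace (WSpace n ∞ t₀ t_f) :=
  (isClosed_sobolevSubmodule (n := n) (t₀ := t₀) (t_f := t_f)).completeSpace_coe

/-- Integration by parts. -/
theorem integral_dotProduct (h₀ : t₀ ≤ t_f) (x y : WSpace n ∞ t₀ t_f) :
    ∫ t, (x.der t ⬝ᵥ y.val t + x.val t ⬝ᵥ y.der t) ∂timeMeasure t₀ t_f =
      x.val t_f ⬝ᵥ y.val t_f - x.val t₀ ⬝ᵥ y.val t₀ := by
  have hint : ∀ {v w : ℝ → Vec n} (i : Fin n), MemLp v ∞ (timeMeasure t₀ t_f) →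
      MemLp w ∞ (timeMeasure t₀ t_f) →
      Integrable (fun t => v t i * w t i) (timeMeasure t₀ t_f) := fun i hv hw =>
    (MemLp_top.bilin (ContinuousLinearMap.mul ℝ ℝ)
      ((ContinuousLinearMap.proj (R := ℝ) (φ := fun _ : Fin n => ℝ) i).comp_memLp' hv)
      ((ContinuousLinearMap.proj (R := ℝ) (φ := fun _ : Fin n => ℝ) i).comp_memLp' hw)).integrable
      le_top
  have hdi : ∀ (z : WSpace n ∞ t₀ t_f) (i : Fin n) (t : ℝ) (_ : t ∈ Icc t₀ t_f),
      IntervalIntegrable (fun s => z.der s i) volume t₀ t ∧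
      z.val t i = z.val t₀ i + ∫ s in t₀..t, z.der s i := by
    intro z i t ht
    have hz := LSpace.intervalIntegrable z.der ⟨t₀, le_rfl, h₀⟩ ⟨t, ht⟩
    refine ⟨?_, ?_⟩
    · exact ⟨(ContinuousLinearMap.proj (R := ℝ) (φ := fun _ : Fin n => ℝ) i).integrable_comp hz.1,
        (ContinuousLinearMap.proj (R := ℝ) (φ := fun _ : Fin n => ℝ) i).integrable_comp hz.2⟩
    · have := (ContinuousLinearMap.proj (R := ℝ)
        (φ := fun _ : Fin n => ℝ) i).intervalIntegral_comp_comm hz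
      simp only [ContinuousLinearMap.proj_apply] at this
      rw [this, val_eq z ht]; rfl
  have key : ∀ i : Fin n,
      ∫ t, (x.der t i * y.val t i + x.val t i * y.der t i) ∂timeMeasure t₀ t_f =
        x.val t_f i * y.val t_f i - x.val t₀ i * y.val t₀ i := by
    intro i
    rw [← intervalIntegral_eq_integral_timeMeasure h₀]
    exact integral_mul_add_mul_of_primitive h₀ (hdi x i t_f ⟨h₀, le_rfl⟩).1
      (hdi y i t_f ⟨h₀, le_rfl⟩).1 (fun t ht => (hdi x i t ht).2) (fun t ht => (hdi y i t ht).2)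
  simp only [_root_.dotProduct, ← Finset.sum_add_distrib, ← Finset.sum_sub_distrib]
  rw [integral_finsetSum]
  · exact Finset.sum_congr rfl fun i _ => key i
  · exact fun i _ => (hint i x.memLp_der y.memLp_val).add (hint i x.memLp_val y.memLp_der)

end WSpace

/-- The dot product as a continuous bilinear map. -/
def dotL (n : ℕ) : Vec n →L[ℝ] Vec n →L[ℝ] ℝ :=
  ∑ i, (ContinuousLinearMap.proj (R := ℝ) (φ := fun _ : Fin n => ℝ) i).smulRight
    (ContinuousLinearMap.proj (R := ℝ) (φ := fun _ : Fin n => ℝ) i)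

theorem dotL_apply {n : ℕ} (v w : Vec n) : dotL n v w = v ⬝ᵥ w := by
  simp [dotL, dotProduct]

/-! ### Superposition operators along bounded trajectories -/

section Along

variable {nx nu np ng : ℕ} {t₀ t_f : ℝ} {V : Type*} [NormedAddCommGroup V] [NormedSpace ℝ V]
  {F : ℝ → Triple nx nu np × Vec ng → V} {y : ℝ → Triple nx nu np}

theorem Smooth.exists_bound_along (hF : Smooth t₀ t_f F) (g : GSpace nx nu np ng t₀ t_f 3)
    (hy : MemLp y ∞ (timeMeasure t₀ t_f)) : ∃ R C, ∀ᵐ t ∂timeMeasure t₀ t_f,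
      PairEstimate (F t) (g t) (g t) R C ‖g - g‖ ∧ y t ∈ Metric.closedBall 0 R := by
  obtain ⟨B, hB0, hB⟩ := MemLp_top.exists_bound hy
  obtain ⟨C, -, hC⟩ := hF.exists_pairEstimate (R := B + ‖g‖ + 1) (by positivity)
  refine ⟨B + ‖g‖ + 1, C, ?_⟩
  have hg : ‖g‖ ≤ B + ‖g‖ + 1 := by linarith
  filter_upwards [hC g g hg hg, hB] with t h1 h2
  exact ⟨h1, by rw [mem_closedBall_zero_iff]; linarith [norm_nonneg g]⟩

theorem Smooth.memLp_comp (hF : Smooth t₀ t_f F) (g : GSpace nx nu np ng t₀ t_f 3)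
    (hy : MemLp y ∞ (timeMeasure t₀ t_f)) :
    MemLp (fun t => F t (y t, g t (y t))) ∞ (timeMeasure t₀ t_f) := by
  obtain ⟨R, C, h⟩ := hF.exists_bound_along g hy
  exact memLp_top_of_bound
    (hF.aestronglyMeasurable_along (hy.1.prodMk (g.aestronglyMeasurable_along hy.1))) C
    (h.mono fun t ht => ht.1.bdd₀ _ ht.2)

theorem Smooth.memLp_fderiv_comp (hF : Smooth t₀ t_f F) (g : GSpace nx nu np ng t₀ t_f 3)
    (hy : MemLp y ∞ (timeMeasure t₀ t_f)) :
    MemLp (fun t => fderiv ℝ (fun y => F t (y, g t y)) (y t)) ∞ (timeMeasure t₀ t_f) := by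
  obtain ⟨R, C, h⟩ := hF.exists_bound_along g hy
  exact memLp_top_of_bound
    (aestronglyMeasurable_fderiv_along (hF.measurable_comp_graph g)
      ((hF.contDiff_comp_graph g).mono fun t ht => ht.of_le (by norm_num)) hy.1) C
    (h.mono fun t ht => ht.1.bdd₁ _ ht.2)

theorem Smooth.memLp_fderiv_fderiv_comp (hF : Smooth t₀ t_f F)
    (g : GSpace nx nu np ng t₀ t_f 3) (hy : MemLp y ∞ (timeMeasure t₀ t_f)) :
    MemLp (fun t => fderiv ℝ (fderiv ℝ (fun y => F t (y, g t y))) (y t)) ∞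
      (timeMeasure t₀ t_f) := by
  obtain ⟨R, C, h⟩ := hF.exists_bound_along g hy
  refine memLp_top_of_bound (f := fun t => fderiv ℝ (fderiv ℝ (fun y => F t (y, g t y))) (y t))
    (aestronglyMeasurable_fderiv_fderiv_along (hF.measurable_comp_graph g)
      (hF.contDiff_comp_graph g) hy.1) C ?_
  filter_upwards [h] with t ht using ht.1.bdd₂ _ ht.2

theorem Smooth.memLp_fderiv (hF : Smooth t₀ t_f F) (g : GSpace nx nu np ng t₀ t_f 3)
    (hy : MemLp y ∞ (timeMeasure t₀ t_f)) :
    MemLp (fun t => fderiv ℝ (F t) (y t, g t (y t))) ∞ (timeMeasure t₀ t_f) := by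
  obtain ⟨R, C, h⟩ := hF.exists_bound_along g hy
  exact memLp_top_of_bound
    (aestronglyMeasurable_fderiv_along hF.measurable
      (hF.contDiff.mono fun t ht => ht.of_le (by norm_num))
      (hy.1.prodMk (g.aestronglyMeasurable_along hy.1))) C
    (h.mono fun t ht => ht.1.bddF₁ _ ht.2)

theorem Smooth.memLp_fderiv_fderiv (hF : Smooth t₀ t_f F) (g : GSpace nx nu np ng t₀ t_f 3)
    (hy : MemLp y ∞ (timeMeasure t₀ t_f)) :
    MemLp (fun t => fderiv ℝ (fderiv ℝ (F t)) (y t, g t (y t))) ∞ (timeMeasure t₀ t_f) := by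
  obtain ⟨R, C, h⟩ := hF.exists_bound_along g hy
  refine memLp_top_of_bound (f := fun t => fderiv ℝ (fderiv ℝ (F t)) (y t, g t (y t)))
    (aestronglyMeasurable_fderiv_fderiv_along hF.measurable hF.contDiff
      (hy.1.prodMk (g.aestronglyMeasurable_along hy.1))) C ?_
  filter_upwards [h] with t ht using ht.1.bddF₂ _ ht.2

theorem GSpace.memLp_along (g : GSpace nx nu np ng t₀ t_f 3)
    (hy : MemLp y ∞ (timeMeasure t₀ t_f)) :
    MemLp (fun t => g t (y t)) ∞ (timeMeasure t₀ t_f) :=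
  memLp_top_of_bound (g.aestronglyMeasurable_along hy.1) ‖g‖
    (g.innerBound.mono fun _ ht => ht.bdd₀ _)

theorem GSpace.memLp_fderiv_along (g : GSpace nx nu np ng t₀ t_f 3)
    (hy : MemLp y ∞ (timeMeasure t₀ t_f)) :
    MemLp (fun t => fderiv ℝ (g t) (y t)) ∞ (timeMeasure t₀ t_f) :=
  memLp_top_of_bound (aestronglyMeasurable_fderiv_along g.2.2.1
      (g.2.1.mono fun t ht => ht.of_le (by norm_cast)) hy.1) ‖g‖
    (g.innerBound.mono fun _ ht => ht.bdd₁ _)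

end Along

namespace Problem

variable {nx nu np ng : ℕ} {P : Problem nx nu np ng}

/-! ### Trajectories of elements of `𝒵^∞` -/

/-- `(y(t), λ(t))`. -/
def pathAt (z : P.Z) (t : ℝ) : Triple nx nu np × Vec nx := (yAt z t, costate z t)

theorem ae_norm_pathAt_le (z : P.Z) : ∀ᵐ t ∂P.μ, ‖pathAt z t‖ ≤ ‖z‖ := by
  filter_upwards [ae_norm_le_norm_Lp_top z.2.1] with t ht
  have h1 : ‖z.1‖ ≤ ‖z‖ := norm_fst_le z
  have h2 : ‖z.2‖ ≤ ‖z‖ := norm_snd_le z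
  have h3 : ‖z.2.1‖ ≤ ‖z.2‖ := norm_fst_le z.2
  have h4 : ‖z.2.2‖ ≤ ‖z.2‖ := norm_snd_le z.2
  have h5 : ‖z.2.2.1‖ ≤ ‖z.2.2‖ := norm_fst_le z.2.2
  have h6 : ‖z.2.2.2‖ ≤ ‖z.2.2‖ := norm_snd_le z.2.2
  refine max_le (max_le ?_ (max_le ?_ ?_)) ?_
  · exact (z.1.norm_val_le t).trans h1
  · exact (ht.trans h3).trans h2
  · exact (h5.trans h4).trans h2
  · exact (z.2.2.2.norm_val_le t).trans ((h6.trans h4).trans h2)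

theorem pathAt_add (z z' : P.Z) : ∀ᵐ t ∂P.μ, pathAt (z + z') t = pathAt z t + pathAt z' t := by
  filter_upwards [Lp.coeFn_add z.2.1 z'.2.1] with t ht
  exact Prod.ext (Prod.ext (WSpace.val_add _ _ t) (Prod.ext ht rfl)) (WSpace.val_add _ _ t)

theorem pathAt_sub (z z' : P.Z) : ∀ᵐ t ∂P.μ, pathAt (z - z') t = pathAt z t - pathAt z' t := by
  filter_upwards [Lp.coeFn_sub z.2.1 z'.2.1] with t ht
  exact Prod.ext (Prod.ext (WSpace.val_sub _ _ t) (Prod.ext ht rfl)) (WSpace.val_sub _ _ t)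

theorem pathAt_smul (c : ℝ) (z : P.Z) : ∀ᵐ t ∂P.μ, pathAt (c • z) t = c • pathAt z t := by
  filter_upwards [Lp.coeFn_smul c z.2.1] with t ht
  exact Prod.ext (Prod.ext (WSpace.val_smul _ t c) (Prod.ext ht rfl)) (WSpace.val_smul _ t c)

theorem aestronglyMeasurable_pathAt (z : P.Z) : AEStronglyMeasurable (pathAt z) P.μ :=
  (z.1.aestronglyMeasurable_val.prodMk
    ((Lp.aestronglyMeasurable z.2.1).prodMk aestronglyMeasurable_const)).prodMk
    z.2.2.2.aestronglyMeasurable_val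

theorem memLp_pathAt (z : P.Z) : MemLp (pathAt z) ∞ P.μ :=
  memLp_top_of_bound (aestronglyMeasurable_pathAt z) ‖z‖ (ae_norm_pathAt_le z)

theorem memLp_yAt (z : P.Z) : MemLp (yAt z) ∞ P.μ := (memLp_pathAt z).fst

theorem memLp_costate (z : P.Z) : MemLp (costate z) ∞ P.μ := (memLp_pathAt z).snd

/-- Pointwise multiplication of trajectories by an essentially bounded operator. -/
def multL {W : Type*} [NormedAddCommGroup W] [NormedSpace ℝ W]
    (M : ℝ → (Triple nx nu np × Vec nx) →L[ℝ] W) (hM : MemLp M ∞ P.μ) : P.Z →L[ℝ] Lp W ∞ P.μ :=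
  LinearMap.mkContinuousOfExistsBound
    { toFun := fun z => (MemLp_top.clm_apply hM (memLp_pathAt z)).toLp
      map_add' := fun z z' => by
        refine Lp.ext ?_
        filter_upwards [(MemLp_top.clm_apply hM (memLp_pathAt (z + z'))).coeFn_toLp,
          (MemLp_top.clm_apply hM (memLp_pathAt z)).coeFn_toLp,
          (MemLp_top.clm_apply hM (memLp_pathAt z')).coeFn_toLp,
          Lp.coeFn_add (MemLp_top.clm_apply hM (memLp_pathAt z)).toLp
            (MemLp_top.clm_apply hM (memLp_pathAt z')).toLp, pathAt_add z z'] with t h1 h2 h3 h4 h5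
        rw [h1, h4, Pi.add_apply, h2, h3, h5, map_add]
      map_smul' := fun c z => by
        refine Lp.ext ?_
        filter_upwards [(MemLp_top.clm_apply hM (memLp_pathAt (c • z))).coeFn_toLp,
          (MemLp_top.clm_apply hM (memLp_pathAt z)).coeFn_toLp,
          Lp.coeFn_smul c (MemLp_top.clm_apply hM (memLp_pathAt z)).toLp,
          pathAt_smul c z] with t h1 h2 h4 h5
        rw [h1, RingHom.id_apply, h4, Pi.smul_apply, h2, h5, map_smul] }
    (by
      obtain ⟨C, hC, hb⟩ := MemLp_top.exists_bound hM
      refine ⟨C, fun z => norm_Lp_top_le (by positivity) ?_⟩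
      filter_upwards [(MemLp_top.clm_apply hM (memLp_pathAt z)).coeFn_toLp, hb,
        ae_norm_pathAt_le z] with t h1 h2 h3
      change ‖(MemLp_top.clm_apply hM (memLp_pathAt z)).toLp _ t‖ ≤ _
      rw [h1]
      exact (ContinuousLinearMap.le_opNorm _ _).trans
        (mul_le_mul h2 h3 (norm_nonneg _) hC))

theorem multL_ae {W : Type*} [NormedAddCommGroup W] [NormedSpace ℝ W]
    (M : ℝ → (Triple nx nu np × Vec nx) →L[ℝ] W) (hM : MemLp M ∞ P.μ) (z : P.Z) :
    ∀ᵐ t ∂P.μ, multL M hM z t = M t (pathAt z t) :=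
  (MemLp_top.clm_apply hM (memLp_pathAt z)).coeFn_toLp

/-! ### The Hamiltonian system as a superposition operator -/

variable (P)

/-- The derivative of the reduced Hamiltonian in `y`, as a functional on directions. -/
def costateForm (z : P.Z) (g : P.G) (t : ℝ) : Triple nx nu np →L[ℝ] ℝ :=
  fderiv ℝ (fun y => P.l t (y, g t y)) (yAt z t) +
    dotL nx (costate z t) ∘L fderiv ℝ (fun y => P.f t (y, g t y)) (yAt z t)

/-- Right-hand side of the state equation, together with the derivative of the reduced
Hamiltonian. -/
def nem (z : P.Z) (g : P.G) (t : ℝ) : Vec nx × (Triple nx nu np →L[ℝ] ℝ) :=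
  (P.f t (yAt z t, g t (yAt z t)), P.costateForm z g t)

/-- `(A, B, C)[t]`, acting on directions `(δx, δu, δp)`. -/
def stateDeriv (z : P.Z) (g : P.G) (t : ℝ) : Triple nx nu np →L[ℝ] Vec nx :=
  fderiv ℝ (fun y => P.f t (y, g t y)) (yAt z t)

/-- Second derivative of the reduced Hamiltonian along the trajectory. -/
def hamHess (z : P.Z) (g : P.G) (t : ℝ) : Triple nx nu np →L[ℝ] Triple nx nu np →L[ℝ] ℝ :=
  fderiv ℝ (fderiv ℝ (fun y => P.l t (y, g t y))) (yAt z t) +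
    ContinuousLinearMap.compL ℝ (Triple nx nu np) (Vec nx) ℝ (dotL nx (costate z t)) ∘L
      fderiv ℝ (fderiv ℝ (fun y => P.f t (y, g t y))) (yAt z t)

/-- The partial derivative of `nem` with respect to `(y, λ)`. -/
def nemDeriv (z : P.Z) (g : P.G) (t : ℝ) :
    (Triple nx nu np × Vec nx) →L[ℝ] Vec nx × (Triple nx nu np →L[ℝ] ℝ) :=
  (P.stateDeriv z g t ∘L ContinuousLinearMap.fst ℝ _ _).prod
    (P.hamHess z g t ∘L ContinuousLinearMap.fst ℝ _ _ +
      ((ContinuousLinearMap.compL ℝ (Triple nx nu np) (Vec nx) ℝ).flip (P.stateDeriv z g t) ∘L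
        dotL nx) ∘L ContinuousLinearMap.snd ℝ _ _)

theorem nemDeriv_apply (z : P.Z) (g : P.G) (t : ℝ) (y : Triple nx nu np) (lam : Vec nx) :
    P.nemDeriv z g t (y, lam) =
      (P.stateDeriv z g t y, P.hamHess z g t y + dotL nx lam ∘L P.stateDeriv z g t) := by
  simp [nemDeriv]

variable {P}

theorem memLp_stateDeriv (hP : P.IsSmooth) (z : P.Z) (g : P.G) :
    MemLp (P.stateDeriv z g) ∞ P.μ := hP.f.memLp_fderiv_comp g (memLp_yAt z)

theorem stateDeriv_memLp_apply (hP : P.IsSmooth) (z : P.Z) (g : P.G) {y : ℝ → Triple nx nu np}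
    (hy : MemLp y ∞ P.μ) : MemLp (fun t => P.stateDeriv z g t (y t)) ∞ P.μ :=
  MemLp_top.clm_apply (memLp_stateDeriv hP z g) hy

theorem memLp_costateForm (hP : P.IsSmooth) (z : P.Z) (g : P.G) :
    MemLp (P.costateForm z g) ∞ P.μ := by
  refine MemLp_top.clm_of_apply fun v => ?_
  have h1 := MemLp_top.clm_apply (hP.l.memLp_fderiv_comp g (memLp_yAt z)) (memLp_const v)
  have h2 := MemLp_top.dotProduct (memLp_costate z)
    (stateDeriv_memLp_apply hP z g (memLp_const v))
  refine (h1.add h2).ae_eq (.of_forall fun t => ?_)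
  simp [costateForm, stateDeriv, dotL_apply]

theorem memLp_nem (hP : P.IsSmooth) (z : P.Z) (g : P.G) : MemLp (P.nem z g) ∞ P.μ :=
  MemLp.of_fst_snd ⟨(hP.f.memLp_comp g (memLp_yAt z)), memLp_costateForm hP z g⟩

theorem hamHess_apply (z : P.Z) (g : P.G) (t : ℝ) (v w : Triple nx nu np) :
    P.hamHess z g t v w = fderiv ℝ (fderiv ℝ (fun y => P.l t (y, g t y))) (yAt z t) v w +
      costate z t ⬝ᵥ fderiv ℝ (fderiv ℝ (fun y => P.f t (y, g t y))) (yAt z t) v w := by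
  simp [hamHess, dotL_apply]

theorem memLp_hamHess (hP : P.IsSmooth) (z : P.Z) (g : P.G) : MemLp (P.hamHess z g) ∞ P.μ := by
  refine MemLp_top.clm_of_apply fun v => MemLp_top.clm_of_apply fun w => ?_
  have h1 := MemLp_top.clm_apply (MemLp_top.clm_apply
    (hP.l.memLp_fderiv_fderiv_comp g (memLp_yAt z)) (memLp_const v)) (memLp_const w)
  have h2 := MemLp_top.clm_apply (MemLp_top.clm_apply
    (hP.f.memLp_fderiv_fderiv_comp g (memLp_yAt z)) (memLp_const v)) (memLp_const w)
  refine (h1.add (MemLp_top.dotProduct (memLp_costate z) h2)).ae_eq (.of_forall fun t => ?_)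
  exact (hamHess_apply z g t v w).symm

theorem memLp_nemDeriv (hP : P.IsSmooth) (z : P.Z) (g : P.G) :
    MemLp (P.nemDeriv z g) ∞ P.μ := by
  refine MemLp_top.clm_of_apply fun v => ?_
  have h1 := stateDeriv_memLp_apply hP z g (memLp_const v.1)
  have h2 := MemLp_top.clm_apply (memLp_hamHess hP z g) (memLp_const v.1)
  have h3 : MemLp (fun t => dotL nx v.2 ∘L P.stateDeriv z g t) ∞ P.μ := by
    refine MemLp_top.clm_of_apply fun w => ?_
    exact (dotL nx v.2).comp_memLp' (stateDeriv_memLp_apply hP z g (memLp_const w))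
  refine (MemLp.of_fst_snd (f := fun t => (P.stateDeriv z g t v.1,
    P.hamHess z g t v.1 + dotL nx v.2 ∘L P.stateDeriv z g t)) ⟨h1, h2.add h3⟩).ae_eq
      (.of_forall fun t => ?_)
  obtain ⟨v1, v2⟩ := v
  exact (P.nemDeriv_apply z g t v1 v2).symm

end Problem

namespace Problem

variable {nx nu np ng : ℕ} {P : Problem nx nu np ng}

/-! ### Expansions of the Hamiltonian system as a superposition operator -/

theorem norm_dotL_comp_le {E : Type*} [NormedAddCommGroup E] [NormedSpace ℝ E] {n : ℕ}
    {v : Vec n} {D : E →L[ℝ] Vec n} {N a b : ℝ} (hN : ‖dotL n‖ ≤ N) (hv : ‖v‖ ≤ a)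
    (hD : ‖D‖ ≤ b) : ‖dotL n v ∘L D‖ ≤ N * a * b := by
  have h1 : ‖dotL n v‖ ≤ N * a := (dotL n).le_of_opNorm_le_of_le hN hv
  have h0 : 0 ≤ N * a := (norm_nonneg (dotL n v)).trans h1
  exact (ContinuousLinearMap.opNorm_comp_le _ _).trans (mul_le_mul h1 hD (norm_nonneg D) h0)

/-- Second-order remainder of the derivative of the Hamiltonian `l + λᵀ f`, where `K`, `D` stand for
derivatives of `l`, `f` and `M`, `Q` for their second derivatives. -/
theorem norm_hamiltonian_remainder_le {E : Type*} [NormedAddCommGroup E] [NormedSpace ℝ E] {n : ℕ}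
    {K₁ K₂ : E →L[ℝ] ℝ} {D₁ D₂ D : E →L[ℝ] Vec n} {M : E →L[ℝ] E →L[ℝ] ℝ}
    {Q : E →L[ℝ] E →L[ℝ] Vec n} {a₁ a₂ a : Vec n} {e : E} {N R Cl Cf σ s : ℝ}
    (hN : ‖dotL n‖ ≤ N)
    (h1 : ‖a₁‖ ≤ R) (h2 : ‖a₁ - a‖ ≤ σ) (h3 : ‖a₁ - a₂‖ ≤ s)
    (he : ‖e‖ ≤ s) (hQ : ‖Q‖ ≤ Cf) (hD : ‖D₂ - D‖ ≤ Cf * σ)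
    (hl : ‖K₁ - K₂ - M e‖ ≤ Cl * σ * s) (hf : ‖D₁ - D₂ - Q e‖ ≤ Cf * σ * s) :
    ‖(K₁ + dotL n a₁ ∘L D₁) - (K₂ + dotL n a₂ ∘L D₂) -
      ((M e + dotL n a ∘L Q e) + dotL n (a₁ - a₂) ∘L D)‖ ≤
      (Cl + N * R * Cf + N * Cf + N * Cf) * σ * s := by
  have split : (K₁ + dotL n a₁ ∘L D₁) - (K₂ + dotL n a₂ ∘L D₂) -
      ((M e + dotL n a ∘L Q e) + dotL n (a₁ - a₂) ∘L D) =
      (K₁ - K₂ - M e) + dotL n a₁ ∘L (D₁ - D₂ - Q e) +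
        dotL n (a₁ - a) ∘L Q e + dotL n (a₁ - a₂) ∘L (D₂ - D) := by
    rw [map_sub (dotL n) a₁ a₂, map_sub (dotL n) a₁ a]
    simp only [ContinuousLinearMap.comp_sub, ContinuousLinearMap.sub_comp]
    abel
  rw [split]
  have hQe : ‖Q e‖ ≤ Cf * s := Q.le_of_opNorm_le_of_le hQ he
  calc _ ≤ Cl * σ * s + N * R * (Cf * σ * s) + N * σ * (Cf * s) + N * s * (Cf * σ) :=
        (norm_add_le _ _).trans (add_le_add ((norm_add_le _ _).trans (add_le_add
          ((norm_add_le _ _).trans (add_le_add hl (norm_dotL_comp_le hN h1 hf)))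
          (norm_dotL_comp_le hN h2 hQe))) (norm_dotL_comp_le hN h3 hD))
    _ = _ := by ring

theorem norm_sub_self_eq {V : Type*} [SeminormedAddCommGroup V] (z : V) : ‖z - z‖ = 0 := by simp

theorem ae_pathAt_sub_le (z z' : P.Z) :
    ∀ᵐ t ∂P.μ, ‖yAt z t - yAt z' t‖ ≤ ‖z - z'‖ ∧ ‖costate z t - costate z' t‖ ≤ ‖z - z'‖ := by
  filter_upwards [pathAt_sub z z', ae_norm_pathAt_le (z - z')] with t h1 h2
  rw [h1] at h2
  exact ⟨(norm_fst_le (pathAt z t - pathAt z' t)).trans h2,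
    (norm_snd_le (pathAt z t - pathAt z' t)).trans h2⟩

/-- Trajectories of elements near `zbar` stay in a ball whose radius is the one used for the
pointwise estimates, the number `r` being the norm of the component function. -/
theorem ae_yAt_mem {z zbar : P.Z} {r : ℝ} (hr : 0 ≤ r) (h : ‖z - zbar‖ ≤ 1) :
    ∀ᵐ t ∂P.μ, yAt z t ∈ Metric.closedBall (0 : Triple nx nu np) (‖zbar‖ + r + 1) ∧
      ‖costate z t‖ ≤ ‖zbar‖ + r + 1 := by
  have hz : ‖z‖ ≤ ‖zbar‖ + r + 1 := by
    have := norm_sub_norm_le z zbar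
    linarith
  filter_upwards [ae_norm_pathAt_le z] with t ht
  exact ⟨mem_closedBall_zero_iff.2 (((norm_fst_le (pathAt z t)).trans ht).trans hz),
    ((norm_snd_le (pathAt z t)).trans ht).trans hz⟩

theorem norm_le_radius {zbar : P.Z} {g gbar : P.G} (h : ‖g - gbar‖ ≤ 1) :
    ‖g‖ ≤ ‖zbar‖ + ‖gbar‖ + 1 := by
  have := norm_sub_norm_le g gbar
  linarith [norm_nonneg zbar]

/-- Strict differentiability of the superposition operator in the trajectory, with an explicit
modulus that also controls the perturbation of the component function. -/
theorem exists_nem_strict (hP : P.IsSmooth) (zbar : P.Z) (gbar : P.G) :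
    ∃ C, 0 ≤ C ∧ ∀ (g : P.G) (z₁ z₂ : P.Z), ‖g - gbar‖ ≤ 1 → ‖z₁ - zbar‖ ≤ 1 →
      ‖z₂ - zbar‖ ≤ 1 → ∀ᵐ t ∂P.μ,
      ‖P.nem z₁ g t - P.nem z₂ g t - P.nemDeriv zbar gbar t (pathAt z₁ t - pathAt z₂ t)‖ ≤
        C * (‖z₁ - zbar‖ + ‖z₂ - zbar‖ + ‖g - gbar‖) * ‖z₁ - z₂‖ := by
  set R := ‖zbar‖ + ‖gbar‖ + 1
  have hR : 0 < R := by positivity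
  obtain ⟨Cf, hCf, Hf⟩ := hP.f.exists_pairEstimate hR
  obtain ⟨Cl, hCl, Hl⟩ := hP.l.exists_pairEstimate hR
  obtain ⟨N, hN, hN0⟩ : ∃ N, ‖dotL nx‖ ≤ N ∧ 0 ≤ N := ⟨_, le_rfl, norm_nonneg (dotL nx)⟩
  have hsum : 0 ≤ Cl + N * R * Cf + N * Cf + N * Cf := by positivity
  refine ⟨Cf + (Cl + N * R * Cf + N * Cf + N * Cf), add_nonneg hCf hsum, fun g z₁ z₂ hg h₁ h₂ => ?_⟩
  have hgR : ‖g‖ ≤ R := norm_le_radius hg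
  have hgbR : ‖gbar‖ ≤ R := by simp only [R]; linarith [norm_nonneg zbar]
  filter_upwards [Hf g gbar hgR hgbR, Hf gbar gbar hgbR hgbR, Hl g gbar hgR hgbR,
    ae_yAt_mem (norm_nonneg gbar) h₁, ae_yAt_mem (norm_nonneg gbar) h₂,
    ae_yAt_mem (z := zbar) (zbar := zbar) (norm_nonneg gbar)
      ((norm_sub_self_eq zbar).trans_le zero_le_one),
    ae_pathAt_sub_le z₁ zbar, ae_pathAt_sub_le z₂ zbar, ae_pathAt_sub_le z₁ z₂]
    with t f1 f2 l1 m1 m2 m0 s1 s2 s12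
  set y₁ := yAt z₁ t
  set y₂ := yAt z₂ t
  set y := yAt zbar t
  set δ := ‖g - gbar‖
  set σ := ‖z₁ - zbar‖ + ‖z₂ - zbar‖ + δ with hσ
  have hδ : 0 ≤ δ := norm_nonneg _
  have hσ0 : 0 ≤ σ := by positivity
  have hy : ‖y₁ - y‖ + ‖y₂ - y‖ + δ ≤ σ := by linarith [s1.1, s2.1]
  have strict : ∀ {C a : ℝ}, 0 ≤ C → a ≤ C * (‖y₁ - y‖ + ‖y₂ - y‖ + δ) * ‖y₁ - y₂‖ →
      a ≤ C * σ * ‖z₁ - z₂‖ := fun hC h =>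
    h.trans (mul_le_mul (mul_le_mul_of_nonneg_left hy hC) s12.1 (norm_nonneg _) (by positivity))
  have e0 := strict hCf (f1.strict₀ _ m1.1 _ m2.1 _ m0.1)
  have e1 := strict hCl (l1.strict₁ _ m1.1 _ m2.1 _ m0.1)
  have e2 := strict hCf (f1.strict₁ _ m1.1 _ m2.1 _ m0.1)
  have e3 := f2.bdd₂ _ m0.1
  have e4 := f1.close₁ _ m2.1 _ m0.1
  set D₁ := fderiv ℝ (fun y => P.f t (y, g t y)) y₁ with hD₁
  set D₂ := fderiv ℝ (fun y => P.f t (y, g t y)) y₂ with hD₂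
  set D := fderiv ℝ (fun y => P.f t (y, gbar t y)) y with hD
  set Q := fderiv ℝ (fderiv ℝ (fun y => P.f t (y, gbar t y))) y with hQ
  set K₁ := fderiv ℝ (fun y => P.l t (y, g t y)) y₁
  set K₂ := fderiv ℝ (fun y => P.l t (y, g t y)) y₂
  set M := fderiv ℝ (fderiv ℝ (fun y => P.l t (y, gbar t y))) y
  set a₁ := costate z₁ t
  set a₂ := costate z₂ t
  set a := costate zbar t
  have hpath : pathAt z₁ t - pathAt z₂ t = (y₁ - y₂, a₁ - a₂) := rfl
  rw [hpath, nemDeriv_apply]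
  have hs2 : ‖z₂ - zbar‖ ≤ σ := by linarith [norm_nonneg (z₁ - zbar)]
  have hs1 : ‖z₁ - zbar‖ ≤ σ := by linarith [norm_nonneg (z₂ - zbar)]
  have hfst : ‖P.f t (y₁, g t y₁) - P.f t (y₂, g t y₂) - D (y₁ - y₂)‖ ≤
      Cf * σ * ‖z₁ - z₂‖ := e0
  have hsnd : ‖(K₁ + dotL nx a₁ ∘L D₁) - (K₂ + dotL nx a₂ ∘L D₂) -
      ((M (y₁ - y₂) + dotL nx a ∘L Q (y₁ - y₂)) + dotL nx (a₁ - a₂) ∘L D)‖ ≤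
      (Cl + N * R * Cf + N * Cf + N * Cf) * σ * ‖z₁ - z₂‖ :=
    norm_hamiltonian_remainder_le hN m1.2 (s1.2.trans hs1) s12.2
      s12.1 e3 (e4.trans (mul_le_mul_of_nonneg_left (by linarith [s2.1, norm_nonneg (z₁ - zbar)])
        hCf)) e1 e2
  have hz12 : 0 ≤ σ * ‖z₁ - z₂‖ := mul_nonneg hσ0 (norm_nonneg _)
  refine max_le (hfst.trans ?_) (hsnd.trans ?_)
  · rw [mul_assoc _ σ, mul_assoc _ σ]
    exact mul_le_mul_of_nonneg_right (le_add_of_nonneg_right hsum) hz12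
  · rw [mul_assoc _ σ, mul_assoc _ σ]
    exact mul_le_mul_of_nonneg_right (le_add_of_nonneg_left hCf) hz12

/-- The derivative of `nem` with respect to the component function, in direction `γ`. -/
def nemVar (P : Problem nx nu np ng) (z : P.Z) (g γ : P.G) (t : ℝ) :
    Vec nx × (Triple nx nu np →L[ℝ] ℝ) :=
  (fderiv ℝ (P.f t) (yAt z t, g t (yAt z t)) (0, γ t (yAt z t)),
    variation (P.l t) (g t) (γ t) (yAt z t) +
      dotL nx (costate z t) ∘L variation (P.f t) (g t) (γ t) (yAt z t))

/-- Dependence of the superposition operator on the component function, at a fixed trajectory. -/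
theorem exists_nem_taylor (hP : P.IsSmooth) (zbar : P.Z) (gbar : P.G) :
    ∃ C, 0 ≤ C ∧ ∀ g : P.G, ‖g - gbar‖ ≤ 1 → ∀ᵐ t ∂P.μ,
      ‖P.nem zbar g t - P.nem zbar gbar t‖ ≤ C * ‖g - gbar‖ ∧
      ‖P.nem zbar g t - P.nem zbar gbar t - P.nemVar zbar gbar (g - gbar) t‖ ≤
        C * ‖g - gbar‖ ^ 2 := by
  set R := ‖zbar‖ + ‖gbar‖ + 1
  have hR : 0 < R := by positivity
  obtain ⟨Cf, hCf, Hf⟩ := hP.f.exists_pairEstimate hR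
  obtain ⟨Cl, hCl, Hl⟩ := hP.l.exists_pairEstimate hR
  obtain ⟨N, hN, hN0⟩ : ∃ N, ‖dotL nx‖ ≤ N ∧ 0 ≤ N := ⟨_, le_rfl, norm_nonneg (dotL nx)⟩
  have hsum : 0 ≤ Cl + N * R * Cf := by positivity
  have fin : ∀ {b a₁ a₂ : ℝ}, 0 ≤ b → a₁ ≤ Cf * b → a₂ ≤ (Cl + N * R * Cf) * b →
      max a₁ a₂ ≤ (Cf + (Cl + N * R * Cf)) * b := fun hb h1 h2 => by
    refine max_le (h1.trans ?_) (h2.trans ?_)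
    · exact mul_le_mul_of_nonneg_right (le_add_of_nonneg_right hsum) hb
    · exact mul_le_mul_of_nonneg_right (le_add_of_nonneg_left hCf) hb
  refine ⟨Cf + (Cl + N * R * Cf), add_nonneg hCf hsum, fun g hg => ?_⟩
  have hgR : ‖g‖ ≤ R := norm_le_radius hg
  have hgbR : ‖gbar‖ ≤ R := by simp only [R]; linarith [norm_nonneg zbar]
  filter_upwards [Hf g gbar hgR hgbR, Hl g gbar hgR hgbR,
    ae_yAt_mem (z := zbar) (zbar := zbar) (norm_nonneg gbar)
      ((norm_sub_self_eq zbar).trans_le zero_le_one)] with t f1 l1 m0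
  set y := yAt zbar t
  set δ := ‖g - gbar‖
  have hδ : 0 ≤ δ := norm_nonneg _
  set a := costate zbar t
  have hdot : ∀ (D : Triple nx nu np →L[ℝ] Vec nx) (c : ℝ), ‖D‖ ≤ c →
      ‖dotL nx a ∘L D‖ ≤ N * R * c := fun D c hD =>
    norm_dotL_comp_le hN m0.2 hD
  have c0 := f1.close₀ _ m0.1 _ m0.1
  have c1 := f1.close₁ _ m0.1 _ m0.1
  have c2 := l1.close₁ _ m0.1 _ m0.1
  rw [sub_self, norm_zero, zero_add] at c0 c1 c2
  have c3 := f1.taylor₀ _ m0.1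
  have c4 := f1.taylor₁ _ m0.1
  have c5 := l1.taylor₁ _ m0.1
  set D₁ := fderiv ℝ (fun y => P.f t (y, g t y)) y
  set D := fderiv ℝ (fun y => P.f t (y, gbar t y)) y
  set K₁ := fderiv ℝ (fun y => P.l t (y, g t y)) y
  set K := fderiv ℝ (fun y => P.l t (y, gbar t y)) y
  set Vf := variation (P.f t) (gbar t) (fun y => g t y - gbar t y) y
  set Vl := variation (P.l t) (gbar t) (fun y => g t y - gbar t y) y
  constructor
  · refine fin hδ c0 ?_
    change ‖(K₁ + dotL nx a ∘L D₁) - (K + dotL nx a ∘L D)‖ ≤ _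
    rw [add_sub_add_comm, ← ContinuousLinearMap.comp_sub]
    calc _ ≤ Cl * δ + N * R * (Cf * δ) :=
        (norm_add_le _ _).trans (add_le_add c2 (hdot _ _ c1))
      _ = _ := by ring
  · refine fin (sq_nonneg δ) c3 ?_
    change ‖(K₁ + dotL nx a ∘L D₁) - (K + dotL nx a ∘L D) - (Vl + dotL nx a ∘L Vf)‖ ≤ _
    have split : (K₁ + dotL nx a ∘L D₁) - (K + dotL nx a ∘L D) - (Vl + dotL nx a ∘L Vf) =
        (K₁ - K - Vl) + dotL nx a ∘L (D₁ - D - Vf) := by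
      simp only [ContinuousLinearMap.comp_sub]; abel
    rw [split]
    calc _ ≤ Cl * δ ^ 2 + N * R * (Cf * δ ^ 2) :=
        (norm_add_le _ _).trans (add_le_add c5 (hdot _ _ c4))
      _ = _ := by ring

/-- First-order expansion of the superposition operator, jointly in the trajectory and the component
function. -/
theorem exists_nem_expansion (hP : P.IsSmooth) (zbar : P.Z) (gbar : P.G) :
    ∃ C, 0 ≤ C ∧ ∀ (g : P.G) (z : P.Z), ‖g - gbar‖ ≤ 1 → ‖z - zbar‖ ≤ 1 → ∀ᵐ t ∂P.μ,
      ‖P.nem z g t - P.nem zbar gbar t - P.nemDeriv zbar gbar t (pathAt z t - pathAt zbar t) -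
        P.nemVar zbar gbar (g - gbar) t‖ ≤ C * (‖z - zbar‖ + ‖g - gbar‖) ^ 2 := by
  obtain ⟨C₁, h1, H1⟩ := exists_nem_strict hP zbar gbar
  obtain ⟨C₂, h2, H2⟩ := exists_nem_taylor hP zbar gbar
  refine ⟨C₁ + C₂, by positivity, fun g z hg hz => ?_⟩
  filter_upwards [H1 g z zbar hg hz ((norm_sub_self_eq zbar).trans_le zero_le_one),
    H2 g hg] with t e1 e2
  rw [norm_sub_self_eq zbar, add_zero] at e1
  set a := ‖z - zbar‖
  set b := ‖g - gbar‖
  have ha : 0 ≤ a := norm_nonneg _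
  have hb : 0 ≤ b := norm_nonneg _
  have split : P.nem z g t - P.nem zbar gbar t -
      P.nemDeriv zbar gbar t (pathAt z t - pathAt zbar t) - P.nemVar zbar gbar (g - gbar) t =
      (P.nem z g t - P.nem zbar g t - P.nemDeriv zbar gbar t (pathAt z t - pathAt zbar t)) +
      (P.nem zbar g t - P.nem zbar gbar t - P.nemVar zbar gbar (g - gbar) t) := by abel
  rw [split]
  refine ((norm_add_le _ _).trans (add_le_add e1 e2.2)).trans ?_
  have t1 : C₁ * (a + b) * a ≤ C₁ * (a + b) ^ 2 := by
    rw [sq, ← mul_assoc]; gcongr; linarith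
  have t2 : C₂ * b ^ 2 ≤ C₂ * (a + b) ^ 2 := by gcongr; linarith
  linarith

/-- The corresponding expansion for the integrand of the quantity of interest. -/
theorem exists_integrand_expansion {F : ℝ → Triple nx nu np × Vec ng → ℝ}
    (hF : Smooth P.t₀ P.t_f F) (zbar : P.Z) (gbar : P.G) :
    ∃ C, 0 ≤ C ∧ ∀ (g : P.G) (z : P.Z), ‖g - gbar‖ ≤ 1 → ‖z - zbar‖ ≤ 1 → ∀ᵐ t ∂P.μ,
      ‖F t (yAt z t, g t (yAt z t)) - F t (yAt zbar t, gbar t (yAt zbar t)) -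
        fderiv ℝ (fun y => F t (y, gbar t y)) (yAt zbar t) (yAt z t - yAt zbar t) -
        fderiv ℝ (F t) (yAt zbar t, gbar t (yAt zbar t)) (0, (g - gbar) t (yAt zbar t))‖ ≤
        C * (‖z - zbar‖ + ‖g - gbar‖) ^ 2 := by
  obtain ⟨C, hC, H⟩ := hF.exists_pairEstimate (R := ‖zbar‖ + ‖gbar‖ + 1) (by positivity)
  refine ⟨C + C, by positivity, fun g z hg hz => ?_⟩
  have hgbR : ‖gbar‖ ≤ ‖zbar‖ + ‖gbar‖ + 1 := by linarith [norm_nonneg zbar]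
  filter_upwards [H g gbar (norm_le_radius hg) hgbR, ae_yAt_mem (norm_nonneg gbar) hz,
    ae_yAt_mem (z := zbar) (zbar := zbar) (norm_nonneg gbar)
      ((norm_sub_self_eq zbar).trans_le zero_le_one),
    ae_pathAt_sub_le z zbar] with t f1 m1 m0 s
  have e1 := f1.strict₀ _ m1.1 _ m0.1 _ m0.1
  have e2 := f1.taylor₀ _ m0.1
  rw [sub_self, norm_zero, add_zero] at e1
  set a := ‖z - zbar‖
  set b := ‖g - gbar‖
  have ha : 0 ≤ a := norm_nonneg _
  have hb : 0 ≤ b := norm_nonneg _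
  have e1' : _ ≤ C * (a + b) * a := e1.trans (mul_le_mul
    (mul_le_mul_of_nonneg_left (by linarith [s.1]) hC) s.1 (norm_nonneg _) (by positivity))
  have split : ∀ p q r d v : ℝ, p - q - d - v = (p - r - d) + (r - q - v) := fun _ _ _ _ _ => by
    ring
  rw [split _ _ (F t (yAt zbar t, g t (yAt zbar t)))]
  refine ((norm_add_le _ _).trans (add_le_add e1' e2)).trans ?_
  have : 0 ≤ C * (a * b) := by positivity
  have : 0 ≤ C * (a * a) := by positivity
  have : 0 ≤ C * (b * b) := by positivity
  nlinarith

end Problem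

/-! ### Coordinate blocks of derivatives -/

section Blocks

variable {nx nu np : ℕ} {E W : Type*} [NormedAddCommGroup E] [NormedSpace ℝ E]
  [NormedAddCommGroup W] [NormedSpace ℝ W] {m n : ℕ} {ι : Type*}

theorem sum_smul_single (L : Vec n →ₗ[ℝ] W) (v : Vec n) :
    ∑ j, v j • L (Pi.single j 1) = L v := by
  rw [LinearMap.pi_apply_eq_sum_univ]
  refine Finset.sum_congr rfl fun j _ => ?_
  congr 2
  ext i
  simp [Pi.single_apply, eq_comm]

theorem prodMk_eq_add {M N : Type*} [AddZeroClass M] [AddZeroClass N] (a : M) (b : N) :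
    (a, b) = (a, 0) + (0, b) := by simp

theorem clm_triple_eq_sum (L : Triple nx nu np →L[ℝ] W) (y : Triple nx nu np) :
    ∑ j, y.1 j • L (dirX nx nu np j) + ∑ j, y.2.1 j • L (dirU nx nu np j) +
      ∑ j, y.2.2 j • L (dirP nx nu np j) = L y := by
  have h1 : ∑ j, y.1 j • L (Pi.single j 1, 0, 0) = L (y.1, 0, 0) :=
    sum_smul_single (L.toLinearMap ∘ₗ LinearMap.inl ℝ (Vec nx) (Vec nu × Vec np)) y.1
  have h2 := sum_smul_single (L.toLinearMap ∘ₗ LinearMap.inr ℝ (Vec nx) (Vec nu × Vec np) ∘ₗ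
    LinearMap.inl ℝ (Vec nu) (Vec np)) y.2.1
  have h3 := sum_smul_single (L.toLinearMap ∘ₗ LinearMap.inr ℝ (Vec nx) (Vec nu × Vec np) ∘ₗ
    LinearMap.inr ℝ (Vec nu) (Vec np)) y.2.2
  simp only [LinearMap.comp_apply, LinearMap.inl_apply, LinearMap.inr_apply,
    ContinuousLinearMap.coe_coe] at h2 h3
  unfold dirX dirU dirP
  rw [h1, h2, h3, ← map_add, ← map_add]
  congr 1
  simp

theorem clm_endPt_eq_sum (L : Vec nx × Vec np →L[ℝ] W) (e : Vec nx × Vec np) :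
    ∑ j, e.1 j • L (Problem.endX j) + ∑ j, e.2 j • L (Problem.endP j) = L e := by
  have h1 := sum_smul_single (L.toLinearMap ∘ₗ LinearMap.inl ℝ (Vec nx) (Vec np)) e.1
  have h2 := sum_smul_single (L.toLinearMap ∘ₗ LinearMap.inr ℝ (Vec nx) (Vec np)) e.2
  simp only [LinearMap.comp_apply, LinearMap.inl_apply, LinearMap.inr_apply,
    ContinuousLinearMap.coe_coe] at h1 h2
  unfold Problem.endX Problem.endP
  rw [h1, h2, ← map_add]
  congr 1
  simp

theorem clm_dirG_eq_sum (L : E × Vec n →L[ℝ] W) (v : Vec n) :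
    ∑ k, v k • L (dirG k) = L (0, v) := by
  have h1 := sum_smul_single (L.toLinearMap ∘ₗ LinearMap.inr ℝ E (Vec n)) v
  exact h1

/-- The chain rule for `y ↦ F (y, g y)` in matrix form, for vector-valued `F`. -/
theorem totalJac_eq {F : E × Vec n → Vec m} {g : E → Vec n} {y : E}
    (hF : DifferentiableAt ℝ F (y, g y)) (hg : DifferentiableAt ℝ g y) (e : ι → E) (i : Fin m)
    (j : ι) : totalJac F g y e i j = fderiv ℝ (fun y => F (y, g y)) y (e j) i := by
  rw [fderiv_comp_graph hF hg, ContinuousLinearMap.comp_apply, graphDeriv_apply,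
    prodMk_eq_add (e j), map_add, ← clm_dirG_eq_sum]
  simp [totalJac, jac, inY, Matrix.mul_apply, mul_comm]

/-- The chain rule for `y ↦ F (y, g y)` in matrix form, for scalar `F`. -/
theorem totalGrad_eq {F : E × Vec n → ℝ} {g : E → Vec n} {y : E}
    (hF : DifferentiableAt ℝ F (y, g y)) (hg : DifferentiableAt ℝ g y) (e : ι → E) (j : ι) :
    totalGrad F g y e j = fderiv ℝ (fun y => F (y, g y)) y (e j) := by
  rw [fderiv_comp_graph hF hg, ContinuousLinearMap.comp_apply, graphDeriv_apply,
    prodMk_eq_add (e j), map_add, ← clm_dirG_eq_sum]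
  simp [totalGrad, jac, grad, inY, Matrix.mulVec, dotProduct]

theorem fderiv_add_dotProduct {l : E → ℝ} {f : E → Vec m} {lam : Vec m} {w : E}
    (hl : DifferentiableAt ℝ l w) (hf : DifferentiableAt ℝ f w) :
    fderiv ℝ (fun w => l w + lam ⬝ᵥ f w) w = fderiv ℝ l w + dotL m lam ∘L fderiv ℝ f w := by
  have := hl.hasFDerivAt.add ((dotL m lam).hasFDerivAt.comp w hf.hasFDerivAt)
  have e : (l + (dotL m lam) ∘ f) = fun w => l w + lam ⬝ᵥ f w := by
    funext w; simp [dotL_apply]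
  rw [e] at this
  exact this.fderiv

theorem fderiv_fderiv_add_dotProduct {l : E → ℝ} {f : E → Vec m} {lam : Vec m} {w : E}
    (hl : ContDiff ℝ 2 l) (hf : ContDiff ℝ 2 f) :
    fderiv ℝ (fderiv ℝ (fun w => l w + lam ⬝ᵥ f w)) w = fderiv ℝ (fderiv ℝ l) w +
      ContinuousLinearMap.compL ℝ E (Vec m) ℝ (dotL m lam) ∘L fderiv ℝ (fderiv ℝ f) w := by
  have h1 : fderiv ℝ (fun w => l w + lam ⬝ᵥ f w) =
      fun w => fderiv ℝ l w + ContinuousLinearMap.compL ℝ E (Vec m) ℝ (dotL m lam)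
        (fderiv ℝ f w) := by
    funext w
    exact fderiv_add_dotProduct (hl.differentiable (by norm_num) w)
      (hf.differentiable (by norm_num) w)
  have hl1 : ContDiff ℝ 1 (fderiv ℝ l) := hl.fderiv_right (by norm_num)
  have hf1 : ContDiff ℝ 1 (fderiv ℝ f) := hf.fderiv_right (by norm_num)
  rw [h1]
  exact ((hl1.differentiable (by norm_num) w).hasFDerivAt.add
    ((ContinuousLinearMap.compL ℝ E (Vec m) ℝ (dotL m lam)).hasFDerivAt.comp w
      (hf1.differentiable (by norm_num) w).hasFDerivAt)).fderiv

theorem fderiv_fderiv_symm {F : E → W} (hF : ContDiff ℝ 2 F) (w v v' : E) :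
    fderiv ℝ (fderiv ℝ F) w v v' = fderiv ℝ (fderiv ℝ F) w v' v :=
  (hF.contDiffAt.isSymmSndFDerivAt (by simp)).eq v v'

end Blocks

namespace Problem

variable {nx nu np ng : ℕ} {P : Problem nx nu np ng}

/-- The times at which the problem data and the component function are smooth. -/
structure SmoothAt (P : Problem nx nu np ng) (g : P.G) (t : ℝ) : Prop where
  l : ContDiff ℝ 2 (P.l t)
  f : ContDiff ℝ 2 (P.f t)
  g : ContDiff ℝ 2 (g t)

theorem ae_smoothAt (hP : P.IsSmooth) (g : P.G) : ∀ᵐ t ∂P.μ, P.SmoothAt g t := by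
  filter_upwards [hP.l.contDiff, hP.f.contDiff, g.2.1] with t h1 h2 h3
  exact ⟨h1, h2, h3.of_le (by norm_cast)⟩

theorem grad_dirG_dotProduct (Φ : Triple nx nu np × Vec ng → ℝ) (a : Triple nx nu np × Vec ng)
    (v : Vec ng) : grad Φ a dirG ⬝ᵥ v = fderiv ℝ Φ a (0, v) := by
  rw [← clm_dirG_eq_sum]
  simp [grad, dotProduct, mul_comm]

theorem fg_mulVec (z : P.Z) (g : P.G) (t : ℝ) (v : Vec ng) :
    P.fg z g t *ᵥ v = fderiv ℝ (P.f t) (yAt z t, g t (yAt z t)) (0, v) := by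
  rw [← clm_dirG_eq_sum]
  ext i
  simp [fg, jac, Matrix.mulVec, dotProduct, mul_comm]

theorem d_dotProduct (z : P.Z) (g : P.G) (t : ℝ) (v : Vec ng) :
    P.d z g t ⬝ᵥ v = fderiv ℝ (P.l t) (yAt z t, g t (yAt z t)) (0, v) +
      costate z t ⬝ᵥ fderiv ℝ (P.f t) (yAt z t, g t (yAt z t)) (0, v) := by
  rw [d, add_dotProduct, grad_dirG_dotProduct, Matrix.mulVec_transpose,
    ← Matrix.dotProduct_mulVec, fg_mulVec, add_comm]

section At

variable {g : P.G} {t : ℝ} (h : P.SmoothAt g t) (z : P.Z) {ι : Type*} (e : ι → Triple nx nu np)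
include h

theorem SmoothAt.totalJac_f (i : Fin nx) (j : ι) :
    totalJac (P.f t) (g t) (yAt z t) e i j = P.stateDeriv z g t (e j) i :=
  totalJac_eq (h.f.differentiable (by norm_num) _) (h.g.differentiable (by norm_num) _) e i j

/-- The state equation of the linearized system in coordinates. -/
theorem SmoothAt.stateDeriv_apply (y : Triple nx nu np) :
    P.A z g t *ᵥ y.1 + P.B z g t *ᵥ y.2.1 + P.C z g t *ᵥ y.2.2 = P.stateDeriv z g t y := by
  rw [← clm_triple_eq_sum]
  ext i
  simp only [A, B, C, Matrix.mulVec, dotProduct, Pi.add_apply, Finset.sum_apply, Pi.smul_apply,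
    h.totalJac_f, smul_eq_mul, mul_comm]

theorem SmoothAt.transpose_mulVec (lam : Vec nx) (j : ι) :
    ((totalJac (P.f t) (g t) (yAt z t) e)ᵀ *ᵥ lam) j =
      (dotL nx lam ∘L P.stateDeriv z g t) (e j) := by
  rw [ContinuousLinearMap.comp_apply, dotL_apply, dotProduct_comm]
  simp only [Matrix.mulVec, dotProduct, Matrix.transpose_apply, h.totalJac_f]

theorem SmoothAt.costateForm_apply (j : ι) :
    ((totalJac (P.f t) (g t) (yAt z t) e)ᵀ *ᵥ costate z t +
      totalGrad (P.l t) (g t) (yAt z t) e) j = P.costateForm z g t (e j) := by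
  rw [Pi.add_apply, h.transpose_mulVec, totalGrad_eq (h.l.differentiable (by norm_num) _)
    (h.g.differentiable (by norm_num) _), add_comm]
  rfl

theorem SmoothAt.fderiv_fderiv_redHam :
    fderiv ℝ (fderiv ℝ (P.redHam z g t)) (yAt z t) = P.hamHess z g t :=
  fderiv_fderiv_add_dotProduct (contDiff_comp_graph h.l h.g) (contDiff_comp_graph h.f h.g)

theorem SmoothAt.hamHess_symm (v v' : Triple nx nu np) :
    P.hamHess z g t v v' = P.hamHess z g t v' v := by
  rw [hamHess_apply, hamHess_apply, fderiv_fderiv_symm (contDiff_comp_graph h.l h.g),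
    fderiv_fderiv_symm (contDiff_comp_graph h.f h.g)]

/-- A row of the linearized adjoint equations in coordinates. -/
theorem SmoothAt.HH_apply (y : Triple nx nu np) (j : ι) :
    (P.HH z g t e (dirX nx nu np) *ᵥ y.1 + P.HH z g t e (dirU nx nu np) *ᵥ y.2.1 +
      P.HH z g t e (dirP nx nu np) *ᵥ y.2.2) j = P.hamHess z g t y (e j) := by
  rw [h.hamHess_symm, ← clm_triple_eq_sum]
  simp only [HH, hess, Matrix.mulVec, dotProduct, Pi.add_apply, Matrix.of_apply,
    h.fderiv_fderiv_redHam, smul_eq_mul, mul_comm]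

/-- The weight of a perturbation of the value of the component function. -/
theorem SmoothAt.coeff_dotProduct {ell : ℝ → Triple nx nu np × Vec ng → ℝ} (w : P.Z) (c : Vec ng) :
    P.coeff ell z g w t ⬝ᵥ c = fderiv ℝ (ell t) (yAt z t, g t (yAt z t)) (0, c) +
      costate w t ⬝ᵥ fderiv ℝ (P.f t) (yAt z t, g t (yAt z t)) (0, c) +
      (fderiv ℝ (fderiv ℝ (P.l t)) (yAt z t, g t (yAt z t)) (0, c)
          (graphDeriv (g t) (yAt z t) (yAt w t)) +
        costate z t ⬝ᵥ fderiv ℝ (fderiv ℝ (P.f t)) (yAt z t, g t (yAt z t)) (0, c)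
          (graphDeriv (g t) (yAt z t) (yAt w t))) := by
  set y := yAt z t
  set lam := costate z t
  set yw := yAt w t with hyw
  set Q := fderiv ℝ (fderiv ℝ (P.ham t lam)) (y, g t y) with hQ
  have hham : ContDiff ℝ 2 (P.ham t lam) := by
    have : P.ham t lam = fun w => P.l t w + dotL nx lam (P.f t w) := by
      funext w; rw [dotL_apply]; rfl
    rw [this]
    exact h.l.add ((dotL nx lam).contDiff.comp h.f)
  have hHG : ∀ {κ : Type} [Fintype κ] (e' : κ → Triple nx nu np) (v : κ → ℝ),
      ((P.HG z g t e')ᵀ *ᵥ v) ⬝ᵥ c =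
        ∑ j, v j • (Q.flip (0, c) ∘L graphDeriv (g t) y) (e' j) := by
    intro κ _ e' v
    rw [Matrix.mulVec_transpose, ← Matrix.dotProduct_mulVec]
    refine Finset.sum_congr rfl fun j _ => ?_
    rw [smul_eq_mul]
    congr 1
    rw [ContinuousLinearMap.comp_apply, graphDeriv_apply, ContinuousLinearMap.flip_apply,
      prodMk_eq_add (e' j), map_add, ← clm_dirG_eq_sum, ← clm_dirG_eq_sum]
    simp only [HG, Matrix.mulVec, dotProduct, Matrix.add_apply, Matrix.mul_apply, hess,
      Matrix.of_apply, Matrix.transpose_apply, jac, inY, smul_eq_mul, add_apply,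
      sum_apply, smul_apply]
    refine Finset.sum_congr rfl fun k _ => ?_
    rw [mul_comm]
  have hQsum : Q (graphDeriv (g t) y yw) (0, c) =
      fderiv ℝ (fderiv ℝ (P.l t)) (y, g t y) (0, c) (graphDeriv (g t) y yw) +
        lam ⬝ᵥ fderiv ℝ (fderiv ℝ (P.f t)) (y, g t y) (0, c) (graphDeriv (g t) y yw) := by
    rw [hQ, fderiv_fderiv_symm hham]
    have := fderiv_fderiv_add_dotProduct (lam := lam) (w := (y, g t y)) h.l h.f
    have h2 := congrArg (fun L => L (0, c) (graphDeriv (g t) y yw)) this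
    simp only [add_apply, ContinuousLinearMap.comp_apply, ContinuousLinearMap.compL_apply,
      dotL_apply] at h2
    exact h2
  have hHsum := clm_triple_eq_sum (Q.flip (0, c) ∘L graphDeriv (g t) y) yw
  rw [coeff, add_dotProduct, add_dotProduct, add_dotProduct, add_dotProduct, grad_dirG_dotProduct,
    hHG, hHG, hHG, Matrix.mulVec_transpose, ← Matrix.dotProduct_mulVec, fg_mulVec]
  change ∑ j, yw.1 j • _ + ∑ j, yw.2.1 j • _ + ∑ j, yw.2.2 j • _ + _ + _ = _
  rw [hHsum, ContinuousLinearMap.comp_apply, ContinuousLinearMap.flip_apply, hQsum]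
  ring

/-- The effect of a perturbation `γ` of the component function on the linearized system, tested with
the adjoint solution, in coordinates. -/
theorem SmoothAt.coeff_add_d_dotProduct {ell : ℝ → Triple nx nu np × Vec ng → ℝ} (w : P.Z)
    (γ : P.G) :
    P.coeff ell z g w t ⬝ᵥ γ t (yAt z t) + P.d z g t ⬝ᵥ fderiv ℝ (γ t) (yAt z t) (yAt w t) =
      fderiv ℝ (ell t) (yAt z t, g t (yAt z t)) (0, γ t (yAt z t)) +
        costate w t ⬝ᵥ (P.nemVar z g γ t).1 + (P.nemVar z g γ t).2 (yAt w t) := by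
  rw [h.coeff_dotProduct, d_dotProduct]
  simp only [nemVar, variation, add_apply, ContinuousLinearMap.comp_apply,
    ContinuousLinearMap.inr_apply, dotL_apply, dotProduct_add]
  ring

end At

end Problem

/-! ### The optimality system as an equation between Banach spaces -/

/-- The derivative, as an operator on `W^{1,∞}`. -/
def WSpace.derL (n : ℕ) (t₀ t_f : ℝ) : WSpace n ∞ t₀ t_f →L[ℝ] LSpace n ∞ t₀ t_f :=
  ContinuousLinearMap.snd ℝ _ _ ∘L (sobolevSubmodule n ∞ t₀ t_f).subtypeL

/-- The value at a point of the closed interval, as an operator on `W^{1,∞}`. -/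
def WSpace.valL (n : ℕ) {t₀ t_f : ℝ} (t : Icc t₀ t_f) : WSpace n ∞ t₀ t_f →L[ℝ] Vec n :=
  ContinuousMap.evalCLM ℝ t ∘L ContinuousLinearMap.fst ℝ _ _ ∘L
    (sobolevSubmodule n ∞ t₀ t_f).subtypeL

theorem WSpace.valL_apply {n : ℕ} {t₀ t_f : ℝ} (t : Icc t₀ t_f) (x : WSpace n ∞ t₀ t_f) :
    WSpace.valL n t x = x.val t := (WSpace.val_of_mem x t.2).symm

/-- The integral, as an operator on `L^∞`. -/
def integralL (n : ℕ) (t₀ t_f : ℝ) : LSpace n ∞ t₀ t_f →L[ℝ] Vec n :=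
  LinearMap.mkContinuousOfExistsBound
    { toFun := fun f => ∫ t, f t ∂timeMeasure t₀ t_f
      map_add' := fun f g => by
        rw [integral_congr_ae (Lp.coeFn_add f g)]
        exact integral_add ((Lp.memLp f).integrable le_top) ((Lp.memLp g).integrable le_top)
      map_smul' := fun c f => by
        rw [integral_congr_ae (Lp.coeFn_smul c f)]
        exact integral_smul c _ }
    ⟨(timeMeasure t₀ t_f).real univ, fun f => by
      rw [mul_comm]
      exact norm_integral_le_of_norm_le_const (ae_norm_le_norm_Lp_top f)⟩

/-- The values of a functional in a finite family of directions. -/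
def evalL {E ι : Type*} [NormedAddCommGroup E] [NormedSpace ℝ E] [Fintype ι] (e : ι → E) :
    (E →L[ℝ] ℝ) →L[ℝ] (ι → ℝ) :=
  ContinuousLinearMap.pi fun j => ContinuousLinearMap.apply ℝ ℝ (e j)

theorem evalL_apply {E ι : Type*} [NormedAddCommGroup E] [NormedSpace ℝ E] [Fintype ι] (e : ι → E)
    (m : E →L[ℝ] ℝ) (j : ι) : evalL e m j = m (e j) := rfl

namespace Problem

variable {nx nu np ng : ℕ} (P : Problem nx nu np ng)

/-- Essentially bounded right-hand sides of the state equation and functionals on directions. -/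
abbrev Data : Type := Lp (Vec nx × (Triple nx nu np →L[ℝ] ℝ)) ∞ P.μ

/-- Right-hand sides of the state, adjoint and control equations and of the initial condition. -/
abbrev Dyn : Type :=
  LSpace nx ∞ P.t₀ P.t_f × LSpace nx ∞ P.t₀ P.t_f × LSpace nu ∞ P.t₀ P.t_f × Vec nx

/-- The operator applying a bounded linear map on values pointwise. -/
def dataL {n : ℕ} (L : (Vec nx × (Triple nx nu np →L[ℝ] ℝ)) →L[ℝ] Vec n) :
    P.Data →L[ℝ] LSpace n ∞ P.t₀ P.t_f := L.compLpL ∞ P.μ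

variable {P} in
theorem dataL_ae {n : ℕ} (L : (Vec nx × (Triple nx nu np →L[ℝ] ℝ)) →L[ℝ] Vec n) (N : P.Data) :
    ∀ᵐ t ∂P.μ, P.dataL L N t = L (N t) := L.coeFn_compLpL N

theorem left_mem : P.t₀ ∈ Icc P.t₀ P.t_f := ⟨le_rfl, P.lt.le⟩
theorem right_mem : P.t_f ∈ Icc P.t₀ P.t_f := ⟨P.lt.le, le_rfl⟩

/-- `z ↦ x`. -/
def stateL : P.Z →L[ℝ] WSpace nx ∞ P.t₀ P.t_f := ContinuousLinearMap.fst ℝ _ _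

/-- `z ↦ p`. -/
def parL : P.Z →L[ℝ] Vec np :=
  ContinuousLinearMap.fst ℝ (Vec np) (WSpace nx ∞ P.t₀ P.t_f) ∘L
    ContinuousLinearMap.snd ℝ (LSpace nu ∞ P.t₀ P.t_f) _ ∘L
    ContinuousLinearMap.snd ℝ (WSpace nx ∞ P.t₀ P.t_f) _

/-- `z ↦ λ`. -/
def costateL : P.Z →L[ℝ] WSpace nx ∞ P.t₀ P.t_f :=
  ContinuousLinearMap.snd ℝ (Vec np) (WSpace nx ∞ P.t₀ P.t_f) ∘L
    ContinuousLinearMap.snd ℝ (LSpace nu ∞ P.t₀ P.t_f) _ ∘L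
    ContinuousLinearMap.snd ℝ (WSpace nx ∞ P.t₀ P.t_f) _

/-- `z ↦ (x(t_f), p)`. -/
def endPtL : P.Z →L[ℝ] Vec nx × Vec np :=
  (WSpace.valL nx ⟨P.t_f, P.right_mem⟩ ∘L P.stateL).prod P.parL

/-- Evaluation of `m` in the directions `e`, on pairs `(v, m)`. -/
def formL {ι : Type*} [Fintype ι] (e : ι → Triple nx nu np) :
    (Vec nx × (Triple nx nu np →L[ℝ] ℝ)) →L[ℝ] (ι → ℝ) :=
  evalL e ∘L ContinuousLinearMap.snd ℝ _ _

/-- State, adjoint and control residuals and initial value. -/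
def dynL : P.Z × P.Data →L[ℝ] P.Dyn :=
  ((WSpace.derL nx P.t₀ P.t_f ∘L P.stateL) ∘L ContinuousLinearMap.fst ℝ P.Z P.Data -
      P.dataL (ContinuousLinearMap.fst ℝ _ _) ∘L ContinuousLinearMap.snd ℝ P.Z P.Data).prod
    (((WSpace.derL nx P.t₀ P.t_f ∘L P.costateL) ∘L ContinuousLinearMap.fst ℝ P.Z P.Data +
      P.dataL (formL (dirX nx nu np)) ∘L ContinuousLinearMap.snd ℝ P.Z P.Data).prod
    ((P.dataL (formL (dirU nx nu np)) ∘L ContinuousLinearMap.snd ℝ P.Z P.Data).prod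
      ((WSpace.valL nx ⟨P.t₀, P.left_mem⟩ ∘L P.stateL) ∘L
        ContinuousLinearMap.fst ℝ P.Z P.Data)))

/-- Residuals of the transversality and of the parameter condition. -/
def finL : P.Z × P.Data × (Vec nx × Vec np →L[ℝ] ℝ) →L[ℝ] Vec nx × Vec np :=
  ((WSpace.valL nx ⟨P.t_f, P.right_mem⟩ ∘L P.costateL) ∘L
      ContinuousLinearMap.fst ℝ P.Z (P.Data × (Vec nx × Vec np →L[ℝ] ℝ)) -
    evalL endX ∘L ContinuousLinearMap.snd ℝ P.Data (Vec nx × Vec np →L[ℝ] ℝ) ∘L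
      ContinuousLinearMap.snd ℝ P.Z (P.Data × (Vec nx × Vec np →L[ℝ] ℝ))).prod
  (evalL endP ∘L ContinuousLinearMap.snd ℝ P.Data (Vec nx × Vec np →L[ℝ] ℝ) ∘L
      ContinuousLinearMap.snd ℝ P.Z (P.Data × (Vec nx × Vec np →L[ℝ] ℝ)) +
    (integralL np P.t₀ P.t_f ∘L P.dataL (formL (dirP nx nu np))) ∘L
      ContinuousLinearMap.fst ℝ P.Data (Vec nx × Vec np →L[ℝ] ℝ) ∘L
        ContinuousLinearMap.snd ℝ P.Z (P.Data × (Vec nx × Vec np →L[ℝ] ℝ)))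

variable {P}

theorem endPtL_apply (z : P.Z) : P.endPtL z = endPt z :=
  Prod.ext (WSpace.valL_apply _ _) rfl

/-- The pointwise form of the equations contained in `dynL`. -/
theorem dynL_eq_iff (z : P.Z) (N : P.Data) (b : P.Dyn) : P.dynL (z, N) = b ↔
    (∀ᵐ t ∂P.μ, z.1.der t - (N t).1 = b.1 t) ∧
    (∀ᵐ t ∂P.μ, z.2.2.2.der t + evalL (dirX nx nu np) (N t).2 = b.2.1 t) ∧
    (∀ᵐ t ∂P.μ, evalL (dirU nx nu np) (N t).2 = b.2.2.1 t) ∧ xAt z P.t₀ = b.2.2.2 := by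
  have e : P.dynL (z, N) = (z.1.der - P.dataL (ContinuousLinearMap.fst ℝ _ _) N,
      z.2.2.2.der + P.dataL (formL (dirX nx nu np)) N, P.dataL (formL (dirU nx nu np)) N,
      xAt z P.t₀) :=
    Prod.ext rfl (Prod.ext rfl (Prod.ext rfl (WSpace.valL_apply _ _)))
  rw [e, Prod.ext_iff, Prod.ext_iff, Prod.ext_iff]
  refine and_congr ?_ (and_congr ?_ (and_congr ?_ Iff.rfl))
  · rw [Lp.ext_iff]
    refine eventually_congr ?_
    filter_upwards [Lp.coeFn_sub z.1.der (P.dataL (ContinuousLinearMap.fst ℝ _ _) N),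
      dataL_ae (ContinuousLinearMap.fst ℝ _ _) N] with t h1 h2
    rw [h1, Pi.sub_apply, h2]; rfl
  · rw [Lp.ext_iff]
    refine eventually_congr ?_
    filter_upwards [Lp.coeFn_add z.2.2.2.der (P.dataL (formL (dirX nx nu np)) N),
      dataL_ae (formL (dirX nx nu np)) N] with t h1 h2
    rw [h1, Pi.add_apply, h2]; rfl
  · rw [Lp.ext_iff]
    refine eventually_congr ?_
    filter_upwards [dataL_ae (formL (dirU nx nu np)) N] with t h2
    rw [h2]; rfl

theorem finL_eq_iff (z : P.Z) (N : P.Data) (e : Vec nx × Vec np →L[ℝ] ℝ) (b : Vec nx × Vec np) :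
    P.finL (z, N, e) = b ↔ costate z P.t_f - evalL endX e = b.1 ∧
      evalL endP e + ∫ t, evalL (dirP nx nu np) (N t).2 ∂P.μ = b.2 := by
  have key : P.finL (z, N, e) = (costate z P.t_f - evalL endX e,
      evalL endP e + ∫ t, P.dataL (formL (dirP nx nu np)) N t ∂P.μ) := by
    refine Prod.ext ?_ rfl
    change WSpace.valL nx ⟨P.t_f, P.right_mem⟩ z.2.2.2 - _ = _
    rw [WSpace.valL_apply]; rfl
  rw [key, Prod.ext_iff, integral_congr_ae (dataL_ae (formL (dirP nx nu np)) N)]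
  rfl

/-- The operator `ψ`, whose zeros are the solutions of the first-order optimality system. -/
def psi (hP : P.IsSmooth) (z : P.Z) (g : P.G) : P.Dyn × (Vec nx × Vec np) :=
  (P.dynL (z, (memLp_nem hP z g).toLp) - (0, 0, 0, P.x₀),
    P.finL (z, (memLp_nem hP z g).toLp, fderiv ℝ P.φ (endPt z)))

/-- State, adjoint, control and initial part of the linearization of `ψ`. -/
def linDyn (hP : P.IsSmooth) (z : P.Z) (g : P.G) : P.Z →L[ℝ] P.Dyn :=
  P.dynL ∘L (ContinuousLinearMap.id ℝ P.Z).prod (multL (P.nemDeriv z g) (memLp_nemDeriv hP z g))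

/-- Transversality and parameter part of the linearization of `ψ`. -/
def linFin (hP : P.IsSmooth) (z : P.Z) (g : P.G) : P.Z →L[ℝ] Vec nx × Vec np :=
  P.finL ∘L (ContinuousLinearMap.id ℝ P.Z).prod
    ((multL (P.nemDeriv z g) (memLp_nemDeriv hP z g)).prod
      (fderiv ℝ (fderiv ℝ P.φ) (endPt z) ∘L P.endPtL))

theorem multL_nemDeriv_ae (hP : P.IsSmooth) (z : P.Z) (g : P.G) (w : P.Z) : ∀ᵐ t ∂P.μ,
    multL (P.nemDeriv z g) (memLp_nemDeriv hP z g) w t =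
      (P.stateDeriv z g t (yAt w t),
        P.hamHess z g t (yAt w t) + dotL nx (costate w t) ∘L P.stateDeriv z g t) := by
  filter_upwards [multL_ae (P.nemDeriv z g) (memLp_nemDeriv hP z g) w] with t ht
  rw [ht]; exact P.nemDeriv_apply z g t _ _

/-- The linearized state, adjoint and control equations in pointwise form. -/
theorem linDyn_eq_iff (hP : P.IsSmooth) (z : P.Z) (g : P.G) (w : P.Z) (b : P.Dyn) :
    linDyn hP z g w = b ↔
    (∀ᵐ t ∂P.μ, w.1.der t - P.stateDeriv z g t (yAt w t) = b.1 t) ∧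
    (∀ᵐ t ∂P.μ, w.2.2.2.der t + evalL (dirX nx nu np)
      (P.hamHess z g t (yAt w t) + dotL nx (costate w t) ∘L P.stateDeriv z g t) = b.2.1 t) ∧
    (∀ᵐ t ∂P.μ, evalL (dirU nx nu np)
      (P.hamHess z g t (yAt w t) + dotL nx (costate w t) ∘L P.stateDeriv z g t) = b.2.2.1 t) ∧
    xAt w P.t₀ = b.2.2.2 := by
  refine (dynL_eq_iff w (multL (P.nemDeriv z g) (memLp_nemDeriv hP z g) w) b).trans ?_
  have := multL_nemDeriv_ae hP z g w
  refine and_congr (eventually_congr ?_) (and_congr (eventually_congr ?_)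
    (and_congr (eventually_congr ?_) Iff.rfl))
  all_goals
    filter_upwards [this] with t ht
    rw [ht]

/-- The linearized transversality and parameter conditions. -/
theorem linFin_eq_iff (hP : P.IsSmooth) (z : P.Z) (g : P.G) (w : P.Z) (b : Vec nx × Vec np) :
    linFin hP z g w = b ↔
    costate w P.t_f - evalL endX (fderiv ℝ (fderiv ℝ P.φ) (endPt z) (endPt w)) = b.1 ∧
    evalL endP (fderiv ℝ (fderiv ℝ P.φ) (endPt z) (endPt w)) +
      ∫ t, evalL (dirP nx nu np) (P.hamHess z g t (yAt w t) +
        dotL nx (costate w t) ∘L P.stateDeriv z g t) ∂P.μ = b.2 := by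
  rw [← endPtL_apply w]
  refine (finL_eq_iff w (multL (P.nemDeriv z g) (memLp_nemDeriv hP z g) w)
    (fderiv ℝ (fderiv ℝ P.φ) (endPt z) (P.endPtL w)) b).trans ?_
  rw [integral_congr_ae ((multL_nemDeriv_ae hP z g w).mono fun t ht => by
    change evalL (dirP nx nu np) _ = (fun t => evalL (dirP nx nu np) (P.hamHess z g t (yAt w t) +
        dotL nx (costate w t) ∘L P.stateDeriv z g t)) t
    rw [ht])]

theorem psi_eq_zero_iff (hP : P.IsSmooth) (z : P.Z) (g : P.G) :
    psi hP z g = 0 ↔ P.IsKKT z g := by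
  have hN := (memLp_nem hP z g).coeFn_toLp
  have hs := ae_smoothAt hP g
  have e1 : ∀ᵐ t ∂P.μ, evalL (dirX nx nu np) (P.costateForm z g t) =
      (P.A z g t)ᵀ *ᵥ costate z t + totalGrad (P.l t) (g t) (yAt z t) (dirX nx nu np) := by
    filter_upwards [hs] with t h
    ext j; exact (h.costateForm_apply z (dirX nx nu np) j).symm
  have e2 : ∀ᵐ t ∂P.μ, evalL (dirU nx nu np) (P.costateForm z g t) =
      (P.B z g t)ᵀ *ᵥ costate z t + totalGrad (P.l t) (g t) (yAt z t) (dirU nx nu np) := by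
    filter_upwards [hs] with t h
    ext j; exact (h.costateForm_apply z (dirU nx nu np) j).symm
  have e3 : ∀ᵐ t ∂P.μ, evalL (dirP nx nu np) ((memLp_nem hP z g).toLp _ t).2 =
      (P.C z g t)ᵀ *ᵥ costate z t + totalGrad (P.l t) (g t) (yAt z t) (dirP nx nu np) := by
    filter_upwards [hs, hN] with t h h'
    rw [h']
    ext j; exact (h.costateForm_apply z (dirP nx nu np) j).symm
  have z1 : ⇑(0 : LSpace nx ∞ P.t₀ P.t_f) =ᵐ[P.μ] 0 := Lp.coeFn_zero _ _ _
  have z2 : ⇑(0 : LSpace nu ∞ P.t₀ P.t_f) =ᵐ[P.μ] 0 := Lp.coeFn_zero _ _ _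
  have h1 : psi hP z g = 0 ↔ P.dynL (z, (memLp_nem hP z g).toLp) = (0, 0, 0, P.x₀) ∧
      P.finL (z, (memLp_nem hP z g).toLp, fderiv ℝ P.φ (endPt z)) = 0 := by
    rw [psi, Prod.ext_iff]
    exact and_congr sub_eq_zero Iff.rfl
  rw [h1, dynL_eq_iff, finL_eq_iff, integral_congr_ae e3]
  have c1 : (∀ᵐ t ∂P.μ, z.1.der t - ((memLp_nem hP z g).toLp _ t).1 =
      (0 : LSpace nx ∞ P.t₀ P.t_f) t) ↔
      ∀ᵐ t ∂P.μ, z.1.der t = P.f t (yAt z t, g t (yAt z t)) := by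
    refine eventually_congr ?_
    filter_upwards [hN, z1] with t a b
    rw [a, b, Pi.zero_apply, sub_eq_zero]; rfl
  have c2 : (∀ᵐ t ∂P.μ, z.2.2.2.der t + evalL (dirX nx nu np) ((memLp_nem hP z g).toLp _ t).2 =
      (0 : LSpace nx ∞ P.t₀ P.t_f) t) ↔
      ∀ᵐ t ∂P.μ, z.2.2.2.der t = -((P.A z g t)ᵀ *ᵥ costate z t) -
        totalGrad (P.l t) (g t) (yAt z t) (dirX nx nu np) := by
    refine eventually_congr ?_
    filter_upwards [hN, z1, e1] with t a b c
    rw [a, b, Pi.zero_apply, nem, c, add_eq_zero_iff_eq_neg, neg_add']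
  have c3 : (∀ᵐ t ∂P.μ, evalL (dirU nx nu np) ((memLp_nem hP z g).toLp _ t).2 =
      (0 : LSpace nu ∞ P.t₀ P.t_f) t) ↔
      ∀ᵐ t ∂P.μ, (P.B z g t)ᵀ *ᵥ costate z t +
        totalGrad (P.l t) (g t) (yAt z t) (dirU nx nu np) = 0 := by
    refine eventually_congr ?_
    filter_upwards [hN, z2, e2] with t a b c
    rw [a, b, Pi.zero_apply, nem, c]
  rw [c1, c2, c3]
  constructor
  · rintro ⟨⟨a1, a2, a3, a4⟩, a5, a6⟩
    exact ⟨a1, a4, a2, sub_eq_zero.1 a5, a3, a6⟩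
  · rintro ⟨a1, a4, a2, a5, a3, a6⟩
    exact ⟨⟨a1, a2, a3, a4⟩, sub_eq_zero.2 a5, a6⟩

end Problem

namespace Problem

variable {nx nu np ng : ℕ} {P : Problem nx nu np ng}

/-! ### Strict differentiability of the optimality system -/

theorem norm_endPtL_le (z : P.Z) : ‖P.endPtL z‖ ≤ ‖z‖ := by
  rw [endPtL_apply]
  refine max_le ((WSpace.norm_val_le _ _).trans (norm_fst_le z)) ?_
  exact (norm_fst_le z.2.2).trans ((norm_snd_le z.2).trans (norm_snd_le z))

/-- A `C²` function has a strictly differentiable derivative. -/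
theorem exists_fderiv_strict {E : Type*} [NormedAddCommGroup E] [NormedSpace ℝ E] {φ : E → ℝ}
    (hφ : ContDiff ℝ 2 φ) (a : E) {c : ℝ} (hc : 0 < c) : ∃ δ > 0, ∀ a₁ ∈ Metric.ball a δ,
      ∀ a₂ ∈ Metric.ball a δ, ‖fderiv ℝ φ a₁ - fderiv ℝ φ a₂ -
        fderiv ℝ (fderiv ℝ φ) a (a₁ - a₂)‖ ≤ c * ‖a₁ - a₂‖ := by
  have h1 : ContDiff ℝ 1 (fderiv ℝ φ) := hφ.fderiv_right (by norm_num)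
  have h2 := (h1.contDiffAt (x := a)).hasStrictFDerivAt (by norm_num)
  have h3 := h2.isLittleO.bound hc
  obtain ⟨δ, hδ, h⟩ := Metric.eventually_nhds_iff_ball.1 h3
  refine ⟨δ, hδ, fun a₁ ha₁ a₂ ha₂ => h (a₁, a₂) ?_⟩
  rw [← ball_prod_same]
  exact ⟨ha₁, ha₂⟩

/-- The linearization of `ψ` in `z`. -/
def lin (hP : P.IsSmooth) (z : P.Z) (g : P.G) : P.Z →L[ℝ] P.Dyn × (Vec nx × Vec np) :=
  (linDyn hP z g).prod (linFin hP z g)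

theorem norm_toLp_sub_sub_le {N₁ N₂ : ℝ → Vec nx × (Triple nx nu np →L[ℝ] ℝ)}
    (h₁ : MemLp N₁ ∞ P.μ) (h₂ : MemLp N₂ ∞ P.μ) (M : P.Data) {c : ℝ} (hc : 0 ≤ c)
    (h : ∀ᵐ t ∂P.μ, ‖N₁ t - N₂ t - M t‖ ≤ c) : ‖h₁.toLp - h₂.toLp - M‖ ≤ c := by
  refine norm_Lp_top_le hc ?_
  filter_upwards [h, h₁.coeFn_toLp, h₂.coeFn_toLp, Lp.coeFn_sub (h₁.toLp - h₂.toLp) M,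
    Lp.coeFn_sub h₁.toLp h₂.toLp] with t a b c d e
  rw [d, Pi.sub_apply, e, Pi.sub_apply, b, c]
  exact a

/-- The linearization error of `ψ` is the image, under the bounded operators `dynL` and `finL`, of
the linearization errors of the superposition operator and of the derivative of the terminal cost.
-/
theorem psi_sub_sub (hP : P.IsSmooth) (zbar z₁ z₂ : P.Z) (gbar g : P.G) :
    psi hP z₁ g - psi hP z₂ g - lin hP zbar gbar (z₁ - z₂) =
      (P.dynL (0, (memLp_nem hP z₁ g).toLp - (memLp_nem hP z₂ g).toLp -
        multL (P.nemDeriv zbar gbar) (memLp_nemDeriv hP zbar gbar) (z₁ - z₂)),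
      P.finL (0, (memLp_nem hP z₁ g).toLp - (memLp_nem hP z₂ g).toLp -
        multL (P.nemDeriv zbar gbar) (memLp_nemDeriv hP zbar gbar) (z₁ - z₂),
        fderiv ℝ P.φ (endPt z₁) - fderiv ℝ P.φ (endPt z₂) -
          fderiv ℝ (fderiv ℝ P.φ) (endPt zbar) (P.endPtL (z₁ - z₂)))) := by
  refine Prod.ext ?_ ?_
  · change P.dynL (z₁, (memLp_nem hP z₁ g).toLp) - (0, 0, 0, P.x₀) -
      (P.dynL (z₂, (memLp_nem hP z₂ g).toLp) - (0, 0, 0, P.x₀)) - P.dynL (z₁ - z₂, _) = _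
    rw [sub_sub_sub_cancel_right, ← map_sub, ← map_sub]
    congr 1
    exact Prod.ext (sub_self _) rfl
  · change P.finL (z₁, (memLp_nem hP z₁ g).toLp, fderiv ℝ P.φ (endPt z₁)) -
      P.finL (z₂, (memLp_nem hP z₂ g).toLp, fderiv ℝ P.φ (endPt z₂)) - P.finL (z₁ - z₂, _, _) = _
    rw [← map_sub, ← map_sub]
    congr 1
    exact Prod.ext (sub_self _) rfl

/-- `ψ` is strictly differentiable in `z`, uniformly for component functions near `gbar`. -/
theorem exists_psi_strict (hP : P.IsSmooth) (zbar : P.Z) (gbar : P.G) {c : ℝ} (hc : 0 < c) :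
    ∃ δ > 0, ∀ g, dist g gbar < δ → ∀ z₁ ∈ Metric.ball zbar δ, ∀ z₂ ∈ Metric.ball zbar δ,
      ‖psi hP z₁ g - psi hP z₂ g - lin hP zbar gbar (z₁ - z₂)‖ ≤ c * ‖z₁ - z₂‖ := by
  obtain ⟨C, hC, hN⟩ := exists_nem_strict hP zbar gbar
  obtain ⟨K, hK, hdyn, hfin⟩ : ∃ K, 0 < K ∧ ‖P.dynL‖ ≤ K ∧ ‖P.finL‖ ≤ K :=
    ⟨max ‖P.dynL‖ ‖P.finL‖ + 1, by positivity, by linarith [le_max_left ‖P.dynL‖ ‖P.finL‖],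
      by linarith [le_max_right ‖P.dynL‖ ‖P.finL‖]⟩
  have hc' : 0 < c / K := by positivity
  obtain ⟨δ₁, hδ₁, h₁⟩ := exists_fderiv_strict hP.φ (endPt zbar) hc'
  -- Each of the three distances in the modulus of `exists_nem_strict` contributes at most a third
  -- of `c / K`; the summand `1` keeps the denominator positive.
  refine ⟨min δ₁ (min 1 (c / K / (3 * (C + 1)))), by positivity, ?_⟩
  intro g hg z₁ hz₁ z₂ hz₂
  simp only [Metric.mem_ball, dist_eq_norm, lt_min_iff] at hg hz₁ hz₂
  have hNb : ∀ᵐ t ∂P.μ, ‖P.nem z₁ g t - P.nem z₂ g t -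
      multL (P.nemDeriv zbar gbar) (memLp_nemDeriv hP zbar gbar) (z₁ - z₂) t‖ ≤
      c / K * ‖z₁ - z₂‖ := by
    filter_upwards [hN g z₁ z₂ hg.2.1.le hz₁.2.1.le hz₂.2.1.le, pathAt_sub z₁ z₂,
      multL_ae (P.nemDeriv zbar gbar) (memLp_nemDeriv hP zbar gbar) (z₁ - z₂)] with t a b d
    rw [d, b]
    refine a.trans (mul_le_mul_of_nonneg_right ?_ (norm_nonneg (z₁ - z₂)))
    have : ‖z₁ - zbar‖ + ‖z₂ - zbar‖ + ‖g - gbar‖ ≤ c / K / (C + 1) := by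
      have : c / K / (C + 1) = 3 * (c / K / (3 * (C + 1))) := by field_simp
      linarith [hz₁.2.2, hz₂.2.2, hg.2.2]
    calc _ ≤ C * (c / K / (C + 1)) := mul_le_mul_of_nonneg_left this hC
      _ ≤ (C + 1) * (c / K / (C + 1)) :=
        mul_le_mul_of_nonneg_right (by linarith) (by positivity)
      _ = c / K := by field_simp
  have hN' := norm_toLp_sub_sub_le (memLp_nem hP z₁ g) (memLp_nem hP z₂ g) _
    (mul_nonneg hc'.le (norm_nonneg (z₁ - z₂))) hNb
  have hball : ∀ z : P.Z, ‖z - zbar‖ < δ₁ → endPt z ∈ Metric.ball (endPt zbar) δ₁ := by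
    intro z hz
    rw [mem_ball_iff_norm, ← endPtL_apply, ← endPtL_apply, ← map_sub]
    exact (norm_endPtL_le _).trans_lt hz
  have he := h₁ _ (hball z₁ hz₁.1) _ (hball z₂ hz₂.1)
  rw [show endPt z₁ - endPt z₂ = P.endPtL (z₁ - z₂) by
    rw [map_sub, endPtL_apply, endPtL_apply]] at he
  have he' := he.trans (mul_le_mul_of_nonneg_left (norm_endPtL_le (z₁ - z₂)) hc'.le)
  rw [psi_sub_sub]
  have h0 : ‖(0 : P.Z)‖ ≤ c / K * ‖z₁ - z₂‖ := by
    rw [norm_zero]; exact mul_nonneg hc'.le (norm_nonneg _)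
  have hfinal : c * ‖z₁ - z₂‖ = K * (c / K * ‖z₁ - z₂‖) := by field_simp
  rw [hfinal]
  exact max_le (P.dynL.le_of_opNorm_le_of_le hdyn (max_le h0 hN'))
    (P.finL.le_of_opNorm_le_of_le hfin (max_le h0 (max_le hN' he')))

/-- At the reference solution, the residual of the optimality system is Lipschitz in `g`. -/
theorem exists_psi_lipschitz (hP : P.IsSmooth) (zbar : P.Z) (gbar : P.G)
    (h0 : psi hP zbar gbar = 0) :
    ∃ K, ∀ᶠ g in 𝓝 gbar, ‖psi hP zbar g‖ ≤ K * dist g gbar := by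
  obtain ⟨C, hC, hN⟩ := exists_nem_taylor hP zbar gbar
  refine ⟨max ‖P.dynL‖ ‖P.finL‖ * C, ?_⟩
  filter_upwards [Metric.ball_mem_nhds gbar one_pos] with g hg
  rw [Metric.mem_ball, dist_eq_norm] at hg
  rw [dist_eq_norm]
  have hN' := norm_toLp_sub_sub_le (memLp_nem hP zbar g) (memLp_nem hP zbar gbar) 0
    (mul_nonneg hC (norm_nonneg (g - gbar))) (by
      filter_upwards [hN g hg.le, Lp.coeFn_zero (Vec nx × (Triple nx nu np →L[ℝ] ℝ)) ∞ P.μ]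
        with t a b
      rw [b, Pi.zero_apply, sub_zero]; exact a.1)
  have key := psi_sub_sub hP zbar zbar zbar gbar g
  have e : psi hP zbar g = (P.dynL (0, (memLp_nem hP zbar g).toLp -
      (memLp_nem hP zbar gbar).toLp - 0), P.finL (0, (memLp_nem hP zbar g).toLp -
      (memLp_nem hP zbar gbar).toLp - 0, 0)) := by
    rw [← sub_zero (psi hP zbar g), ← h0]
    refine Prod.ext ?_ ?_
    · change P.dynL (zbar, _) - _ - (P.dynL (zbar, _) - _) = _
      rw [sub_sub_sub_cancel_right, ← map_sub]
      congr 1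
      exact Prod.ext (sub_self _) (sub_zero _).symm
    · change P.finL (zbar, _, _) - P.finL (zbar, _, _) = _
      rw [← map_sub]
      congr 1
      exact Prod.ext (sub_self _) (Prod.ext (sub_zero _).symm (sub_self _))
  have hz : ‖(0 : P.Z)‖ ≤ C * ‖g - gbar‖ := by
    rw [norm_zero]; exact mul_nonneg hC (norm_nonneg _)
  have hz' : ‖(0 : Vec nx × Vec np →L[ℝ] ℝ)‖ ≤ C * ‖g - gbar‖ := by
    rw [norm_zero]; exact mul_nonneg hC (norm_nonneg _)
  rw [e, mul_assoc]
  exact max_le (P.dynL.le_of_opNorm_le_of_le (le_max_left _ _) (max_le hz hN'))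
    (P.finL.le_of_opNorm_le_of_le (le_max_right _ _) (max_le hz (max_le hN' hz')))

/-! ### The adjoint equations -/

/-- Right-hand sides of the adjoint equations of a quantity of interest. -/
def adjointData (P : Problem nx nu np ng) (ϕ : Vec nx × Vec np → ℝ)
    {ell : ℝ → Triple nx nu np × Vec ng → ℝ} (hell : Smooth P.t₀ P.t_f ell) (z : P.Z) (g : P.G) :
    P.Dyn × (Vec nx × Vec np) :=
  ((0, -((evalL (dirX nx nu np)).comp_memLp' (hell.memLp_fderiv_comp g (memLp_yAt z))).toLp,
    -((evalL (dirU nx nu np)).comp_memLp' (hell.memLp_fderiv_comp g (memLp_yAt z))).toLp, 0),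
    (evalL endX (fderiv ℝ ϕ (endPt z)), -evalL endP (fderiv ℝ ϕ (endPt z)) -
      ∫ t, evalL (dirP nx nu np) (fderiv ℝ (fun y => ell t (y, g t y)) (yAt z t)) ∂P.μ))

theorem hess_endPt_mulVec {ι : Type*} (hP : P.IsSmooth) (z w : P.Z) (e : ι → Vec nx × Vec np)
    (j : ι) :
    (hess P.φ (endPt z) e endX *ᵥ xAt w P.t_f + hess P.φ (endPt z) e endP *ᵥ par w) j =
      fderiv ℝ (fderiv ℝ P.φ) (endPt z) (endPt w) (e j) := by
  rw [fderiv_fderiv_symm hP.φ, ← clm_endPt_eq_sum]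
  simp only [hess, Matrix.mulVec, dotProduct, Pi.add_apply, Matrix.of_apply, smul_eq_mul, mul_comm]
  rfl

/-- The adjoint equations have the operator of the linearized optimality system on the left: only
the right-hand sides involve the quantity of interest. -/
theorem lin_eq_adjointData_iff (hP : P.IsSmooth) {ϕ : Vec nx × Vec np → ℝ}
    {ell : ℝ → Triple nx nu np × Vec ng → ℝ} (hell : Smooth P.t₀ P.t_f ell) (z w : P.Z) (g : P.G) :
    lin hP z g w = P.adjointData ϕ hell z g ↔ P.IsAdjoint ϕ ell z g w := by
  have hell' : ∀ᵐ t ∂P.μ, P.SmoothAt g t ∧ ContDiff ℝ 2 (ell t) :=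
    (ae_smoothAt hP g).and hell.contDiff
  set Nw := fun t => P.hamHess z g t (yAt w t) + dotL nx (costate w t) ∘L P.stateDeriv z g t
  set De := fun t => fderiv ℝ (fun y => ell t (y, g t y)) (yAt z t)
  have hgrad : ∀ {κ : Type} [Fintype κ] (e : κ → Triple nx nu np), ∀ᵐ t ∂P.μ,
      evalL e (De t) = totalGrad (ell t) (g t) (yAt z t) e := by
    intro κ _ e
    filter_upwards [hell'] with t h
    ext j
    exact (totalGrad_eq (h.2.differentiable (by norm_num) _)
      (h.1.g.differentiable (by norm_num) _) e j).symm
  have hrow : ∀ {κ : Type} [Fintype κ] (e : κ → Triple nx nu np), ∀ᵐ t ∂P.μ,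
      evalL e (Nw t) = P.HH z g t e (dirX nx nu np) *ᵥ xAt w t +
        P.HH z g t e (dirU nx nu np) *ᵥ uAt w t + P.HH z g t e (dirP nx nu np) *ᵥ par w +
        (totalJac (P.f t) (g t) (yAt z t) e)ᵀ *ᵥ costate w t := by
    intro κ _ e
    filter_upwards [ae_smoothAt hP g] with t h
    ext j
    rw [Pi.add_apply, h.transpose_mulVec z e (costate w t) j]
    exact (congrArg (· + (dotL nx (costate w t) ∘L P.stateDeriv z g t) (e j))
      (h.HH_apply z e (yAt w t) j)).symm
  have z1 : ⇑(0 : LSpace nx ∞ P.t₀ P.t_f) =ᵐ[P.μ] 0 := Lp.coeFn_zero _ _ _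
  have hM := hell.memLp_fderiv_comp g (memLp_yAt z)
  have m1 := ((evalL (dirX nx nu np)).comp_memLp' hM).coeFn_toLp
  have m2 := ((evalL (dirU nx nu np)).comp_memLp' hM).coeFn_toLp
  have n1 := Lp.coeFn_neg ((evalL (dirX nx nu np)).comp_memLp' hM).toLp
  have n2 := Lp.coeFn_neg ((evalL (dirU nx nu np)).comp_memLp' hM).toLp
  have h0 : lin hP z g w = P.adjointData ϕ hell z g ↔
      linDyn hP z g w = (P.adjointData ϕ hell z g).1 ∧
        linFin hP z g w = (P.adjointData ϕ hell z g).2 := Prod.ext_iff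
  rw [h0, linDyn_eq_iff, linFin_eq_iff]
  have c1 : (∀ᵐ t ∂P.μ, w.1.der t - P.stateDeriv z g t (yAt w t) =
      (P.adjointData ϕ hell z g).1.1 t) ↔ ∀ᵐ t ∂P.μ, w.1.der t =
      P.A z g t *ᵥ xAt w t + P.B z g t *ᵥ uAt w t + P.C z g t *ᵥ par w := by
    refine eventually_congr ?_
    filter_upwards [z1, ae_smoothAt hP g] with t a h
    change _ = (0 : LSpace nx ∞ P.t₀ P.t_f) t ↔ _
    rw [a, Pi.zero_apply, sub_eq_zero, ← h.stateDeriv_apply z (yAt w t)]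
    rfl
  have c2 : (∀ᵐ t ∂P.μ, w.2.2.2.der t + evalL (dirX nx nu np) (Nw t) =
      (P.adjointData ϕ hell z g).1.2.1 t) ↔ ∀ᵐ t ∂P.μ, w.2.2.2.der t =
      -((P.A z g t)ᵀ *ᵥ costate w t)
      - P.HH z g t (dirX nx nu np) (dirX nx nu np) *ᵥ xAt w t
      - P.HH z g t (dirX nx nu np) (dirU nx nu np) *ᵥ uAt w t
      - P.HH z g t (dirX nx nu np) (dirP nx nu np) *ᵥ par w
      - totalGrad (ell t) (g t) (yAt z t) (dirX nx nu np) := by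
    refine eventually_congr ?_
    filter_upwards [m1, n1, hgrad (dirX nx nu np), hrow (dirX nx nu np)] with t a b c d
    change _ = (-((evalL (dirX nx nu np)).comp_memLp' hM).toLp) t ↔ _
    rw [b, Pi.neg_apply, a, Function.comp_apply, c, d, ← eq_sub_iff_add_eq]
    refine Eq.congr_right ?_
    rw [A]; abel
  have c3 : (∀ᵐ t ∂P.μ, evalL (dirU nx nu np) (Nw t) = (P.adjointData ϕ hell z g).1.2.2.1 t) ↔
      ∀ᵐ t ∂P.μ, P.HH z g t (dirU nx nu np) (dirX nx nu np) *ᵥ xAt w t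
        + P.HH z g t (dirU nx nu np) (dirU nx nu np) *ᵥ uAt w t
        + P.HH z g t (dirU nx nu np) (dirP nx nu np) *ᵥ par w
        + (P.B z g t)ᵀ *ᵥ costate w t =
      -totalGrad (ell t) (g t) (yAt z t) (dirU nx nu np) := by
    refine eventually_congr ?_
    filter_upwards [m2, n2, hgrad (dirU nx nu np), hrow (dirU nx nu np)] with t a b c d
    change _ = (-((evalL (dirU nx nu np)).comp_memLp' hM).toLp) t ↔ _
    rw [b, Pi.neg_apply, a, Function.comp_apply, c, d]
    rfl
  have c4 : evalL endX (fderiv ℝ (fderiv ℝ P.φ) (endPt z) (endPt w)) =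
      hess P.φ (endPt z) endX endX *ᵥ xAt w P.t_f + hess P.φ (endPt z) endX endP *ᵥ par w := by
    ext j; exact (hess_endPt_mulVec hP z w endX j).symm
  have c5 : evalL endP (fderiv ℝ (fderiv ℝ P.φ) (endPt z) (endPt w)) =
      hess P.φ (endPt z) endP endX *ᵥ xAt w P.t_f + hess P.φ (endPt z) endP endP *ᵥ par w := by
    ext j; exact (hess_endPt_mulVec hP z w endP j).symm
  rw [c1, c2, c3, c4, c5, integral_congr_ae (hrow (dirP nx nu np))]
  have e1 : (P.adjointData ϕ hell z g).2.1 = grad ϕ (endPt z) endX := rfl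
  have e2 : (P.adjointData ϕ hell z g).2.2 = -grad ϕ (endPt z) endP -
      ∫ t, totalGrad (ell t) (g t) (yAt z t) (dirP nx nu np) ∂P.μ := by
    rw [← integral_congr_ae (hgrad (dirP nx nu np))]; rfl
  rw [e1, e2, sub_eq_iff_eq_add, ← add_assoc]
  constructor
  · rintro ⟨⟨a1, a2, a3, a4⟩, a5, a6⟩
    exact ⟨a1, a4, a2, a5, a3, a6⟩
  · rintro ⟨a1, a4, a2, a5, a3, a6⟩
    exact ⟨⟨a1, a2, a3, a4⟩, a5, a6⟩

end Problem

namespace Problem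

variable {nx nu np ng : ℕ} {P : Problem nx nu np ng}

/-! ### Duality between the linearized state and adjoint equations -/

theorem evalL_dotProduct (m : Triple nx nu np →L[ℝ] ℝ) (y : Triple nx nu np) :
    evalL (dirX nx nu np) m ⬝ᵥ y.1 + evalL (dirU nx nu np) m ⬝ᵥ y.2.1 +
      evalL (dirP nx nu np) m ⬝ᵥ y.2.2 = m y := by
  rw [← clm_triple_eq_sum]
  simp only [dotProduct, evalL_apply, smul_eq_mul, mul_comm]

theorem evalL_endPt_dotProduct (m : Vec nx × Vec np →L[ℝ] ℝ) (e : Vec nx × Vec np) :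
    evalL endX m ⬝ᵥ e.1 + evalL endP m ⬝ᵥ e.2 = m e := by
  rw [← clm_endPt_eq_sum]
  simp only [dotProduct, evalL_apply, smul_eq_mul, mul_comm]

theorem memLp_dotL_comp {v : ℝ → Vec nx} {D : ℝ → Triple nx nu np →L[ℝ] Vec nx}
    (hv : MemLp v ∞ P.μ) (hD : MemLp D ∞ P.μ) :
    MemLp (fun t => dotL nx (v t) ∘L D t) ∞ P.μ := by
  refine MemLp_top.clm_of_apply fun w => ?_
  refine (MemLp_top.dotProduct hv (MemLp_top.clm_apply hD (memLp_const w))).ae_eq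
    (.of_forall fun t => ?_)
  simp only [ContinuousLinearMap.comp_apply, dotL_apply]

theorem memLp_form_add {c d : ℝ → Triple nx nu np →L[ℝ] ℝ} (hc : MemLp c ∞ P.μ)
    (hd : MemLp d ∞ P.μ) : MemLp (fun t => c t + d t) ∞ P.μ := by
  refine MemLp_top.clm_of_apply fun w => ?_
  exact ((MemLp_top.clm_apply hc (memLp_const w)).add
    (MemLp_top.clm_apply hd (memLp_const w))).ae_eq (.of_forall fun t => rfl)

/-- The integrand in Green's formula. -/
theorem green_integrand {D : Triple nx nu np →L[ℝ] Vec nx} {c : Triple nx nu np →L[ℝ] ℝ}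
    {lam lam' x' a : Vec nx} {y : Triple nx nu np} (hx : x' = D y + a)
    (hX : lam' + evalL (dirX nx nu np) (c + dotL nx lam ∘L D) = 0)
    (hU : evalL (dirU nx nu np) (c + dotL nx lam ∘L D) = 0) :
    lam' ⬝ᵥ y.1 + lam ⬝ᵥ x' =
      (dotL np).flip y.2.2 (evalL (dirP nx nu np) (c + dotL nx lam ∘L D)) -
        (c y - lam ⬝ᵥ a) := by
  have e := evalL_dotProduct (c + dotL nx lam ∘L D) y
  rw [hU, zero_dotProduct, add_zero, add_apply, ContinuousLinearMap.comp_apply, dotL_apply] at e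
  rw [eq_neg_of_add_eq_zero_left hX, hx, neg_dotProduct, dotProduct_add,
    ContinuousLinearMap.flip_apply, dotL_apply]
  linarith

/-- Green's formula: a solution of the linearized state equation with right-hand side `a`, tested
with a solution of the adjoint and control equations with right-hand side `c`. -/
theorem green {D : ℝ → Triple nx nu np →L[ℝ] Vec nx} (hD : MemLp D ∞ P.μ) (z₁ z₂ : P.Z)
    {a : ℝ → Vec nx} (ha : MemLp a ∞ P.μ) {c : ℝ → Triple nx nu np →L[ℝ] ℝ} (hc : MemLp c ∞ P.μ)
    (h0 : xAt z₁ P.t₀ = 0) (hx : ∀ᵐ t ∂P.μ, z₁.1.der t = D t (yAt z₁ t) + a t)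
    (hX : ∀ᵐ t ∂P.μ, z₂.2.2.2.der t +
      evalL (dirX nx nu np) (c t + dotL nx (costate z₂ t) ∘L D t) = 0)
    (hU : ∀ᵐ t ∂P.μ, evalL (dirU nx nu np) (c t + dotL nx (costate z₂ t) ∘L D t) = 0) :
    ∫ t, (c t (yAt z₁ t) - costate z₂ t ⬝ᵥ a t) ∂P.μ =
      (∫ t, evalL (dirP nx nu np) (c t + dotL nx (costate z₂ t) ∘L D t) ∂P.μ) ⬝ᵥ par z₁ -
        costate z₂ P.t_f ⬝ᵥ xAt z₁ P.t_f := by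
  have hd : MemLp (fun t => dotL nx (costate z₂ t) ∘L D t) ∞ P.μ :=
    memLp_dotL_comp (memLp_costate z₂) hD
  have hm : MemLp (fun t => c t + dotL nx (costate z₂ t) ∘L D t) ∞ P.μ := memLp_form_add hc hd
  have hPm : Integrable
      (fun t => evalL (dirP nx nu np) (c t + dotL nx (costate z₂ t) ∘L D t)) P.μ :=
    (evalL (dirP nx nu np)).integrable_comp (hm.integrable le_top)
  have parts := WSpace.integral_dotProduct P.lt.le z₂.2.2.2 z₁.1
  have hI : Integrable (fun t => c t (yAt z₁ t) - costate z₂ t ⬝ᵥ a t) P.μ :=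
    ((MemLp_top.clm_apply hc (memLp_yAt z₁)).sub
      (MemLp_top.dotProduct (memLp_costate z₂) ha)).integrable le_top
  have pw : ∀ᵐ t ∂P.μ, z₂.2.2.2.der t ⬝ᵥ z₁.1.val t + z₂.2.2.2.val t ⬝ᵥ z₁.1.der t =
      (dotL np).flip (par z₁) (evalL (dirP nx nu np) (c t + dotL nx (costate z₂ t) ∘L D t)) -
        (c t (yAt z₁ t) - costate z₂ t ⬝ᵥ a t) := by
    filter_upwards [hx, hX, hU] with t h1 h2 h3
    exact green_integrand (y := yAt z₁ t) h1 h2 h3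
  have hI' := ((dotL np).flip (par z₁)).integrable_comp hPm
  have eP := ((dotL np).flip (par z₁)).integral_comp_comm hPm
  rw [ContinuousLinearMap.flip_apply, dotL_apply] at eP
  have key := (integral_congr_ae pw).trans (integral_sub hI' hI)
  rw [eP] at key
  have h0' : z₁.1.val P.t₀ = 0 := h0
  have e := key.symm.trans parts
  rw [h0', dotProduct_zero, sub_zero] at e
  exact (sub_eq_iff_eq_add.2 (sub_eq_iff_eq_add'.1 e)).symm

theorem _root_.OCP.WSpace.eq_zero_of_der_eq_zero {n : ℕ} {t₀ t_f : ℝ} {x : WSpace n ∞ t₀ t_f}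
    (hd : ∀ᵐ t ∂timeMeasure t₀ t_f, x.der t = 0) {s : ℝ} (hs : s ∈ Icc t₀ t_f)
    (h : x.val s = 0) : x = 0 := by
  have h0 : ∀ t ∈ Icc t₀ t_f, x.val t = x.val t₀ := fun t ht => by
    have hz : ∫ r in t₀..t, x.der r = 0 := by
      rw [intervalIntegral.integral_congr_ae (g := fun _ => (0 : Vec n))
        (ae_uIoc_of_ae_timeMeasure hd ⟨t₀, le_rfl, ht.1.trans ht.2⟩ ⟨t, ht⟩)]
      simp
    rw [WSpace.val_eq x ht, hz, add_zero]
  refine WSpace.ext_val_der (fun t ht => ?_) ?_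
  · rw [h0 t ht, ← h0 s hs, h, WSpace.val_zero]
  · filter_upwards [hd, Lp.coeFn_zero (Vec n) ∞ (timeMeasure t₀ t_f)] with t h1 h2
    rw [h1]; exact h2.symm

/-- The terminal part of the second-order condition, as a statement on the second derivative. -/
theorem hess_terminal_nonneg (hP : P.IsSmooth) {z : P.Z} {g : P.G} (hSO : P.SecondOrder z g)
    (w : P.Z) : 0 ≤ fderiv ℝ (fderiv ℝ P.φ) (endPt z) (endPt w) (endPt w) := by
  have h := hSO.terminal.dotProduct_mulVec_nonneg (Sum.elim (xAt w P.t_f) (par w))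
  rw [Matrix.fromBlocks_mulVec] at h
  have e : star (Sum.elim (xAt w P.t_f) (par w)) = Sum.elim (xAt w P.t_f) (par w) := by
    ext i; simp
  rw [e, sumElim_dotProduct_sumElim] at h
  have hX : hess P.φ (endPt z) endX endX *ᵥ xAt w P.t_f + hess P.φ (endPt z) endX endP *ᵥ par w =
      evalL endX (fderiv ℝ (fderiv ℝ P.φ) (endPt z) (endPt w)) := by
    ext j; exact hess_endPt_mulVec hP z w endX j
  have hY : hess P.φ (endPt z) endP endX *ᵥ xAt w P.t_f + hess P.φ (endPt z) endP endP *ᵥ par w =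
      evalL endP (fderiv ℝ (fderiv ℝ P.φ) (endPt z) (endPt w)) := by
    ext j; exact hess_endPt_mulVec hP z w endP j
  have hs := evalL_endPt_dotProduct (fderiv ℝ (fderiv ℝ P.φ) (endPt z) (endPt w)) (endPt w)
  rw [← hs]
  simp only [Sum.elim_comp_inl, Sum.elim_comp_inr, hX, hY] at h
  rw [dotProduct_comm (xAt w P.t_f), dotProduct_comm (par w)] at h
  exact h

theorem integral_dotProduct_self_eq_zero {n : ℕ} {v : ℝ → Vec n} (hv : MemLp v ∞ P.μ)
    (h : ∫ t, v t ⬝ᵥ v t ∂P.μ ≤ 0) : ∀ᵐ t ∂P.μ, v t = 0 := by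
  have hn : ∀ t, 0 ≤ v t ⬝ᵥ v t := fun t => Finset.sum_nonneg fun i _ => mul_self_nonneg _
  have h0 := (integral_eq_zero_iff_of_nonneg hn
    ((MemLp_top.dotProduct hv hv).integrable le_top)).1 (le_antisymm h (integral_nonneg hn))
  filter_upwards [h0] with t ht
  exact dotProduct_self_eq_zero.1 ht

end Problem

namespace Problem

variable {nx nu np ng : ℕ} {P : Problem nx nu np ng}

/-! ### Injectivity of the linearization -/

/-- The coercivity condition, for essentially bounded variations. -/
theorem SecondOrder.coercive_top (hP : P.IsSmooth) {z : P.Z} {g : P.G} (hSO : P.SecondOrder z g) :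
    ∃ ε > 0, ∀ w : P.Z, xAt w P.t₀ = 0 →
      (∀ᵐ t ∂P.μ, w.1.der t = P.stateDeriv z g t (yAt w t)) →
      ε * ((∫ t, xAt w t ⬝ᵥ xAt w t ∂P.μ) + (∫ t, uAt w t ⬝ᵥ uAt w t ∂P.μ) + par w ⬝ᵥ par w) ≤
        ∫ t, P.hamHess z g t (yAt w t) (yAt w t) ∂P.μ := by
  obtain ⟨ε, hε, h⟩ := hSO.coercive
  refine ⟨ε, hε, fun w h0 hd => ?_⟩
  obtain ⟨δx, hx, hx'⟩ := WSpace.exists_two_of_top P.lt.le w.1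
  have hu2 : MemLp (uAt w) 2 P.μ := (Lp.memLp w.2.1).mono_exponent le_top
  have hu := hu2.coeFn_toLp
  have hxae : ∀ᵐ t ∂P.μ, δx.val t = xAt w t := by
    filter_upwards [ae_restrict_mem measurableSet_Ioo] with t ht
    exact hx ⟨t, Ioo_subset_Icc_self ht⟩
  have key := h δx hu2.toLp (par w) ((hx ⟨P.t₀, P.left_mem⟩).trans h0) (by
    filter_upwards [hx', hd, hxae, hu, ae_smoothAt hP g] with t a b c d e
    rw [a, b, c, d]
    exact (e.stateDeriv_apply z (yAt w t)).symm)
  have e1 : ∫ t, δx.val t ⬝ᵥ δx.val t ∂P.μ = ∫ t, xAt w t ⬝ᵥ xAt w t ∂P.μ :=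
    integral_congr_ae (by filter_upwards [hxae] with t ht; rw [ht])
  have e2 : ∫ t, hu2.toLp _ t ⬝ᵥ hu2.toLp _ t ∂P.μ = ∫ t, uAt w t ⬝ᵥ uAt w t ∂P.μ :=
    integral_congr_ae (by filter_upwards [hu] with t ht; rw [ht])
  have e3 : ∫ t, fderiv ℝ (fderiv ℝ (P.redHam z g t)) (yAt z t)
      (δx.val t, hu2.toLp _ t, par w) (δx.val t, hu2.toLp _ t, par w) ∂P.μ =
      ∫ t, P.hamHess z g t (yAt w t) (yAt w t) ∂P.μ :=
    integral_congr_ae (by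
      filter_upwards [hxae, hu, ae_smoothAt hP g] with t a b e
      rw [a, b, e.fderiv_fderiv_redHam]; rfl)
  rw [e1, e2, e3] at key
  exact key

/-- If the state, control and parameter part of a solution of the homogeneous linearized system
vanishes, so does the multiplier: test with the solution of `x' = A x + λ`. -/
theorem costate_eq_zero {D : ℝ → Triple nx nu np →L[ℝ] Vec nx} (hD : MemLp D ∞ P.μ) (w : P.Z)
    (hX : ∀ᵐ t ∂P.μ, w.2.2.2.der t + evalL (dirX nx nu np) (dotL nx (costate w t) ∘L D t) = 0)
    (hU : ∀ᵐ t ∂P.μ, evalL (dirU nx nu np) (dotL nx (costate w t) ∘L D t) = 0)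
    (hf : costate w P.t_f = 0) : w.2.2.2 = 0 := by
  have hlam := memLp_costate w
  have hDv : ∀ v : Vec nx, MemLp (fun t => D t (v, 0, 0) + costate w t) ∞ P.μ := fun v =>
    (MemLp_top.clm_apply hD (memLp_const ((v, 0, 0) : Triple nx nu np))).add hlam
  obtain ⟨c, hc, hb⟩ := MemLp_top.exists_bound hD
  obtain ⟨K, -, hK⟩ := MemLp_top.exists_bound (hDv 0)
  obtain ⟨ξ, hξ, -⟩ := existsUnique_integral_solution P.lt.le
    (m := fun t v => D t (v, 0, 0) + costate w t) (c := c) (fun v => (hDv v).1) (by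
      filter_upwards [hb] with t ht v v'
      rw [add_sub_add_right_eq_sub, ← map_sub]
      refine ((D t).le_of_opNorm_le_of_le ht (b := ‖v - v'‖) ?_)
      simp) hK 0
  have hξm : MemLp (fun t => IccExtend P.lt.le ξ t) ∞ P.μ :=
    memLp_top_of_bound (ξ.continuous.Icc_extend'.aestronglyMeasurable) ‖ξ‖
      (.of_forall fun t => ξ.norm_coe_le_norm _)
  have hrhs : MemLp (fun t => D t (IccExtend P.lt.le ξ t, 0, 0) + costate w t) ∞ P.μ :=
    (MemLp_top.clm_apply hD (MemLp.of_fst_snd (f := fun t => ((IccExtend P.lt.le ξ t, 0, 0) :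
      Triple nx nu np)) ⟨hξm, memLp_const (0 : Vec nu × Vec np)⟩)).add hlam
  obtain ⟨x, hx, hx'⟩ := WSpace.exists_of_primitive P.lt.le ξ hrhs 0 hξ
  have hxi : ∀ᵐ t ∂P.μ, IccExtend P.lt.le ξ t = x.val t := by
    filter_upwards [ae_restrict_mem measurableSet_Ioo] with t ht
    rw [hx ⟨t, Ioo_subset_Icc_self ht⟩, IccExtend_of_mem _ _ (Ioo_subset_Icc_self ht)]
  let z₁ : P.Z := (x, 0, 0, 0)
  have hy : ∀ᵐ t ∂P.μ, yAt z₁ t = (x.val t, 0, 0) := by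
    filter_upwards [Lp.coeFn_zero (Vec nu) ∞ P.μ] with t ht
    exact Prod.ext rfl (Prod.ext ht rfl)
  have h0 : xAt z₁ P.t₀ = 0 := by
    have := hx ⟨P.t₀, P.left_mem⟩
    rw [hξ, intervalIntegral.integral_same, add_zero] at this
    exact this
  have g := green hD z₁ w hlam (c := fun _ => 0) (memLp_const 0) h0 (by
      filter_upwards [hx', hxi, hy] with t a b d
      rw [d, ← b]; exact a)
    (by simpa only [zero_add] using hX) (by simpa only [zero_add] using hU)
  have hp : par z₁ = 0 := rfl
  rw [hf, hp, dotProduct_zero, zero_dotProduct, sub_zero] at g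
  have hz : ∀ᵐ t ∂P.μ, costate w t = 0 := by
    refine integral_dotProduct_self_eq_zero hlam ?_
    simp only [zero_apply, zero_sub, integral_neg, neg_eq_zero] at g
    exact g.le
  refine WSpace.eq_zero_of_der_eq_zero (s := P.t_f) ?_ P.right_mem hf
  filter_upwards [hX, hz] with t a b
  rw [b] at a
  simpa using a

/-- The linearization has trivial kernel: by Green's formula, applied to an element of the kernel
with itself, the quadratic form of the second-order condition is nonpositive there. Coercivity makes
the state, the control and the parameter vanish, and then also the multiplier. -/
theorem lin_injective (hP : P.IsSmooth) {z : P.Z} {g : P.G} (hSO : P.SecondOrder z g) (w : P.Z)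
    (h₁ : linDyn hP z g w = 0) (h₂ : linFin hP z g w = 0) : w = 0 := by
  obtain ⟨h1, h2, h3, h4⟩ := (linDyn_eq_iff hP z g w 0).1 h₁
  obtain ⟨h5, h6⟩ := (linFin_eq_iff hP z g w 0).1 h₂
  have z1 : ⇑(0 : LSpace nx ∞ P.t₀ P.t_f) =ᵐ[P.μ] 0 := Lp.coeFn_zero _ _ _
  have z2 : ⇑(0 : LSpace nu ∞ P.t₀ P.t_f) =ᵐ[P.μ] 0 := Lp.coeFn_zero _ _ _
  have hx : ∀ᵐ t ∂P.μ, w.1.der t = P.stateDeriv z g t (yAt w t) := by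
    filter_upwards [h1, z1] with t a b
    exact sub_eq_zero.1 (a.trans b)
  have hX : ∀ᵐ t ∂P.μ, w.2.2.2.der t + evalL (dirX nx nu np)
      (P.hamHess z g t (yAt w t) + dotL nx (costate w t) ∘L P.stateDeriv z g t) = 0 := by
    filter_upwards [h2, z1] with t a b using a.trans b
  have hU : ∀ᵐ t ∂P.μ, evalL (dirU nx nu np)
      (P.hamHess z g t (yAt w t) + dotL nx (costate w t) ∘L P.stateDeriv z g t) = 0 := by
    filter_upwards [h3, z2] with t a b using a.trans b
  have hD := memLp_stateDeriv hP z g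
  have hc := MemLp_top.clm_apply (memLp_hamHess hP z g) (memLp_yAt w)
  have green₁ := green hD w w (a := fun _ => 0) (memLp_const 0) hc h4
    (by simpa only [add_zero] using hx) hX hU
  obtain ⟨ε, hε, hco⟩ := hSO.coercive_top hP
  have hco' := hco w h4 hx
  have hT := hess_terminal_nonneg hP hSO w
  rw [← evalL_endPt_dotProduct] at hT
  have e5 : costate w P.t_f = evalL endX (fderiv ℝ (fderiv ℝ P.φ) (endPt z) (endPt w)) :=
    sub_eq_zero.1 h5
  have e6 := eq_neg_of_add_eq_zero_right h6
  rw [e6, e5, neg_dotProduct] at green₁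
  simp only [dotProduct_zero, sub_zero] at green₁
  change 0 ≤ _ ⬝ᵥ xAt w P.t_f + _ ⬝ᵥ par w at hT
  rw [green₁] at hco'
  have n1 : 0 ≤ ∫ t, xAt w t ⬝ᵥ xAt w t ∂P.μ :=
    integral_nonneg fun t => Finset.sum_nonneg fun i _ => mul_self_nonneg _
  have n2 : 0 ≤ ∫ t, uAt w t ⬝ᵥ uAt w t ∂P.μ :=
    integral_nonneg fun t => Finset.sum_nonneg fun i _ => mul_self_nonneg _
  have n3 : 0 ≤ par w ⬝ᵥ par w := Finset.sum_nonneg fun i _ => mul_self_nonneg _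
  have hsum : (∫ t, xAt w t ⬝ᵥ xAt w t ∂P.μ) + (∫ t, uAt w t ⬝ᵥ uAt w t ∂P.μ) +
      par w ⬝ᵥ par w ≤ 0 := by
    by_contra hpos
    have := mul_pos hε (not_le.1 hpos)
    linarith
  have x0 := integral_dotProduct_self_eq_zero (memLp_yAt w).fst
    (show ∫ t, xAt w t ⬝ᵥ xAt w t ∂P.μ ≤ 0 by linarith)
  have u0 := integral_dotProduct_self_eq_zero (memLp_yAt w).snd.fst
    (show ∫ t, uAt w t ⬝ᵥ uAt w t ∂P.μ ≤ 0 by linarith)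
  have p0 : par w = 0 := dotProduct_self_eq_zero.1 (by linarith)
  have y0 : ∀ᵐ t ∂P.μ, yAt w t = 0 := by
    filter_upwards [x0, u0] with t a b
    exact Prod.ext a (Prod.ext b p0)
  have hw1 : w.1 = 0 := WSpace.eq_zero_of_der_eq_zero (s := P.t₀) (by
    filter_upwards [hx, y0] with t a b
    rw [a, b, map_zero]) P.left_mem h4
  have hw2 : w.2.1 = 0 := Lp.ext (by
    filter_upwards [u0, z2] with t a b
    exact a.trans b.symm)
  have hend : endPt w = 0 := by
    refine Prod.ext ?_ p0
    change w.1.val P.t_f = 0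
    rw [hw1, WSpace.val_zero]
  have hw4 : w.2.2.2 = 0 := costate_eq_zero hD w
    (by
      filter_upwards [hX, y0] with t a b
      rw [b, map_zero, zero_add] at a; exact a)
    (by
      filter_upwards [hU, y0] with t a b
      rw [b, map_zero, zero_add] at a; exact a)
    (by rw [e5, hend, map_zero, map_zero])
  exact Prod.ext hw1 (Prod.ext hw2 (Prod.ext p0 hw4))

end Problem

namespace Problem

variable {nx nu np ng : ℕ} {P : Problem nx nu np ng}

/-! ### Surjectivity of the linearization -/

/-- A pair `(x, λ)`, as a direction of `(y, λ)`. -/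
def inPair (nx nu np : ℕ) : (Vec nx × Vec nx) →L[ℝ] Triple nx nu np × Vec nx :=
  (ContinuousLinearMap.inl ℝ (Vec nx) (Vec nu × Vec np) ∘L ContinuousLinearMap.fst ℝ _ _).prod
    (ContinuousLinearMap.snd ℝ _ _)

/-- A control, as a direction of `(y, λ)`. -/
def inControl (nx nu np : ℕ) : Vec nu →L[ℝ] Triple nx nu np × Vec nx :=
  ContinuousLinearMap.inl ℝ (Triple nx nu np) (Vec nx) ∘L
    ContinuousLinearMap.inr ℝ (Vec nx) (Vec nu × Vec np) ∘L
      ContinuousLinearMap.inl ℝ (Vec nu) (Vec np)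

/-- A parameter, as a direction of `(y, λ)`. -/
def inParam (nx nu np : ℕ) : Vec np →L[ℝ] Triple nx nu np × Vec nx :=
  ContinuousLinearMap.inl ℝ (Triple nx nu np) (Vec nx) ∘L
    ContinuousLinearMap.inr ℝ (Vec nx) (Vec nu × Vec np) ∘L
      ContinuousLinearMap.inr ℝ (Vec nu) (Vec np)

theorem pathAt_eq_add (w : P.Z) (t : ℝ) : pathAt w t =
    inPair nx nu np (xAt w t, costate w t) + inControl nx nu np (uAt w t) +
      inParam nx nu np (par w) := by
  refine Prod.ext (Prod.ext ?_ (Prod.ext ?_ ?_)) ?_ <;>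
    simp [pathAt, yAt, inPair, inControl, inParam]

/-- By the strengthened Legendre condition the control can be eliminated from the control equation,
by an essentially bounded operator. -/
theorem exists_controlInverse (hP : P.IsSmooth) {z : P.Z} {g : P.G} (hSO : P.SecondOrder z g) :
    ∃ R : ℝ → Vec nu →L[ℝ] Vec nu, MemLp R ∞ P.μ ∧ ∀ᵐ t ∂P.μ, ∀ v,
      R t (formL (dirU nx nu np) (P.nemDeriv z g t (inControl nx nu np v))) = v ∧
      formL (dirU nx nu np) (P.nemDeriv z g t (inControl nx nu np (R t v))) = v := by
  set U : ℝ → Matrix (Fin nu) (Fin nu) ℝ :=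
    fun t => P.HH z g t (dirU nx nu np) (dirU nx nu np) with hUdef
  obtain ⟨M, hM⟩ := hSO.legendre
  have hform : ∀ᵐ t ∂P.μ, ∀ v,
      formL (dirU nx nu np) (P.nemDeriv z g t (inControl nx nu np v)) = U t *ᵥ v := by
    filter_upwards [ae_smoothAt hP g] with t h v
    have e : inControl nx nu np v = (((0, v, 0) : Triple nx nu np), (0 : Vec nx)) := rfl
    ext j
    have := h.HH_apply z (dirU nx nu np) (0, v, 0) j
    simp only [Matrix.mulVec_zero, zero_add, add_zero] at this
    rw [e, nemDeriv_apply, map_zero, ContinuousLinearMap.zero_comp, add_zero]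
    exact this.symm
  have hUm : ∀ i j, AEStronglyMeasurable (fun t => U t i j) P.μ := by
    intro i j
    refine (MemLp_top.clm_apply (MemLp_top.clm_apply (memLp_hamHess hP z g)
      (memLp_const (dirU nx nu np i))) (memLp_const (dirU nx nu np j))).1.congr ?_
    filter_upwards [ae_smoothAt hP g] with t h
    rw [hUdef, ← h.fderiv_fderiv_redHam]; rfl
  have hUm' : AEStronglyMeasurable U P.μ :=
    (aemeasurable_pi_iff (X := fun _ => Fin nu → ℝ).2 fun i => aemeasurable_pi_iff.2 fun j =>
      (hUm i j).aemeasurable).aestronglyMeasurable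
  have hinv : ∀ i j, AEStronglyMeasurable (fun t => (U t)⁻¹ i j) P.μ := by
    intro i j
    have e : (fun t => (U t)⁻¹ i j) = fun t => (U t).det⁻¹ * (U t).adjugate i j := by
      funext t
      rw [Matrix.inv_def, Ring.inverse_eq_inv', Matrix.smul_apply, smul_eq_mul]
    rw [e]
    have hdet : AEStronglyMeasurable (fun t => (U t).det) P.μ :=
      (continuous_id.matrix_det).comp_aestronglyMeasurable hUm'
    have hadj : AEStronglyMeasurable (fun t => (U t).adjugate i j) P.μ :=
      ((continuous_id.matrix_adjugate).matrix_elem i j).comp_aestronglyMeasurable hUm'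
    exact (hdet.aemeasurable.inv.aestronglyMeasurable).mul hadj
  have hinvm : ∀ i j, MemLp (fun t => (U t)⁻¹ i j) ∞ P.μ := fun i j =>
    memLp_top_of_bound (hinv i j) M (hM.mono fun t ht => ht.2 i j)
  refine ⟨fun t => LinearMap.toContinuousLinearMap (Matrix.toLin' (U t)⁻¹),
    MemLp_top.clm_of_apply fun v => ?_, ?_⟩
  · refine memLp_pi_iff.2 fun i => ?_
    have : (fun t => (LinearMap.toContinuousLinearMap (Matrix.toLin' (U t)⁻¹)) v i) =
        fun t => ∑ j, (U t)⁻¹ i j * v j := by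
      funext t; simp [Matrix.mulVec, dotProduct]
    rw [this]
    exact memLp_finsetSum _ fun j _ => (hinvm i j).mul_const (v j)
  · filter_upwards [hform, hM] with t h1 h2 v
    have hdet : IsUnit (U t).det := (Matrix.isUnit_iff_isUnit_det _).1 h2.1
    constructor
    · rw [h1]
      simp [Matrix.mulVec_mulVec, Matrix.nonsing_inv_mul _ hdet]
    · rw [h1]
      simp [Matrix.mulVec_mulVec, Matrix.mul_nonsing_inv _ hdet]

/-- The initial multiplier and the parameter: together with the right-hand sides they determine the
solution of the linearized state, adjoint and control equations. -/
def shootL (P : Problem nx nu np ng) : P.Z →L[ℝ] Vec nx × Vec np :=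
  (WSpace.valL nx ⟨P.t₀, P.left_mem⟩ ∘L P.costateL).prod P.parL

theorem shootL_apply (w : P.Z) : P.shootL w = (costate w P.t₀, par w) :=
  Prod.ext (WSpace.valL_apply _ _) rfl

/-- The linearized equations in terms of the derivative of the superposition operator. -/
theorem linDyn_eq_iff' (hP : P.IsSmooth) (z : P.Z) (g : P.G) (w : P.Z) (b : P.Dyn) :
    linDyn hP z g w = b ↔
    (∀ᵐ t ∂P.μ, w.1.der t - (P.nemDeriv z g t (pathAt w t)).1 = b.1 t) ∧
    (∀ᵐ t ∂P.μ, w.2.2.2.der t +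
      formL (dirX nx nu np) (P.nemDeriv z g t (pathAt w t)) = b.2.1 t) ∧
    (∀ᵐ t ∂P.μ, formL (dirU nx nu np) (P.nemDeriv z g t (pathAt w t)) = b.2.2.1 t) ∧
    xAt w P.t₀ = b.2.2.2 := by
  have e : ∀ t, P.nemDeriv z g t (pathAt w t) = (P.stateDeriv z g t (yAt w t),
      P.hamHess z g t (yAt w t) + dotL nx (costate w t) ∘L P.stateDeriv z g t) := fun t =>
    P.nemDeriv_apply z g t _ _
  simp only [e]
  exact linDyn_eq_iff hP z g w b

/-- The ordinary differential equation for `(x, λ)` after elimination of the control, with operator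
`L` and right-hand side `k`; the control is `S (x, λ) + s`. -/
theorem exists_reduction (hP : P.IsSmooth) {z : P.Z} {g : P.G} (hSO : P.SecondOrder z g)
    (b : P.Dyn) (p : Vec np) :
    ∃ (L : ℝ → (Vec nx × Vec nx) →L[ℝ] Vec nx × Vec nx) (k : ℝ → Vec nx × Vec nx)
      (S : ℝ → (Vec nx × Vec nx) →L[ℝ] Vec nu) (s : ℝ → Vec nu), MemLp L ∞ P.μ ∧ MemLp k ∞ P.μ ∧
      MemLp S ∞ P.μ ∧ MemLp s ∞ P.μ ∧ (b = 0 → p = 0 → ∀ᵐ t ∂P.μ, k t = 0 ∧ s t = 0) ∧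
      ∀ᵐ t ∂P.μ, ∀ (v : Vec nx × Vec nx) (u : Vec nu),
        (formL (dirU nx nu np) (P.nemDeriv z g t (inPair nx nu np v + inControl nx nu np u +
          inParam nx nu np p)) = b.2.2.1 t ↔ u = S t v + s t) ∧
        (u = S t v + s t → L t v + k t =
          ((P.nemDeriv z g t (inPair nx nu np v + inControl nx nu np u +
            inParam nx nu np p)).1 + b.1 t,
          b.2.1 t - formL (dirX nx nu np) (P.nemDeriv z g t (inPair nx nu np v +
            inControl nx nu np u + inParam nx nu np p)))) := by
  obtain ⟨R, hR, hRinv⟩ := exists_controlInverse hP hSO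
  have hN := memLp_nemDeriv hP z g
  set fU := formL (nx := nx) (nu := nu) (np := np) (dirU nx nu np)
  set fX := formL (nx := nx) (nu := nu) (np := np) (dirX nx nu np)
  set iV := inPair nx nu np
  set iU := inControl nx nu np
  set q := inParam nx nu np p
  let S : ℝ → (Vec nx × Vec nx) →L[ℝ] Vec nu := fun t => -(R t ∘L fU ∘L P.nemDeriv z g t ∘L iV)
  let s : ℝ → Vec nu := fun t => R t (b.2.2.1 t - fU (P.nemDeriv z g t q))
  let D : ℝ → (Vec nx × Vec nx) →L[ℝ] Vec nx × (Triple nx nu np →L[ℝ] ℝ) :=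
    fun t => P.nemDeriv z g t ∘L (iV + iU ∘L S t)
  let d : ℝ → Vec nx × (Triple nx nu np →L[ℝ] ℝ) := fun t => P.nemDeriv z g t (iU (s t) + q)
  have hS : MemLp S ∞ P.μ := by
    refine MemLp_top.clm_of_apply fun v => ?_
    exact (MemLp_top.clm_apply hR (fU.comp_memLp'
      (MemLp_top.clm_apply hN (memLp_const (iV v))))).neg
  have hs : MemLp s ∞ P.μ := MemLp_top.clm_apply hR ((Lp.memLp b.2.2.1).sub
    (fU.comp_memLp' (MemLp_top.clm_apply hN (memLp_const q))))
  have hDv : ∀ v, MemLp (fun t => D t v) ∞ P.μ := fun v =>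
    MemLp_top.clm_apply hN (v := fun t => iV v + iU (S t v)) ((memLp_const (iV v)).add
      (iU.comp_memLp' (MemLp_top.clm_apply hS (memLp_const v))))
  have hd : MemLp d ∞ P.μ := MemLp_top.clm_apply hN (v := fun t => iU (s t) + q)
    ((iU.comp_memLp' hs).add (memLp_const q))
  refine ⟨fun t => (ContinuousLinearMap.fst ℝ _ _ ∘L D t).prod (-(fX ∘L D t)),
    fun t => ((d t).1 + b.1 t, b.2.1 t - fX (d t)), S, s, ?_, ?_, hS, hs, ?_, ?_⟩
  · refine MemLp_top.clm_of_apply fun v => ?_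
    exact MemLp.of_fst_snd ⟨(hDv v).fst, (fX.comp_memLp' (hDv v)).neg⟩
  · exact MemLp.of_fst_snd ⟨hd.fst.add (Lp.memLp b.1),
      (Lp.memLp b.2.1).sub (fX.comp_memLp' hd)⟩
  · intro hb hp
    have z1 : ⇑(0 : LSpace nx ∞ P.t₀ P.t_f) =ᵐ[P.μ] 0 := Lp.coeFn_zero _ _ _
    have z2 : ⇑(0 : LSpace nu ∞ P.t₀ P.t_f) =ᵐ[P.μ] 0 := Lp.coeFn_zero _ _ _
    subst hb
    have hq : q = 0 := by simp only [q, hp, map_zero]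
    filter_upwards [z1, z2] with t h1 h2
    have hs0 : s t = 0 := by
      change R t ((0 : LSpace nu ∞ P.t₀ P.t_f) t - fU (P.nemDeriv z g t q)) = 0
      rw [h2, hq, map_zero, map_zero, Pi.zero_apply, sub_zero, map_zero]
    have hd0 : d t = 0 := by
      change P.nemDeriv z g t (iU (s t) + q) = 0
      rw [hs0, hq, map_zero, add_zero, map_zero]
    refine ⟨Prod.ext ?_ ?_, hs0⟩
    · change (d t).1 + (0 : LSpace nx ∞ P.t₀ P.t_f) t = 0
      rw [hd0, h1]; simp
    · change (0 : LSpace nx ∞ P.t₀ P.t_f) t - fX (d t) = 0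
      rw [hd0, h1]; simp
  · filter_upwards [hRinv] with t ht v u
    refine ⟨?_, fun hu => ?_⟩
    · have hSv : S t v + s t = R t (b.2.2.1 t - fU (P.nemDeriv z g t (iV v)) -
          fU (P.nemDeriv z g t q)) := by
        change -(R t (fU (P.nemDeriv z g t (iV v)))) +
          R t (b.2.2.1 t - fU (P.nemDeriv z g t q)) = _
        rw [← map_neg, ← map_add]; congr 1; abel
      rw [hSv, map_add, map_add, map_add, map_add]
      constructor
      · intro h
        rw [← h, show ∀ a b c : Vec nu, a + b + c - a - c = b from fun a b c => by abel, (ht u).1]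
      · intro h
        rw [h, (ht _).2]; abel
    · have e : iV v + iU u + q = (iV v + iU (S t v)) + (iU (s t) + q) := by
        rw [hu, map_add]; abel
      rw [e, map_add]
      refine Prod.ext ?_ ?_
      · change (D t v).1 + ((d t).1 + b.1 t) = (D t v).1 + (d t).1 + b.1 t
        rw [add_assoc]
      · change -(fX (D t v)) + (b.2.1 t - fX (d t)) = b.2.1 t - fX (D t v + d t)
        rw [map_add]; abel

end Problem

/-- Existence and uniqueness for linear differential equations, in integral form. -/
theorem existsUnique_linear_integral_solution {V : Type*} [NormedAddCommGroup V] [NormedSpace ℝ V]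
    [CompleteSpace V] {t₀ t_f : ℝ} (h : t₀ ≤ t_f) {L : ℝ → V →L[ℝ] V} {k : ℝ → V}
    (hL : MemLp L ∞ (timeMeasure t₀ t_f)) (hk : MemLp k ∞ (timeMeasure t₀ t_f)) (v₀ : V) :
    ∃! ξ : C(Icc t₀ t_f, V), ∀ t : Icc t₀ t_f,
      ξ t = v₀ + ∫ s in t₀..t, (L s (IccExtend h ξ s) + k s) := by
  obtain ⟨c, -, hc⟩ := MemLp_top.exists_bound hL
  obtain ⟨K, -, hK⟩ := MemLp_top.exists_bound hk
  refine existsUnique_integral_solution h (m := fun t v => L t v + k t) (c := c) (K := K)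
    (fun v => ((MemLp_top.clm_apply hL (memLp_const v)).add hk).1) ?_ ?_ v₀
  · filter_upwards [hc] with t ht v w
    rw [add_sub_add_right_eq_sub, ← map_sub]
    exact (L t).le_of_opNorm_le ht _
  · filter_upwards [hK] with t ht
    rwa [map_zero, zero_add]

/-- A pair of Sobolev functions with prescribed initial values and derivatives, as a solution of
an integral equation. -/
theorem WSpace.prod_eq_integral {m n : ℕ} {t₀ t_f : ℝ} (h : t₀ ≤ t_f) (x : WSpace m ∞ t₀ t_f)
    (y : WSpace n ∞ t₀ t_f) {v : ℝ → Vec m × Vec n}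
    (hv : ∀ᵐ t ∂timeMeasure t₀ t_f, v t = (x.der t, y.der t)) (t : Icc t₀ t_f) :
    (x.val t, y.val t) = (x.val t₀, y.val t₀) + ∫ s in t₀..t, v s := by
  rw [intervalIntegral.integral_congr_ae
      (ae_uIoc_of_ae_timeMeasure hv ⟨t₀, le_rfl, h⟩ t), x.val_eq t.2, y.val_eq t.2]
  have h1 := LSpace.intervalIntegrable x.der ⟨t₀, le_rfl, h⟩ t
  have h2 := LSpace.intervalIntegrable y.der ⟨t₀, le_rfl, h⟩ t
  rw [intervalIntegral.integral_of_le t.2.1] at *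
  rw [intervalIntegral.integral_of_le t.2.1, intervalIntegral.integral_of_le t.2.1,
    integral_pair h1.1 h2.1]
  rfl

namespace Problem

variable {nx nu np ng : ℕ} {P : Problem nx nu np ng}

/-- Given the initial multiplier and the parameter, the linearized equations reduce to an initial
value problem for `(x, λ)`, which is solvable for all data. -/
theorem linDyn_prod_shootL_surjective (hP : P.IsSmooth) {z : P.Z} {g : P.G}
    (hSO : P.SecondOrder z g) :
    Function.Surjective
      ((linDyn hP z g).toLinearMap.prod (P.shootL : P.Z →L[ℝ] _).toLinearMap) := by
  rintro ⟨b, lam₀, p⟩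
  obtain ⟨L, k, S, s, hL, hk, hS, hs, -, H⟩ := exists_reduction hP hSO b p
  obtain ⟨ξ, hξ, -⟩ := existsUnique_linear_integral_solution P.lt.le hL hk (b.2.2.2, lam₀)
  have hξm : MemLp (fun t => IccExtend P.lt.le ξ t) ∞ P.μ :=
    memLp_top_of_bound (ξ.continuous.Icc_extend'.aestronglyMeasurable) ‖ξ‖
      (.of_forall fun t => ξ.norm_coe_le_norm _)
  have hr : MemLp (fun t => L t (IccExtend P.lt.le ξ t) + k t) ∞ P.μ :=
    (MemLp_top.clm_apply hL hξm).add hk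
  have hI : ∀ t : Icc P.t₀ P.t_f, IntegrableOn (fun t => L t (IccExtend P.lt.le ξ t) + k t)
      (Ioc P.t₀ t) := fun t =>
    (intervalIntegrable_of_integrable_timeMeasure (hr.integrable le_top)
      ⟨P.t₀, P.left_mem⟩ t).1
  have hfst : ∀ t : Icc P.t₀ P.t_f, (ξ t).1 = b.2.2.2 +
      ∫ s in P.t₀..t, (L s (IccExtend P.lt.le ξ s) + k s).1 := fun t => by
    rw [hξ, Prod.fst_add, intervalIntegral.integral_of_le t.2.1,
      intervalIntegral.integral_of_le t.2.1, fst_integral (hI t)]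
  have hsnd : ∀ t : Icc P.t₀ P.t_f, (ξ t).2 = lam₀ +
      ∫ s in P.t₀..t, (L s (IccExtend P.lt.le ξ s) + k s).2 := fun t => by
    rw [hξ, Prod.snd_add, intervalIntegral.integral_of_le t.2.1,
      intervalIntegral.integral_of_le t.2.1, snd_integral (hI t)]
  obtain ⟨x, hx, hx'⟩ := WSpace.exists_of_primitive P.lt.le ⟨_, ξ.continuous.fst⟩ hr.fst _ hfst
  obtain ⟨y, hy, hy'⟩ := WSpace.exists_of_primitive P.lt.le ⟨_, ξ.continuous.snd⟩ hr.snd _ hsnd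
  have hu : MemLp (fun t => S t (IccExtend P.lt.le ξ t) + s t) ∞ P.μ :=
    (MemLp_top.clm_apply hS hξm).add hs
  let w : P.Z := (x, hu.toLp, p, y)
  have hw : ∀ᵐ t ∂P.μ, (xAt w t, costate w t) = IccExtend P.lt.le ξ t := by
    filter_upwards [ae_restrict_mem measurableSet_Ioo] with t ht
    rw [IccExtend_of_mem _ _ (Ioo_subset_Icc_self ht)]
    exact Prod.ext (hx ⟨t, Ioo_subset_Icc_self ht⟩) (hy ⟨t, Ioo_subset_Icc_self ht⟩)
  have init : ξ ⟨P.t₀, P.left_mem⟩ = (b.2.2.2, lam₀) := by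
    rw [hξ, intervalIntegral.integral_same, add_zero]
  have hall : ∀ᵐ t ∂P.μ, formL (dirU nx nu np) (P.nemDeriv z g t (pathAt w t)) = b.2.2.1 t ∧
      (x.der t, y.der t) = ((P.nemDeriv z g t (pathAt w t)).1 + b.1 t,
        b.2.1 t - formL (dirX nx nu np) (P.nemDeriv z g t (pathAt w t))) := by
    filter_upwards [H, hw, hx', hy', hu.coeFn_toLp] with t H hw hx hy hu
    have e : uAt w t = S t (xAt w t, costate w t) + s t := by rw [hw]; exact hu
    obtain ⟨h1, h2⟩ := H (xAt w t, costate w t) (uAt w t)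
    rw [pathAt_eq_add]
    refine ⟨h1.2 e, ?_⟩
    rw [hx, hy]
    refine Eq.trans ?_ (h2 e)
    rw [hw]
  refine ⟨w, Prod.ext ((linDyn_eq_iff' hP z g w b).2 ⟨?_, ?_, hall.mono fun t h => h.1, ?_⟩) ?_⟩
  · filter_upwards [hall] with t h
    rw [show w.1.der t = _ from congrArg Prod.fst h.2]
    exact add_sub_cancel_left _ _
  · filter_upwards [hall] with t h
    rw [show w.2.2.2.der t = _ from congrArg Prod.snd h.2]
    exact sub_add_cancel _ _
  · exact (hx ⟨P.t₀, P.left_mem⟩).trans (congrArg Prod.fst init)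
  · refine (shootL_apply w).trans (Prod.ext ?_ rfl)
    exact (hy ⟨P.t₀, P.left_mem⟩).trans (congrArg Prod.snd init)

/-- The initial value problem has only one solution. -/
theorem linDyn_prod_shootL_injective (hP : P.IsSmooth) {z : P.Z} {g : P.G}
    (hSO : P.SecondOrder z g) :
    Function.Injective
      ((linDyn hP z g).toLinearMap.prod (P.shootL : P.Z →L[ℝ] _).toLinearMap) := by
  refine (injective_iff_map_eq_zero _).2 fun w hw => ?_
  have hw1 : linDyn hP z g w = 0 := congrArg Prod.fst hw
  have hw2 : (costate w P.t₀, par w) = 0 := (shootL_apply w).symm.trans (congrArg Prod.snd hw)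
  have hp : par w = 0 := congrArg Prod.snd hw2
  obtain ⟨L, k, S, s, hL, hk, -, -, h0, H⟩ := exists_reduction hP hSO 0 (par w)
  obtain ⟨a1, a2, a3, a4⟩ := (linDyn_eq_iff' hP z g w 0).1 hw1
  have hall : ∀ᵐ t ∂P.μ, uAt w t = S t (xAt w t, costate w t) ∧
      L t (xAt w t, costate w t) = (w.1.der t, w.2.2.2.der t) := by
    filter_upwards [h0 rfl hp, H, a1, a2, a3] with t h0 H a1 a2 a3
    obtain ⟨h1, h2⟩ := H (xAt w t, costate w t) (uAt w t)
    rw [← pathAt_eq_add] at h1 h2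
    have e := h1.1 a3
    have e2 := h2 e
    rw [h0.1, add_zero] at e2
    rw [h0.2, add_zero] at e
    refine ⟨e, e2.trans (Prod.ext ?_ ?_)⟩
    · rw [← a1]; exact add_sub_cancel _ _
    · rw [← a2]; exact add_sub_cancel_right _ _
  obtain ⟨ξ, -, huniq⟩ := existsUnique_linear_integral_solution P.lt.le hL
    (memLp_const (0 : Vec nx × Vec nx)) 0
  have z0 := huniq 0 fun t => by
    rw [intervalIntegral.integral_congr (g := fun _ => (0 : Vec nx × Vec nx))
      (fun s _ => by simp [IccExtend])]
    simp
  have zw := huniq (w.1.1.1.prodMk w.2.2.2.1.1) fun t => by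
    have := WSpace.prod_eq_integral P.lt.le w.1 w.2.2.2
      (v := fun s => L s (IccExtend P.lt.le (w.1.1.1.prodMk w.2.2.2.1.1) s) + 0) (by
        filter_upwards [hall, ae_restrict_mem measurableSet_Ioo] with t h ht
        have ht' := Ioo_subset_Icc_self ht
        rw [add_zero, IccExtend_of_mem _ _ ht', ← h.2]
        exact congrArg _ (Prod.ext (WSpace.val_of_mem _ ht').symm (WSpace.val_of_mem _ ht').symm)) t
    rw [WSpace.val_of_mem _ t.2, WSpace.val_of_mem _ t.2] at this
    refine this.trans (congrArg (· + _) ?_)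
    exact Prod.ext a4 (congrArg Prod.fst hw2)
  have hxy : ∀ t ∈ Icc P.t₀ P.t_f, (xAt w t, costate w t) = 0 := fun t ht => by
    have := congrArg (fun ξ : C(Icc P.t₀ P.t_f, Vec nx × Vec nx) => ξ ⟨t, ht⟩) (zw.trans z0.symm)
    refine Eq.trans ?_ this
    exact Prod.ext (WSpace.val_of_mem _ ht) (WSpace.val_of_mem _ ht)
  have hall0 : ∀ᵐ t ∂P.μ, uAt w t = 0 ∧ w.1.der t = 0 ∧ w.2.2.2.der t = 0 := by
    filter_upwards [hall, ae_restrict_mem measurableSet_Ioo] with t h ht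
    obtain ⟨h1, h2⟩ := h
    rw [hxy t (Ioo_subset_Icc_self ht), map_zero] at h1 h2
    exact ⟨h1, (congrArg Prod.fst h2).symm, (congrArg Prod.snd h2).symm⟩
  refine Prod.ext (WSpace.eq_zero_of_der_eq_zero (s := P.t₀) (hall0.mono fun t h => h.2.1)
    P.left_mem a4) (Prod.ext (Lp.ext ?_) (Prod.ext hp
      (WSpace.eq_zero_of_der_eq_zero (s := P.t₀) (hall0.mono fun t h => h.2.2)
        P.left_mem (congrArg Prod.fst hw2))))
  filter_upwards [hall0, Lp.coeFn_zero (Vec nu) ∞ P.μ] with t h h'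
  exact h.1.trans h'.symm

/-- The initial multiplier and the parameter may be exchanged for the transversality and parameter
conditions, which have the same finite dimension, because the resulting operator is injective. -/
theorem lin_bijective (hP : P.IsSmooth) {z : P.Z} {g : P.G} (hSO : P.SecondOrder z g) :
    Function.Bijective (lin hP z g) :=
  ⟨(injective_iff_map_eq_zero _).2 fun w hw =>
      lin_injective hP hSO w (congrArg Prod.fst hw) (congrArg Prod.snd hw),
    surjective_prod_of_bijective_prod (linDyn hP z g).toLinearMap (linFin hP z g).toLinearMap
      (P.shootL : P.Z →L[ℝ] _).toLinearMap
      ⟨linDyn_prod_shootL_injective hP hSO, linDyn_prod_shootL_surjective hP hSO⟩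
      (lin_injective hP hSO)⟩

end Problem

namespace Problem

variable {nx nu np ng : ℕ} {P : Problem nx nu np ng}

/-! ### Sensitivity of the quantity of interest by duality -/

/-- The multiplier of `z` solves the adjoint, control, transversality and parameter equations for
the state operator `D`, with right-hand sides given by the functionals `c t` and `m`. -/
structure IsDual (D : ℝ → Triple nx nu np →L[ℝ] Vec nx) (c : ℝ → Triple nx nu np →L[ℝ] ℝ)
    (m : Vec nx × Vec np →L[ℝ] ℝ) (z : P.Z) : Prop where
  adjoint : ∀ᵐ t ∂P.μ, z.2.2.2.der t +
    evalL (dirX nx nu np) (c t + dotL nx (costate z t) ∘L D t) = 0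
  control : ∀ᵐ t ∂P.μ, evalL (dirU nx nu np) (c t + dotL nx (costate z t) ∘L D t) = 0
  final : costate z P.t_f = evalL endX m
  param : ∫ t, evalL (dirP nx nu np) (c t + dotL nx (costate z t) ∘L D t) ∂P.μ = -evalL endP m

/-- Green's formula with the terminal and parameter conditions inserted. -/
theorem IsDual.green {D : ℝ → Triple nx nu np →L[ℝ] Vec nx} (hD : MemLp D ∞ P.μ) {z₁ z₂ : P.Z}
    {a : ℝ → Vec nx} (ha : MemLp a ∞ P.μ) {c : ℝ → Triple nx nu np →L[ℝ] ℝ} (hc : MemLp c ∞ P.μ)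
    {m : Vec nx × Vec np →L[ℝ] ℝ} (h₂ : IsDual D c m z₂) (h0 : xAt z₁ P.t₀ = 0)
    (hx : ∀ᵐ t ∂P.μ, z₁.1.der t = D t (yAt z₁ t) + a t) :
    ∫ t, (c t (yAt z₁ t) - costate z₂ t ⬝ᵥ a t) ∂P.μ = -m (endPt z₁) := by
  rw [Problem.green hD z₁ z₂ ha hc h0 hx h₂.adjoint h₂.control, h₂.final, h₂.param,
    ← evalL_endPt_dotProduct, neg_dotProduct, neg_add, sub_eq_add_neg, add_comm]
  rfl

/-- The solution of the adjoint equations, as a solution of a dual system. -/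
theorem IsAdjoint.isDual (hP : P.IsSmooth) {ϕ : Vec nx × Vec np → ℝ}
    {ell : ℝ → Triple nx nu np × Vec ng → ℝ} (hell : Smooth P.t₀ P.t_f ell) {z w : P.Z} {g : P.G}
    (hw : P.IsAdjoint ϕ ell z g w) :
    IsDual (P.stateDeriv z g)
      (fun t => P.hamHess z g t (yAt w t) + fderiv ℝ (fun y => ell t (y, g t y)) (yAt z t))
      (fderiv ℝ ϕ (endPt z) + fderiv ℝ (fderiv ℝ P.φ) (endPt z) (endPt w)) w ∧
    (∀ᵐ t ∂P.μ, w.1.der t = P.stateDeriv z g t (yAt w t) + 0) ∧ xAt w P.t₀ = 0 := by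
  have hM := hell.memLp_fderiv_comp g (memLp_yAt z)
  have h := (lin_eq_adjointData_iff hP hell z w g).2 hw
  obtain ⟨h1, h2, h3, h4⟩ := (linDyn_eq_iff hP z g w _).1 (congrArg Prod.fst h)
  obtain ⟨h5, h6⟩ := (linFin_eq_iff hP z g w _).1 (congrArg Prod.snd h)
  have z1 : ⇑(0 : LSpace nx ∞ P.t₀ P.t_f) =ᵐ[P.μ] 0 := Lp.coeFn_zero _ _ _
  have m1 := ((evalL (dirX nx nu np)).comp_memLp' hM).coeFn_toLp
  have m2 := ((evalL (dirU nx nu np)).comp_memLp' hM).coeFn_toLp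
  have n1 := Lp.coeFn_neg ((evalL (dirX nx nu np)).comp_memLp' hM).toLp
  have n2 := Lp.coeFn_neg ((evalL (dirU nx nu np)).comp_memLp' hM).toLp
  have hN : MemLp (fun t => P.hamHess z g t (yAt w t) +
      dotL nx (costate w t) ∘L P.stateDeriv z g t) ∞ P.μ :=
    memLp_form_add (MemLp_top.clm_apply (memLp_hamHess hP z g) (memLp_yAt w))
      (memLp_dotL_comp (memLp_costate w) (memLp_stateDeriv hP z g))
  refine ⟨⟨?_, ?_, ?_, ?_⟩, ?_, h4⟩
  · filter_upwards [h2, m1, n1] with t a b c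
    have a' := a.trans (c.trans (congrArg Neg.neg b))
    rw [add_right_comm, map_add, ← add_assoc, a']
    exact neg_add_cancel _
  · filter_upwards [h3, m2, n2] with t a b c
    have a' := a.trans (c.trans (congrArg Neg.neg b))
    rw [add_right_comm, map_add, a']
    exact neg_add_cancel _
  · rw [map_add]
    exact sub_eq_iff_eq_add.1 h5
  · have e : ∀ t, evalL (dirP nx nu np) (P.hamHess z g t (yAt w t) +
        fderiv ℝ (fun y => ell t (y, g t y)) (yAt z t) +
          dotL nx (costate w t) ∘L P.stateDeriv z g t) =
        evalL (dirP nx nu np) (P.hamHess z g t (yAt w t) +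
          dotL nx (costate w t) ∘L P.stateDeriv z g t) +
        evalL (dirP nx nu np) (fderiv ℝ (fun y => ell t (y, g t y)) (yAt z t)) := fun t => by
      rw [add_right_comm, map_add]
    simp only [e]
    rw [integral_add ((evalL (dirP nx nu np)).integrable_comp (hN.integrable le_top))
      ((evalL (dirP nx nu np)).integrable_comp (hM.integrable le_top)), eq_sub_of_add_eq' h6,
      map_add]
    change -_ - _ - _ + _ = _
    abel
  · filter_upwards [h1, z1] with t a b
    rw [add_zero]
    exact sub_eq_zero.1 (a.trans b)

/-- The defect of the linearization of the superposition operator. -/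
def nemDefect (P : Problem nx nu np ng) (zbar : P.Z) (gbar : P.G) (z : P.Z) (g : P.G) (t : ℝ) :
    Vec nx × (Triple nx nu np →L[ℝ] ℝ) :=
  P.nem z g t - P.nem zbar gbar t - P.nemDeriv zbar gbar t (pathAt z t - pathAt zbar t)

theorem memLp_nemDefect (hP : P.IsSmooth) (zbar : P.Z) (gbar : P.G) (z : P.Z) (g : P.G) :
    MemLp (P.nemDefect zbar gbar z g) ∞ P.μ :=
  ((memLp_nem hP z g).sub (memLp_nem hP zbar gbar)).sub
    (MemLp_top.clm_apply (memLp_nemDeriv hP zbar gbar) ((memLp_pathAt z).sub (memLp_pathAt zbar)))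

/-- The difference of two solutions of the optimality system, for different component functions, as
a solution of a linear state equation and of a dual system. -/
theorem isDual_sub (hP : P.IsSmooth) {zbar z : P.Z} {gbar g : P.G} (hbar : psi hP zbar gbar = 0)
    (h : psi hP z g = 0) :
    IsDual (P.stateDeriv zbar gbar)
      (fun t => P.hamHess zbar gbar t (yAt (z - zbar) t) + (P.nemDefect zbar gbar z g t).2)
      (fderiv ℝ P.φ (endPt z) - fderiv ℝ P.φ (endPt zbar)) (z - zbar) ∧
    (∀ᵐ t ∂P.μ, (z - zbar).1.der t = P.stateDeriv zbar gbar t (yAt (z - zbar) t) +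
      (P.nemDefect zbar gbar z g t).1) ∧ xAt (z - zbar) P.t₀ = 0 := by
  have e0 : P.dynL (z - zbar, (memLp_nem hP z g).toLp - (memLp_nem hP zbar gbar).toLp) = 0 := by
    have := congrArg Prod.fst (h.trans hbar.symm)
    rw [psi, psi] at this
    have e := sub_eq_zero.2 (sub_left_injective this)
    rw [← map_sub] at e
    exact e
  have e1 : P.finL (z - zbar, (memLp_nem hP z g).toLp - (memLp_nem hP zbar gbar).toLp,
      fderiv ℝ P.φ (endPt z) - fderiv ℝ P.φ (endPt zbar)) = 0 := by
    have := congrArg Prod.snd (h.trans hbar.symm)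
    have e := sub_eq_zero.2 this
    rw [psi, psi, ← map_sub] at e
    exact e
  obtain ⟨h1, h2, h3, h4⟩ := (dynL_eq_iff _ _ _).1 e0
  obtain ⟨h5, h6⟩ := (finL_eq_iff _ _ _ _).1 e1
  have z1 : ⇑(0 : LSpace nx ∞ P.t₀ P.t_f) =ᵐ[P.μ] 0 := Lp.coeFn_zero _ _ _
  have z2 : ⇑(0 : LSpace nu ∞ P.t₀ P.t_f) =ᵐ[P.μ] 0 := Lp.coeFn_zero _ _ _
  have hN : ∀ᵐ t ∂P.μ, ((memLp_nem hP z g).toLp - (memLp_nem hP zbar gbar).toLp : P.Data) t =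
      (P.stateDeriv zbar gbar t (yAt (z - zbar) t) + (P.nemDefect zbar gbar z g t).1,
        P.hamHess zbar gbar t (yAt (z - zbar) t) + (P.nemDefect zbar gbar z g t).2 +
          dotL nx (costate (z - zbar) t) ∘L P.stateDeriv zbar gbar t) := by
    filter_upwards [Lp.coeFn_sub (memLp_nem hP z g).toLp (memLp_nem hP zbar gbar).toLp,
      (memLp_nem hP z g).coeFn_toLp, (memLp_nem hP zbar gbar).coeFn_toLp,
      pathAt_sub z zbar] with t a b c d
    rw [a, Pi.sub_apply, b, c]
    have e := P.nemDeriv_apply zbar gbar t (yAt (z - zbar) t) (costate (z - zbar) t)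
    have e' : P.nem z g t - P.nem zbar gbar t =
        P.nemDeriv zbar gbar t (pathAt (z - zbar) t) + P.nemDefect zbar gbar z g t := by
      rw [nemDefect, d]; abel
    rw [e']
    change P.nemDeriv zbar gbar t (yAt (z - zbar) t, costate (z - zbar) t) + _ = _
    rw [e]
    exact Prod.ext rfl (add_right_comm _ _ _)
  refine ⟨⟨?_, ?_, sub_eq_zero.1 h5, ?_⟩, ?_, h4⟩
  · filter_upwards [h2, hN, z1] with t a b c
    rw [b] at a
    exact a.trans c
  · filter_upwards [h3, hN, z2] with t a b c
    rw [b] at a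
    exact a.trans c
  · rw [integral_congr_ae (hN.mono fun t ht => congrArg
      (fun N : Vec nx × (Triple nx nu np →L[ℝ] ℝ) => evalL (dirP nx nu np) N.2) ht)] at h6
    exact eq_neg_of_add_eq_zero_right h6
  · filter_upwards [h1, hN, z1] with t a b c
    rw [b] at a
    exact sub_eq_zero.1 (a.trans c)

/-- Change of the linearized quantity of interest between two solutions of the optimality system,
in terms of the adjoint solution: the unknown variation `z - z̄` enters only through remainders. -/
theorem duality (hP : P.IsSmooth) {ϕ : Vec nx × Vec np → ℝ}
    {ell : ℝ → Triple nx nu np × Vec ng → ℝ} (hell : Smooth P.t₀ P.t_f ell) {zbar z w : P.Z}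
    {gbar g : P.G} (hbar : psi hP zbar gbar = 0) (h : psi hP z g = 0)
    (hw : P.IsAdjoint ϕ ell zbar gbar w) :
    ∫ t, fderiv ℝ (fun y => ell t (y, gbar t y)) (yAt zbar t) (yAt (z - zbar) t) ∂P.μ +
        fderiv ℝ ϕ (endPt zbar) (endPt (z - zbar)) =
      ∫ t, (costate w t ⬝ᵥ (P.nemDefect zbar gbar z g t).1 +
        (P.nemDefect zbar gbar z g t).2 (yAt w t)) ∂P.μ +
      (fderiv ℝ P.φ (endPt z) - fderiv ℝ P.φ (endPt zbar) -
        fderiv ℝ (fderiv ℝ P.φ) (endPt zbar) (endPt (z - zbar))) (endPt w) := by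
  obtain ⟨dw, hwx, hw0⟩ := hw.isDual hP hell
  obtain ⟨dz, hzx, hz0⟩ := isDual_sub hP hbar h
  have hD := memLp_stateDeriv hP zbar gbar
  have hH := memLp_hamHess hP zbar gbar
  have hN := memLp_nemDefect hP zbar gbar z g
  have hE := hell.memLp_fderiv_comp gbar (memLp_yAt zbar)
  have hcz := memLp_form_add (MemLp_top.clm_apply hH (memLp_yAt (z - zbar))) hN.snd
  have hcw := memLp_form_add (MemLp_top.clm_apply hH (memLp_yAt w)) hE
  have g1 := dw.green hD hN.fst hcw hz0 hzx
  have g2 := dz.green hD (memLp_const (0 : Vec nx)) hcz hw0 hwx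
  have i1 : Integrable (fun t => (P.hamHess zbar gbar t (yAt w t) +
      fderiv ℝ (fun y => ell t (y, gbar t y)) (yAt zbar t)) (yAt (z - zbar) t) -
      costate w t ⬝ᵥ (P.nemDefect zbar gbar z g t).1) P.μ :=
    ((MemLp_top.clm_apply hcw (memLp_yAt (z - zbar))).sub
      (MemLp_top.dotProduct (memLp_costate w) hN.fst)).integrable le_top
  have i2 : Integrable (fun t => (P.hamHess zbar gbar t (yAt (z - zbar) t) +
      (P.nemDefect zbar gbar z g t).2) (yAt w t) - costate (z - zbar) t ⬝ᵥ (0 : Vec nx)) P.μ :=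
    ((MemLp_top.clm_apply hcz (memLp_yAt w)).sub
      (MemLp_top.dotProduct (memLp_costate (z - zbar)) (memLp_const 0))).integrable le_top
  have i3 : Integrable (fun t => fderiv ℝ (fun y => ell t (y, gbar t y)) (yAt zbar t)
      (yAt (z - zbar) t)) P.μ :=
    (MemLp_top.clm_apply hE (memLp_yAt (z - zbar))).integrable le_top
  have i4 : Integrable (fun t => costate w t ⬝ᵥ (P.nemDefect zbar gbar z g t).1 +
      (P.nemDefect zbar gbar z g t).2 (yAt w t)) P.μ :=
    ((MemLp_top.dotProduct (memLp_costate w) hN.fst).add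
      (MemLp_top.clm_apply hN.snd (memLp_yAt w))).integrable le_top
  -- In the difference of the two Green identities, the Hessian terms cancel by symmetry.
  have pw : ∀ᵐ t ∂P.μ, ((P.hamHess zbar gbar t (yAt w t) +
      fderiv ℝ (fun y => ell t (y, gbar t y)) (yAt zbar t)) (yAt (z - zbar) t) -
      costate w t ⬝ᵥ (P.nemDefect zbar gbar z g t).1) -
      ((P.hamHess zbar gbar t (yAt (z - zbar) t) +
      (P.nemDefect zbar gbar z g t).2) (yAt w t) - costate (z - zbar) t ⬝ᵥ (0 : Vec nx)) =
      fderiv ℝ (fun y => ell t (y, gbar t y)) (yAt zbar t) (yAt (z - zbar) t) -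
      (costate w t ⬝ᵥ (P.nemDefect zbar gbar z g t).1 +
        (P.nemDefect zbar gbar z g t).2 (yAt w t)) := by
    filter_upwards [ae_smoothAt hP gbar] with t ht
    rw [add_apply, add_apply, ht.hamHess_symm zbar (yAt w t), dotProduct_zero]
    ring
  have key := integral_congr_ae pw
  rw [integral_sub i1 i2, integral_sub i3 i4, g1, g2] at key
  have hs := fderiv_fderiv_symm hP.φ (endPt zbar) (endPt w) (endPt (z - zbar))
  simp only [add_apply, sub_apply] at key ⊢
  linarith

end Problem

namespace Problem

variable {nx nu np ng : ℕ} {P : Problem nx nu np ng}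

theorem memLp_d (hP : P.IsSmooth) (z : P.Z) (g : P.G) : MemLp (P.d z g) ∞ P.μ := by
  refine memLp_pi_iff.2 fun i => ?_
  have h1 := MemLp_top.clm_apply (hP.l.memLp_fderiv g (memLp_yAt z))
    (memLp_const (0, Pi.single i 1))
  have h2 := MemLp_top.clm_apply (hP.f.memLp_fderiv g (memLp_yAt z))
    (memLp_const (0, Pi.single i 1))
  refine (h1.add (MemLp_top.dotProduct (memLp_costate z) h2)).ae_eq (.of_forall fun t => ?_)
  have := P.d_dotProduct z g t (Pi.single i 1)
  rw [dotProduct_single_one] at this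
  exact this.symm

theorem memLp_coeff (hP : P.IsSmooth) {ell : ℝ → Triple nx nu np × Vec ng → ℝ}
    (hell : Smooth P.t₀ P.t_f ell) (z w : P.Z) (g : P.G) : MemLp (P.coeff ell z g w) ∞ P.μ := by
  refine memLp_pi_iff.2 fun i => ?_
  have hc : MemLp (fun _ : ℝ => ((0, Pi.single i 1) : Triple nx nu np × Vec ng)) ∞ P.μ :=
    memLp_const _
  have hv : MemLp (fun t => graphDeriv (g t) (yAt z t) (yAt w t)) ∞ P.μ := by
    refine (MemLp.of_fst_snd (f := fun t => (yAt w t, fderiv ℝ (g t) (yAt z t) (yAt w t)))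
      ⟨memLp_yAt w, MemLp_top.clm_apply (g.memLp_fderiv_along (memLp_yAt z))
        (memLp_yAt w)⟩).ae_eq (.of_forall fun t => ?_)
    exact (graphDeriv_apply _ _ _).symm
  have h1 := MemLp_top.clm_apply (hell.memLp_fderiv g (memLp_yAt z)) hc
  have h2 := MemLp_top.clm_apply (hP.f.memLp_fderiv g (memLp_yAt z)) hc
  have h3 := MemLp_top.clm_apply (MemLp_top.clm_apply
    (hP.l.memLp_fderiv_fderiv g (memLp_yAt z)) hc) hv
  have h4 := MemLp_top.clm_apply (MemLp_top.clm_apply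
    (hP.f.memLp_fderiv_fderiv g (memLp_yAt z)) hc) hv
  refine ((h1.add (MemLp_top.dotProduct (memLp_costate w) h2)).add
    (h3.add (MemLp_top.dotProduct (memLp_costate z) h4))).ae_eq ?_
  filter_upwards [ae_smoothAt hP g] with t ht
  have := ht.coeff_dotProduct z (ell := ell) w (Pi.single i 1)
  rw [dotProduct_single_one] at this
  exact this.symm

theorem memLp_sensitivity (hP : P.IsSmooth) {ell : ℝ → Triple nx nu np × Vec ng → ℝ}
    (hell : Smooth P.t₀ P.t_f ell) (z w : P.Z) (g γ : P.G) :
    MemLp (fun t => P.coeff ell z g w t ⬝ᵥ γ t (yAt z t) +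
      P.d z g t ⬝ᵥ fderiv ℝ (γ t) (yAt z t) (yAt w t)) ∞ P.μ :=
  (MemLp_top.dotProduct (memLp_coeff hP hell z w g) (γ.memLp_along (memLp_yAt z))).add
    (MemLp_top.dotProduct (memLp_d hP z g)
      (MemLp_top.clm_apply (γ.memLp_fderiv_along (memLp_yAt z)) (memLp_yAt w)))

theorem norm_dotProduct_le {n : ℕ} (v w : Vec n) : ‖v ⬝ᵥ w‖ ≤ ‖dotL n‖ * ‖v‖ * ‖w‖ := by
  rw [← dotL_apply]
  exact (dotL n).le_opNorm₂ v w

/-- The derivative of the quantity of interest in the component function, expressed by the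
solution `w` of the adjoint equations. -/
def sensitivity (hP : P.IsSmooth) {ell : ℝ → Triple nx nu np × Vec ng → ℝ}
    (hell : Smooth P.t₀ P.t_f ell) (z : P.Z) (g : P.G) (w : P.Z) : P.G →L[ℝ] ℝ :=
  LinearMap.mkContinuousOfExistsBound
    { toFun := fun γ => ∫ t, (P.coeff ell z g w t ⬝ᵥ γ t (yAt z t) +
        P.d z g t ⬝ᵥ fderiv ℝ (γ t) (yAt z t) (yAt w t)) ∂P.μ
      map_add' := fun γ γ' => by
        rw [← integral_add ((memLp_sensitivity hP hell z w g γ).integrable le_top)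
          ((memLp_sensitivity hP hell z w g γ').integrable le_top)]
        refine integral_congr_ae ?_
        filter_upwards [ae_smoothAt hP γ, ae_smoothAt hP γ'] with t h h'
        have e : fderiv ℝ ((γ + γ') t) (yAt z t) =
            fderiv ℝ (γ t) (yAt z t) + fderiv ℝ (γ' t) (yAt z t) :=
          fderiv_add (h.g.differentiable (by norm_num) _) (h'.g.differentiable (by norm_num) _)
        have e' : (γ + γ') t (yAt z t) = γ t (yAt z t) + γ' t (yAt z t) := rfl
        rw [e, e', add_apply, dotProduct_add, dotProduct_add]
        ring
      map_smul' := fun c γ => by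
        rw [RingHom.id_apply, smul_eq_mul, ← integral_const_mul]
        refine integral_congr_ae ?_
        filter_upwards [ae_smoothAt hP γ] with t h
        have e : fderiv ℝ ((c • γ) t) (yAt z t) = c • fderiv ℝ (γ t) (yAt z t) :=
          fderiv_const_smul (h.g.differentiable (by norm_num) _) c
        have e' : (c • γ) t (yAt z t) = c • γ t (yAt z t) := rfl
        rw [e, e', smul_apply, dotProduct_smul, dotProduct_smul, smul_eq_mul, smul_eq_mul]
        ring }
    (by
      obtain ⟨K, hK, hKb⟩ := MemLp_top.exists_bound (memLp_coeff hP hell z w g)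
      obtain ⟨D, hD, hDb⟩ := MemLp_top.exists_bound (memLp_d hP z g)
      obtain ⟨Y, hY, hYb⟩ := MemLp_top.exists_bound (memLp_yAt w)
      refine ⟨‖dotL ng‖ * (K + D * Y) * P.μ.real univ, fun γ => ?_⟩
      have pw : ∀ᵐ t ∂P.μ, ‖P.coeff ell z g w t ⬝ᵥ γ t (yAt z t) +
          P.d z g t ⬝ᵥ fderiv ℝ (γ t) (yAt z t) (yAt w t)‖ ≤
          ‖dotL ng‖ * (K + D * Y) * ‖γ‖ := by
        filter_upwards [hKb, hDb, hYb, γ.innerBound] with t h1 h2 h3 h4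
        have a1 : ‖P.coeff ell z g w t ⬝ᵥ γ t (yAt z t)‖ ≤ ‖dotL ng‖ * K * ‖γ‖ :=
          (norm_dotProduct_le _ _).trans (by gcongr; exact h4.bdd₀ _)
        have a2 : ‖P.d z g t ⬝ᵥ fderiv ℝ (γ t) (yAt z t) (yAt w t)‖ ≤
            ‖dotL ng‖ * D * (‖γ‖ * Y) := by
          refine (norm_dotProduct_le _ _).trans ?_
          gcongr
          exact (fderiv ℝ (γ t) (yAt z t)).le_of_opNorm_le_of_le (h4.bdd₁ _) h3
        calc _ ≤ _ := norm_add_le_of_le a1 a2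
          _ = _ := by ring
      calc _ ≤ _ := norm_integral_le_of_norm_le_const pw
        _ = _ := by ring)

theorem sensitivity_apply (hP : P.IsSmooth) {ell : ℝ → Triple nx nu np × Vec ng → ℝ}
    (hell : Smooth P.t₀ P.t_f ell) (z : P.Z) (g : P.G) (w : P.Z) (γ : P.G) :
    sensitivity hP hell z g w γ = ∫ t, (P.coeff ell z g w t ⬝ᵥ γ t (yAt z t) +
      P.d z g t ⬝ᵥ fderiv ℝ (γ t) (yAt z t) (yAt w t)) ∂P.μ := rfl

theorem integral_sub_sub_add_sub {α : Type*} [MeasurableSpace α] {μ : Measure α}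
    {f₁ f₂ f₃ f₄ f₅ : α → ℝ} (h₁ : Integrable f₁ μ) (h₂ : Integrable f₂ μ) (h₃ : Integrable f₃ μ)
    (h₄ : Integrable f₄ μ) (h₅ : Integrable f₅ μ) :
    ∫ a, f₁ a ∂μ - ∫ a, f₂ a ∂μ - ∫ a, f₃ a ∂μ + ∫ a, f₄ a ∂μ - ∫ a, f₅ a ∂μ =
      ∫ a, (f₁ a - f₂ a - f₃ a + f₄ a - f₅ a) ∂μ := by
  have h₁₂ : Integrable (fun a => f₁ a - f₂ a) μ := h₁.sub h₂
  have h₁₃ : Integrable (fun a => f₁ a - f₂ a - f₃ a) μ := h₁₂.sub h₃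
  have h₁₄ : Integrable (fun a => f₁ a - f₂ a - f₃ a + f₄ a) μ := h₁₃.add h₄
  rw [integral_sub h₁₄ h₅, integral_add h₁₃ h₄, integral_sub h₁₂ h₃, integral_sub h₁ h₂]

/-- Second-order remainder of the integral part of the quantity of interest. -/
theorem exists_integral_remainder (hP : P.IsSmooth) {ell : ℝ → Triple nx nu np × Vec ng → ℝ}
    (hell : Smooth P.t₀ P.t_f ell) (zbar w : P.Z) (gbar : P.G) :
    ∃ C, 0 ≤ C ∧ ∀ (g : P.G) (z : P.Z), ‖g - gbar‖ ≤ 1 → ‖z - zbar‖ ≤ 1 →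
      |∫ t, ell t (yAt z t, g t (yAt z t)) ∂P.μ -
        ∫ t, ell t (yAt zbar t, gbar t (yAt zbar t)) ∂P.μ -
        ∫ t, fderiv ℝ (fun y => ell t (y, gbar t y)) (yAt zbar t) (yAt (z - zbar) t) ∂P.μ +
        ∫ t, (costate w t ⬝ᵥ (P.nemDefect zbar gbar z g t).1 +
          (P.nemDefect zbar gbar z g t).2 (yAt w t)) ∂P.μ -
        sensitivity hP hell zbar gbar w (g - gbar)| ≤ C * (‖z - zbar‖ + ‖g - gbar‖) ^ 2 := by
  obtain ⟨C₁, hC₁, H₁⟩ := exists_integrand_expansion hell zbar gbar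
  obtain ⟨C₂, hC₂, H₂⟩ := exists_nem_expansion hP zbar gbar
  refine ⟨(C₁ + ‖dotL nx‖ * ‖w‖ * C₂ + C₂ * ‖w‖) * P.μ.real univ, by positivity,
    fun g z hg hz => ?_⟩
  have hN := memLp_nemDefect hP zbar gbar z g
  have hE := hell.memLp_fderiv_comp gbar (memLp_yAt zbar)
  have i1 := (hell.memLp_comp g (memLp_yAt z)).integrable le_top
  have i2 := (hell.memLp_comp gbar (memLp_yAt zbar)).integrable le_top
  have i3 : Integrable (fun t => fderiv ℝ (fun y => ell t (y, gbar t y)) (yAt zbar t)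
      (yAt (z - zbar) t)) P.μ :=
    (MemLp_top.clm_apply hE (memLp_yAt (z - zbar))).integrable le_top
  have i4 : Integrable (fun t => costate w t ⬝ᵥ (P.nemDefect zbar gbar z g t).1 +
      (P.nemDefect zbar gbar z g t).2 (yAt w t)) P.μ :=
    ((MemLp_top.dotProduct (memLp_costate w) hN.fst).add
      (MemLp_top.clm_apply hN.snd (memLp_yAt w))).integrable le_top
  have i5 := (memLp_sensitivity hP hell zbar w gbar (g - gbar)).integrable le_top
  rw [sensitivity_apply, integral_sub_sub_add_sub i1 i2 i3 i4 i5]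
  set σ := (‖z - zbar‖ + ‖g - gbar‖) ^ 2
  have hσ : 0 ≤ σ := sq_nonneg _
  have hw0 := norm_nonneg w
  have hd0 := norm_nonneg (dotL nx)
  have pw : ∀ᵐ t ∂P.μ, ‖ell t (yAt z t, g t (yAt z t)) - ell t (yAt zbar t, gbar t (yAt zbar t)) -
      fderiv ℝ (fun y => ell t (y, gbar t y)) (yAt zbar t) (yAt (z - zbar) t) +
      (costate w t ⬝ᵥ (P.nemDefect zbar gbar z g t).1 +
        (P.nemDefect zbar gbar z g t).2 (yAt w t)) -
      (P.coeff ell zbar gbar w t ⬝ᵥ (g - gbar) t (yAt zbar t) +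
        P.d zbar gbar t ⬝ᵥ fderiv ℝ ((g - gbar) t) (yAt zbar t) (yAt w t))‖ ≤
      (C₁ + ‖dotL nx‖ * ‖w‖ * C₂ + C₂ * ‖w‖) * σ := by
    filter_upwards [H₁ g z hg hz, H₂ g z hg hz, ae_smoothAt hP gbar, pathAt_sub z zbar,
      ae_norm_pathAt_le w] with t h1 h2 h3 h4 h5
    have hy : yAt (z - zbar) t = yAt z t - yAt zbar t := congrArg Prod.fst h4
    set V := P.nemVar zbar gbar (g - gbar) t
    set N := P.nemDefect zbar gbar z g t
    have h2' : ‖N - V‖ ≤ C₂ * σ := h2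
    have b1 : ‖costate w t ⬝ᵥ (N - V).1‖ ≤ ‖dotL nx‖ * ‖w‖ * (C₂ * σ) := by
      refine (norm_dotProduct_le _ _).trans ?_
      have e1 := (norm_snd_le (pathAt w t)).trans h5
      have e2 := (norm_fst_le (N - V)).trans h2'
      exact mul_le_mul (mul_le_mul_of_nonneg_left e1 hd0) e2 (norm_nonneg _)
        (mul_nonneg hd0 hw0)
    have b2 : ‖(N - V).2 (yAt w t)‖ ≤ C₂ * σ * ‖w‖ :=
      (N - V).2.le_of_opNorm_le_of_le ((norm_snd_le (N - V)).trans h2')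
        ((norm_fst_le (pathAt w t)).trans h5)
    rw [h3.coeff_add_d_dotProduct, hy]
    have e : (N - V).1 = N.1 - V.1 := rfl
    have e' : (N - V).2 (yAt w t) = N.2 (yAt w t) - V.2 (yAt w t) := rfl
    rw [e, dotProduct_sub] at b1
    rw [e'] at b2
    refine le_trans (le_of_eq ?_) ((norm_add₃_le).trans ((add_le_add (add_le_add h1 b1) b2).trans
      (le_of_eq ?_)))
    · congr 1; ring
    · ring
  refine (norm_integral_le_of_norm_le_const pw).trans (le_of_eq ?_)
  ring

open Asymptotics in
/-- The derivative of the quantity of interest along a Lipschitz family of solutions. -/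
theorem hasFDerivAt_qoi (hP : P.IsSmooth) {ϕ : Vec nx × Vec np → ℝ} (hϕ : ContDiff ℝ 2 ϕ)
    {ell : ℝ → Triple nx nu np × Vec ng → ℝ} (hell : Smooth P.t₀ P.t_f ell) {zbar w : P.Z}
    {gbar : P.G} {sol : P.G → P.Z} (hsol : sol gbar = zbar) (hbar : psi hP zbar gbar = 0)
    (h : ∀ᶠ g in 𝓝 gbar, psi hP (sol g) g = 0) {C : ℝ}
    (hC : ∀ᶠ g in 𝓝 gbar, ‖sol g - zbar‖ ≤ C * ‖g - gbar‖)
    (hw : P.IsAdjoint ϕ ell zbar gbar w) :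
    HasFDerivAt (fun g => P.qoi ϕ ell (sol g) g) (sensitivity hP hell zbar gbar w) gbar := by
  have hO : (fun g => sol g - zbar) =O[𝓝 gbar] fun g => g - gbar := .of_bound C hC
  have hend : (fun g => endPt (sol g) - endPt zbar) =O[𝓝 gbar] fun g => g - gbar := by
    refine IsBigO.trans ?_ hO
    refine ((P.endPtL).isBigO_comp (fun g => sol g - zbar) (𝓝 gbar)).congr_left fun g => ?_
    rw [map_sub, endPtL_apply, endPtL_apply]
  have hsolT : Tendsto sol (𝓝 gbar) (𝓝 zbar) := by
    rw [tendsto_iff_norm_sub_tendsto_zero]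
    have h0 : Tendsto (fun g => C * ‖g - gbar‖) (𝓝 gbar) (𝓝 (C * ‖gbar - gbar‖)) :=
      ((continuous_id.sub continuous_const).norm.const_mul C).tendsto gbar
    rw [norm_sub_self_eq, mul_zero] at h0
    exact squeeze_zero' (.of_forall fun g => norm_nonneg _) hC h0
  have hendT : Tendsto (fun g => endPt (sol g)) (𝓝 gbar) (𝓝 (endPt zbar)) := by
    have := ((P.endPtL).continuous.tendsto zbar).comp hsolT
    rw [endPtL_apply] at this
    exact this.congr fun g => endPtL_apply _
  -- the terminal costs
  have r1 : (fun g => ϕ (endPt (sol g)) - ϕ (endPt zbar) -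
      fderiv ℝ ϕ (endPt zbar) (endPt (sol g) - endPt zbar)) =o[𝓝 gbar] fun g => g - gbar :=
    ((((hϕ.differentiable (by norm_num) (endPt zbar)).hasFDerivAt).isLittleO).comp_tendsto
      hendT).trans_isBigO hend
  have hφ1 : ContDiff ℝ 1 (fderiv ℝ P.φ) := hP.φ.fderiv_right (by norm_num)
  have r2 : (fun g => fderiv ℝ P.φ (endPt (sol g)) - fderiv ℝ P.φ (endPt zbar) -
      fderiv ℝ (fderiv ℝ P.φ) (endPt zbar) (endPt (sol g) - endPt zbar)) =o[𝓝 gbar]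
        fun g => g - gbar :=
    ((((hφ1.differentiable (by norm_num) (endPt zbar)).hasFDerivAt).isLittleO).comp_tendsto
      hendT).trans_isBigO hend
  have r3 := ((ContinuousLinearMap.apply ℝ ℝ (endPt w)).isBigO_comp _ _).trans_isLittleO r2
  -- the integrals
  obtain ⟨K, hK, H⟩ := exists_integral_remainder hP hell zbar w gbar
  set rem : P.G → ℝ := fun g =>
    ∫ t, ell t (yAt (sol g) t, g t (yAt (sol g) t)) ∂P.μ -
        ∫ t, ell t (yAt zbar t, gbar t (yAt zbar t)) ∂P.μ -
        ∫ t, fderiv ℝ (fun y => ell t (y, gbar t y)) (yAt zbar t) (yAt (sol g - zbar) t) ∂P.μ +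
        ∫ t, (costate w t ⬝ᵥ (P.nemDefect zbar gbar (sol g) g t).1 +
          (P.nemDefect zbar gbar (sol g) g t).2 (yAt w t)) ∂P.μ -
        sensitivity hP hell zbar gbar w (g - gbar) with hrem
  have r4 : rem =o[𝓝 gbar] fun g => g - gbar := by
    have b1 : ∀ᶠ g in 𝓝 gbar, ‖g - gbar‖ ≤ 1 := by
      filter_upwards [Metric.closedBall_mem_nhds gbar one_pos] with g hg
      rwa [← dist_eq_norm]
    have b2 : ∀ᶠ g in 𝓝 gbar, ‖sol g - zbar‖ ≤ 1 := by
      filter_upwards [hsolT (Metric.closedBall_mem_nhds zbar one_pos)] with g hg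
      rw [← dist_eq_norm]
      exact hg
    have b3 : rem =O[𝓝 gbar] fun g => ‖g - gbar‖ ^ 2 := by
      refine .of_bound (K * (C + 1) ^ 2) ?_
      filter_upwards [b1, b2, hC] with g h1 h2 h3
      have e : (‖sol g - zbar‖ + ‖g - gbar‖) ^ 2 ≤ ((C + 1) * ‖g - gbar‖) ^ 2 :=
        pow_le_pow_left₀ (add_nonneg (norm_nonneg _) (norm_nonneg _))
          (by linarith) 2
      calc ‖rem g‖ ≤ _ := H g (sol g) h1 h2
        _ ≤ K * ((C + 1) * ‖g - gbar‖) ^ 2 := mul_le_mul_of_nonneg_left e hK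
        _ = K * (C + 1) ^ 2 * ‖‖g - gbar‖ ^ 2‖ := by
          rw [norm_pow, norm_norm, mul_pow]; ring
    exact b3.trans_isLittleO (isLittleO_pow_sub_sub gbar one_lt_two)
  -- By `duality`, the remainder of the quantity of interest is the sum of three small terms.
  refine .of_isLittleO (((r1.add r4).add r3).congr' ?_ .rfl)
  filter_upwards [h] with g hg
  have key := duality (ϕ := ϕ) hP hell hbar hg hw
  have e : endPt (sol g - zbar) = endPt (sol g) - endPt zbar := by
    rw [← endPtL_apply, map_sub, endPtL_apply, endPtL_apply]
  rw [e] at key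
  simp only [hrem, qoi, hsol, ContinuousLinearMap.apply_apply]
  linarith

end Problem

namespace Problem

variable {nx nu np ng : ℕ} {P : Problem nx nu np ng}

/-! ### The solution mapping -/

/-- The linearization of `ψ` as an isomorphism. -/
def linEquiv (hP : P.IsSmooth) {z : P.Z} {g : P.G} (hSO : P.SecondOrder z g) :
    P.Z ≃L[ℝ] P.Dyn × (Vec nx × Vec np) :=
  ContinuousLinearEquiv.ofBijective (lin hP z g)
    (LinearMap.ker_eq_bot.2 (lin_bijective hP hSO).1)
    (LinearMap.range_eq_top.2 (lin_bijective hP hSO).2)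

/-- The optimality system is uniquely solvable near `z̄`, and the solution is Lipschitz at `ḡ`. -/
theorem exists_lipschitz_solution (hP : P.IsSmooth) {zbar : P.Z} {gbar : P.G}
    (hKKT : P.IsKKT zbar gbar) (hSO : P.SecondOrder zbar gbar) :
    ∃ r > 0, ∃ C, ∃ sol : P.G → P.Z, sol gbar = zbar ∧ ∀ᶠ g in 𝓝 gbar,
      sol g ∈ Metric.ball zbar r ∧ P.IsKKT (sol g) g ∧
      (∀ z ∈ Metric.ball zbar r, P.IsKKT z g → z = sol g) ∧
      ‖sol g - zbar‖ ≤ C * ‖g - gbar‖ := by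
  have h0 := (psi_eq_zero_iff hP zbar gbar).2 hKKT
  obtain ⟨r, hr, C, sol, h1, h2⟩ := exists_locally_unique_solution (linEquiv hP hSO)
    (ψ := psi hP) h0 (fun c hc => exists_psi_strict hP zbar gbar hc)
    (exists_psi_lipschitz hP zbar gbar h0)
  simp only [psi_eq_zero_iff, dist_eq_norm] at h2
  exact ⟨r, hr, C, sol, h1, h2⟩

theorem exists_isSolutionMap (hP : P.IsSmooth) {zbar : P.Z} {gbar : P.G}
    (hKKT : P.IsKKT zbar gbar) (hSO : P.SecondOrder zbar gbar) :
    ∃ sol : P.G → P.Z, P.IsSolutionMap zbar gbar sol := by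
  obtain ⟨r, hr, C, sol, h1, h2⟩ := exists_lipschitz_solution hP hKKT hSO
  exact ⟨sol, h1, _, h2, _, Metric.ball_mem_nhds zbar hr,
    fun g hg => ⟨hg.1, hg.2.1, hg.2.2.1⟩⟩

/-- Every solution mapping agrees near `ḡ` with the one of `exists_lipschitz_solution`, whose values
tend to `z̄` and hence lie in the neighbourhood `V` of uniqueness; so it is Lipschitz at `ḡ`. -/
theorem IsSolutionMap.exists_norm_sub_le (hP : P.IsSmooth) {zbar : P.Z} {gbar : P.G}
    (hKKT : P.IsKKT zbar gbar) (hSO : P.SecondOrder zbar gbar) {sol : P.G → P.Z}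
    (hsol : P.IsSolutionMap zbar gbar sol) :
    ∃ C, ∀ᶠ g in 𝓝 gbar, P.IsKKT (sol g) g ∧ ‖sol g - zbar‖ ≤ C * ‖g - gbar‖ := by
  obtain ⟨-, U, hU, V, hV, H⟩ := hsol
  obtain ⟨r, hr, C, sol', h1, h2⟩ := exists_lipschitz_solution hP hKKT hSO
  have hT : Tendsto sol' (𝓝 gbar) (𝓝 zbar) := by
    rw [tendsto_iff_norm_sub_tendsto_zero]
    have h0 : Tendsto (fun g => C * ‖g - gbar‖) (𝓝 gbar) (𝓝 (C * ‖gbar - gbar‖)) :=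
      ((continuous_id.sub continuous_const).norm.const_mul C).tendsto gbar
    rw [norm_sub_self_eq, mul_zero] at h0
    exact squeeze_zero' (.of_forall fun g => norm_nonneg _) (h2.mono fun g hg => hg.2.2.2) h0
  refine ⟨C, ?_⟩
  filter_upwards [hU, hT hV, h2] with g hg hg' h
  have e := (H g hg).2.2 (sol' g) hg' h.2.1
  exact ⟨(H g hg).2.1, e ▸ h.2.2.2⟩

/-- The adjoint equations are uniquely solvable, since their operator is the linearization. -/
theorem existsUnique_isAdjoint (hP : P.IsSmooth) {ϕ : Vec nx × Vec np → ℝ}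
    {ell : ℝ → Triple nx nu np × Vec ng → ℝ} (hell : Smooth P.t₀ P.t_f ell) {z : P.Z} {g : P.G}
    (hSO : P.SecondOrder z g) : ∃! w : P.Z, P.IsAdjoint ϕ ell z g w := by
  simp only [← lin_eq_adjointData_iff hP hell]
  exact (lin_bijective hP hSO).existsUnique _

/-! ### The sensitivity bound -/

theorem _root_.OCP.abs_dotProduct_le {ι : Type*} [Fintype ι] {v w e : ι → ℝ}
    (h : ∀ i, |w i| ≤ e i) : |v ⬝ᵥ w| ≤ absVec v ⬝ᵥ e := by
  refine (Finset.abs_sum_le_sum_abs _ _).trans (Finset.sum_le_sum fun i _ => ?_)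
  rw [abs_mul]
  exact mul_le_mul_of_nonneg_left (h i) (abs_nonneg _)

theorem _root_.OCP.abs_dotProduct_mulVec_le {ι κ : Type*} [Fintype ι] [Fintype κ] {v : ι → ℝ}
    {M E : Matrix ι κ ℝ} {w : κ → ℝ} (h : ∀ i j, |M i j| ≤ E i j) :
    |v ⬝ᵥ (M *ᵥ w)| ≤ absVec v ⬝ᵥ (E *ᵥ absVec w) :=
  abs_dotProduct_le fun i => (Finset.abs_sum_le_sum_abs _ _).trans
    (Finset.sum_le_sum fun j _ => by
      rw [abs_mul]; exact mul_le_mul_of_nonneg_right (h i j) (abs_nonneg _))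

theorem _root_.OCP.integrable_absVec_dotProduct {α : Type*} [MeasurableSpace α] {μ : Measure α}
    {n : ℕ} {v : α → Vec n} (hv : MemLp v ∞ μ) {e : α → Vec n}
    (he : ∀ i, Integrable (fun a => e a i) μ) :
    Integrable (fun a => absVec (v a) ⬝ᵥ e a) μ :=
  integrable_finsetSum _ fun i _ => (he i).mul_of_top_right (memLp_pi_iff.1 hv i).abs

theorem _root_.OCP.integrable_absVec_dotProduct_mulVec {α : Type*} [MeasurableSpace α]
    {μ : Measure α} {m n : ℕ} {v : α → Vec m} {w : α → Vec n} (hv : MemLp v ∞ μ)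
    (hw : MemLp w ∞ μ) {E : α → Matrix (Fin m) (Fin n) ℝ}
    (hE : ∀ i j, Integrable (fun a => E a i j) μ) :
    Integrable (fun a => absVec (v a) ⬝ᵥ (E a *ᵥ absVec (w a))) μ :=
  integrable_absVec_dotProduct hv fun i => (integrable_finsetSum Finset.univ fun j _ =>
    (hE i j).mul_of_top_left (memLp_pi_iff.1 hw j).abs :
      Integrable (fun _ => ∑ _, _) μ)

/-- A directional derivative in terms of partial Jacobians. -/
theorem _root_.OCP.fderiv_triple_eq {m : ℕ} (γ : Triple nx nu np → Vec m) (y v : Triple nx nu np) :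
    fderiv ℝ γ y v = jac γ y (dirX nx nu np) *ᵥ v.1 + jac γ y (dirU nx nu np) *ᵥ v.2.1 +
      jac γ y (dirP nx nu np) *ᵥ v.2.2 := by
  rw [← clm_triple_eq_sum]
  ext i
  simp [jac, Matrix.mulVec, dotProduct, mul_comm]

theorem _root_.OCP.jac_sub {E ι : Type*} [NormedAddCommGroup E] [NormedSpace ℝ E] {m : ℕ}
    {F G : E → Vec m} {y : E} (hF : DifferentiableAt ℝ F y) (hG : DifferentiableAt ℝ G y)
    (e : ι → E) (i : Fin m) (j : ι) : jac (F - G) y e i j = jac F y e i j - jac G y e i j := by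
  simp [jac, fderiv_sub hF hG]

/-- The sensitivity formula, estimated term by term: `g` enters through its value and its Jacobians
along the reference trajectory only. -/
theorem abs_sensitivity_le (hP : P.IsSmooth) {ell : ℝ → Triple nx nu np × Vec ng → ℝ}
    (hell : Smooth P.t₀ P.t_f ell) (zbar w : P.Z) (gbar gstar : P.G) {ε : ℝ → Fin ng → ℝ}
    {εx : ℝ → Matrix (Fin ng) (Fin nx) ℝ} {εu : ℝ → Matrix (Fin ng) (Fin nu) ℝ}
    {εp : ℝ → Matrix (Fin ng) (Fin np) ℝ} (iε : ∀ i, Integrable (fun t => ε t i) P.μ)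
    (ix : ∀ i j, Integrable (fun t => εx t i j) P.μ)
    (iu : ∀ i j, Integrable (fun t => εu t i j) P.μ)
    (ip : ∀ i j, Integrable (fun t => εp t i j) P.μ)
    (hε : ∀ᵐ t ∂P.μ, ∀ i, |gbar t (yAt zbar t) i - gstar t (yAt zbar t) i| ≤ ε t i)
    (hx : ∀ᵐ t ∂P.μ, ∀ i j, |jac (gbar t) (yAt zbar t) (dirX nx nu np) i j -
      jac (gstar t) (yAt zbar t) (dirX nx nu np) i j| ≤ εx t i j)
    (hu : ∀ᵐ t ∂P.μ, ∀ i j, |jac (gbar t) (yAt zbar t) (dirU nx nu np) i j -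
      jac (gstar t) (yAt zbar t) (dirU nx nu np) i j| ≤ εu t i j)
    (hp : ∀ᵐ t ∂P.μ, ∀ i j, |jac (gbar t) (yAt zbar t) (dirP nx nu np) i j -
      jac (gstar t) (yAt zbar t) (dirP nx nu np) i j| ≤ εp t i j) :
    |sensitivity hP hell zbar gbar w (gbar - gstar)| ≤
      (∫ t, absVec (P.coeff ell zbar gbar w t) ⬝ᵥ ε t ∂P.μ) +
      ∫ t, (absVec (P.d zbar gbar t) ⬝ᵥ (εx t *ᵥ absVec (xAt w t)) +
        absVec (P.d zbar gbar t) ⬝ᵥ (εu t *ᵥ absVec (uAt w t)) +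
        absVec (P.d zbar gbar t) ⬝ᵥ (εp t *ᵥ absVec (par w))) ∂P.μ := by
  have hd := memLp_d hP zbar gbar
  have j1 := integrable_absVec_dotProduct (memLp_coeff hP hell zbar w gbar) iε
  have jx := integrable_absVec_dotProduct_mulVec hd (memLp_yAt w).fst ix
  have ju := integrable_absVec_dotProduct_mulVec hd (memLp_yAt w).snd.fst iu
  have jp := integrable_absVec_dotProduct_mulVec hd (memLp_const (par w)) ip
  have j2 : Integrable (fun t => absVec (P.d zbar gbar t) ⬝ᵥ (εx t *ᵥ absVec (xAt w t)) +
        absVec (P.d zbar gbar t) ⬝ᵥ (εu t *ᵥ absVec (uAt w t)) +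
        absVec (P.d zbar gbar t) ⬝ᵥ (εp t *ᵥ absVec (par w))) P.μ := (jx.add ju).add jp
  rw [sensitivity_apply, ← integral_add j1 j2]
  refine norm_integral_le_of_norm_le (G := ℝ) (j1.add j2) ?_
  filter_upwards [hε, hx, hu, hp, ae_smoothAt hP gbar, ae_smoothAt hP gstar]
    with t h1 h2 h3 h4 s s'
  have hb := s.g.differentiable (by norm_num) (yAt zbar t)
  have hs := s'.g.differentiable (by norm_num) (yAt zbar t)
  have hj : ∀ {κ : Type} (e : κ → Triple nx nu np) (i : Fin ng) (j : κ),
      jac ((gbar - gstar) t) (yAt zbar t) e i j =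
        jac (gbar t) (yAt zbar t) e i j - jac (gstar t) (yAt zbar t) e i j := fun e i j =>
    jac_sub hb hs e i j
  rw [fderiv_triple_eq, dotProduct_add, dotProduct_add]
  refine norm_add_le_of_le (abs_dotProduct_le h1) (norm_add₃_le.trans
    (add_le_add (add_le_add ?_ ?_) ?_))
  · exact abs_dotProduct_mulVec_le fun i j => by rw [hj]; exact h2 i j
  · exact abs_dotProduct_mulVec_le fun i j => by rw [hj]; exact h3 i j
  · exact abs_dotProduct_mulVec_le fun i j => by rw [hj]; exact h4 i j

end Problem

end OCP

end


theorem mainTheorem5 {nx nu np ng : ℕ} (P : OCP.Problem nx nu np ng)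
    (ϕ : OCP.Vec nx × OCP.Vec np → ℝ) (ell : ℝ → OCP.Triple nx nu np × OCP.Vec ng → ℝ)
    (hP : P.IsSmooth) (hϕ : ContDiff ℝ 2 ϕ) (hell : OCP.Smooth P.t₀ P.t_f ell)
    (zbar : P.Z) (gbar : P.G) (hKKT : P.IsKKT zbar gbar) (hSO : P.SecondOrder zbar gbar) :
    (∃ sol : P.G → P.Z, P.IsSolutionMap zbar gbar sol) ∧
    (∃! w : P.Z, P.IsAdjoint ϕ ell zbar gbar w) ∧
    ∀ sol : P.G → P.Z, P.IsSolutionMap zbar gbar sol →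
      DifferentiableAt ℝ (fun g => P.qoi ϕ ell (sol g) g) gbar ∧
      ∀ w : P.Z, P.IsAdjoint ϕ ell zbar gbar w →
      ∀ (gstar : P.G) (ε : ℝ → Fin ng → ℝ) (εx : ℝ → Matrix (Fin ng) (Fin nx) ℝ)
        (εu : ℝ → Matrix (Fin ng) (Fin nu) ℝ) (εp : ℝ → Matrix (Fin ng) (Fin np) ℝ),
      (∀ i, MeasureTheory.Integrable (fun t => ε t i) P.μ) →
      (∀ i j, MeasureTheory.Integrable (fun t => εx t i j) P.μ) →
      (∀ i j, MeasureTheory.Integrable (fun t => εu t i j) P.μ) →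
      (∀ i j, MeasureTheory.Integrable (fun t => εp t i j) P.μ) →
      (∀ᵐ t ∂P.μ, ∀ i,
        |gbar t (OCP.Problem.yAt zbar t) i - gstar t (OCP.Problem.yAt zbar t) i| ≤ ε t i) →
      (∀ᵐ t ∂P.μ, ∀ i j,
        |OCP.jac (gbar t) (OCP.Problem.yAt zbar t) (OCP.dirX nx nu np) i j
          - OCP.jac (gstar t) (OCP.Problem.yAt zbar t) (OCP.dirX nx nu np) i j| ≤ εx t i j) →
      (∀ᵐ t ∂P.μ, ∀ i j,
        |OCP.jac (gbar t) (OCP.Problem.yAt zbar t) (OCP.dirU nx nu np) i j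
          - OCP.jac (gstar t) (OCP.Problem.yAt zbar t) (OCP.dirU nx nu np) i j| ≤ εu t i j) →
      (∀ᵐ t ∂P.μ, ∀ i j,
        |OCP.jac (gbar t) (OCP.Problem.yAt zbar t) (OCP.dirP nx nu np) i j
          - OCP.jac (gstar t) (OCP.Problem.yAt zbar t) (OCP.dirP nx nu np) i j| ≤ εp t i j) →
      |fderiv ℝ (fun g => P.qoi ϕ ell (sol g) g) gbar (gbar - gstar)| ≤
        (∫ t, OCP.absVec (P.coeff ell zbar gbar w t) ⬝ᵥ ε t ∂P.μ) +
        ∫ t, (OCP.absVec (P.d zbar gbar t) ⬝ᵥ (εx t *ᵥ OCP.absVec (OCP.Problem.xAt w t))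
          + OCP.absVec (P.d zbar gbar t) ⬝ᵥ (εu t *ᵥ OCP.absVec (OCP.Problem.uAt w t))
          + OCP.absVec (P.d zbar gbar t) ⬝ᵥ (εp t *ᵥ OCP.absVec (OCP.Problem.par w))) ∂P.μ := by
  refine ⟨OCP.Problem.exists_isSolutionMap hP hKKT hSO,
    OCP.Problem.existsUnique_isAdjoint hP hell hSO, fun sol hsol => ?_⟩
  have h0 := (OCP.Problem.psi_eq_zero_iff hP zbar gbar).2 hKKT
  obtain ⟨C, hC⟩ := hsol.exists_norm_sub_le hP hKKT hSO
  have hD : ∀ w, P.IsAdjoint ϕ ell zbar gbar w →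
      HasFDerivAt (fun g => P.qoi ϕ ell (sol g) g)
        (OCP.Problem.sensitivity hP hell zbar gbar w) gbar :=
    fun w hw => OCP.Problem.hasFDerivAt_qoi hP hϕ hell hsol.1 h0
      (hC.mono fun g hg => (OCP.Problem.psi_eq_zero_iff hP (sol g) g).2 hg.1)
      (hC.mono fun g hg => hg.2) hw
  obtain ⟨w₀, hw₀, -⟩ := OCP.Problem.existsUnique_isAdjoint (ϕ := ϕ) hP hell hSO
  refine ⟨(hD w₀ hw₀).differentiableAt, fun w hw gstar ε εx εu εp iε ix iu ip hε hx hu hp => ?_⟩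
  rw [(hD w hw).fderiv]
  exact OCP.Problem.abs_sensitivity_le hP hell zbar w gbar gstar iε ix iu ip hε hx hu hp
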